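/- Let $n\ge 1$, $R\ge 1$, $\Omega=(-R,R)^n\subset\mathbb R^n$, $\mathbf x=(x_1,\dots,x_{n-1},z)$ (so $x_n=z$), $\Gamma_+=\{\mathbf x\in\partial\Omega: z=R\}$. Let $H^2_{0,\#}(\Omega)$ be the space of complex valued $w\in H^2(\Omega)$ with $w|_{\partial\Omega}=0$ and $\partial_\nu w|_{\Gamma_+}=0$ (in the sense of traces); a vector function belongs to it if every component does. Coefficients. Let $0<\mu_1\le\mu_2$ and $A\in\mathbb R$. Denote by $\mathcal A=\mathcal A(\mu_1,\mu_2,n,R,A)$ the set of all real $(a_{ij})_{i,j=1}^n$ with $a_{ij}\in C^1(\overline\Omega)$, $a_{ij}=a_{ji}$ and $\mu_1|\xi|^2\le\sum_{i,j}a_{ij}(\mathbf x)\xi_i\xi_j\le\mu_2|\xi|^2$ for all $\mathbf x\in\overline\Omega$, $\xi\in\mathbb R^n$, with $a_{in}(\mathbf x)=0$ for $\mathbf x\in\partial\Omega\setminus\{z=\pm R\}$ and $i\ne n$, and with $\max_{ij}\|a_{ij}\|_{C^1(\overline\Omega)}\le A$. Put $L_0u=\sum_{i,j}a_{ij}u_{x_ix_j}$.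 For real $b_j,c,\mathbf n\in C(\overline\Omega)$ put $Lu=L_0u+\sum_i b_iu_{x_i}+cu$, applied componentwise to vector functions. Matrices. For $0<\underline k<\overline k$ let $k_0=(\underline k+\overline k)/2$, and let $(\Psi_m)_{m\ge1}$ be the Gram–Schmidt orthonormalization in $L^2(\underline k,\overline k)$ of the functions $(k-k_0)^{m-1}e^{k-k_0}$, $m\ge 1$. For $N\ge1$ let $D_N$ and $S_N$ be the $N\times N$ matrices with entries $$d_{mr}=\int_{\underline k}^{\overline k}\Psi_m\Psi_r'\,dk,\qquad s_{mr}=\int_{\underline k}^{\overline k}\bigl(k^2\Psi_r'(k)+2k\Psi_r(k)\bigr)\Psi_m(k)\,dk .$$ Claim. There are numbers $p_0>1$, $\lambda_0>1$, $C_3>0$, depending only on $\mu_1,\mu_2,n,R,A$, such that the following two statements hold. (i) ($p_0$ and $\lambda_0$ are admissible in the Carleman estimate for $L_0$ with $b=3R$.) For every $p\ge p_0$ there is $C_2>0$, depending only on $\mu_1,\mu_2,n,R,A,p$, such that for all $(a_{ij})\in\mathcal A$, all $\lambda\ge\lambda_0$ and all $u\in H^2_{0,\#}(\Omega)$ $$\int_\Omega|L_0u|^2e^{2\lambda(z+3R)^p}\,d\mathbf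 x\ \ge\ C_2\lambda\int_\Omega\bigl(|\nabla u|^2+\lambda^2|u|^2\bigr)e^{2\lambda(z+3R)^p}\,d\mathbf x .$$ (ii) For all real $B,C,M$, all $0<\underline k<\overline k$ and all integers $N\ge1$ there is $\lambda_1\ge\lambda_0$, depending only on $\mu_1,\mu_2,n,R,A,B,C,M,\underline k,\overline k,N$, such that for all $(a_{ij})\in\mathcal A$ and all real $b_j,c,\mathbf n\in C(\overline\Omega)$ with $\max_j\|b_j\|_{C(\overline\Omega)}\le B$, $\|c\|_{C(\overline\Omega)}\le C$, $\|\mathbf n\|_{C(\overline\Omega)}\le M$, all $\lambda\ge\lambda_1$ and all $N$-dimensional complex vector functions $W\in H^2_{0,\#}(\Omega)$ $$\int_\Omega\bigl|LW+D_N^{-1}S_N\mathbf n^2W\bigr|^2e^{2\lambda(z+3R)^{p_0}}\,d\mathbf x\ \ge\ C_3\lambda\int_\Omega\bigl(|\nabla W|^2+\lambda^2|W|^2\bigr)e^{2\lambda(z+3R)^{p_0}}\,d\mathbf x .$$ -/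

import Mathlib

open MeasureTheory Filter Topology
open scoped ContDiff

noncomputable section

namespace Carleman

/-! Geometry. The ambient space is `ℝⁿ` with `n = d + 1`; its points are functions
`x : Fin (d + 1) → ℝ` and the distinguished variable `z` is the last coordinate. -/

/-- The open cube `(-R, R)ⁿ`. -/
def cube (n : ℕ) (R : ℝ) : Set (Fin n → ℝ) := {x | ∀ i, x i ∈ Set.Ioo (-R) R}

/-- The closed cube `[-R, R]ⁿ`. -/
def closedCube (n : ℕ) (R : ℝ) : Set (Fin n → ℝ) := {x | ∀ i, x i ∈ Set.Icc (-R) R}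

/-- The last coordinate `z` of a point. -/
def zc {d : ℕ} (x : Fin (d + 1) → ℝ) : ℝ := x (Fin.last d)

/-- The classical partial derivative with respect to the `k`-th coordinate. -/
def pd {n : ℕ} {F : Type*} [NormedAddCommGroup F] [NormedSpace ℝ F]
    (k : Fin n) (f : (Fin n → ℝ) → F) (x : Fin n → ℝ) : F :=
  fderiv ℝ f x (Pi.single k 1)

/-- The norm of `C(closure Ω)` for the cube `Ω` (of functions continuous on the closed cube). -/
def cNorm {n : ℕ} (R : ℝ) (f : (Fin n → ℝ) → ℝ) : ℝ :=
  sSup ((fun x => |f x|) '' closedCube n R)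

/-- The norm of `C¹(closure Ω)` for the cube `Ω` (of functions that are `C¹` on the closed cube;
the supremum of a continuous derivative over `Ω` is that over the closure). -/
def c1Norm {n : ℕ} (R : ℝ) (f : (Fin n → ℝ) → ℝ) : ℝ :=
  cNorm R f + ∑ k, sSup ((fun x => |pd k f x|) '' cube n R)

/-! Sobolev functions. -/

/-- `g` is the weak (distributional) partial derivative `∂ₖ u` in the open set `Ω`. -/
def IsWeakDeriv {n : ℕ} (Ω : Set (Fin n → ℝ)) (k : Fin n) (u g : (Fin n → ℝ) → ℂ) : Prop :=
  ∀ ψ : (Fin n → ℝ) → ℝ, ContDiff ℝ ∞ ψ → HasCompactSupport ψ → tsupport ψ ⊆ Ω →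
    ∫ x in Ω, pd k ψ x • u x = - ∫ x in Ω, ψ x • g x

/-- A complex valued function of class `H²(Ω)` together with (representatives of) its weak
derivatives of orders one and two, which it determines almost everywhere in `Ω`.
`hess i j` is the second derivative with respect to the coordinates `i` and `j`. -/
structure H2 {n : ℕ} (Ω : Set (Fin n → ℝ)) where
  val : (Fin n → ℝ) → ℂ
  grad : Fin n → (Fin n → ℝ) → ℂ
  hess : Fin n → Fin n → (Fin n → ℝ) → ℂ
  memLp_val : MemLp val 2 (volume.restrict Ω)
  memLp_grad : ∀ i, MemLp (grad i) 2 (volume.restrict Ω)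
  memLp_hess : ∀ i j, MemLp (hess i j) 2 (volume.restrict Ω)
  weak_grad : ∀ i, IsWeakDeriv Ω i val (grad i)
  weak_hess : ∀ i j, IsWeakDeriv Ω j (grad i) (hess i j)

/-- `g` is the trace on the face `{xᵢ = s}` (`s = R` or `s = -R`) of the cube `(-R, R)ⁿ` of the
function `w ∈ H¹` with weak gradient `dw`: there are functions `φⱼ` that are `C¹` up to the
boundary, converge to `w` in `H¹` of the cube, and whose restrictions to the face converge to `g`
in `L²` of the face. The face is parametrized by the remaining `n - 1` coordinates. -/
def HasTrace {d : ℕ} (R : ℝ) (w : (Fin (d + 1) → ℝ) → ℂ)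
    (dw : Fin (d + 1) → (Fin (d + 1) → ℝ) → ℂ)
    (i : Fin (d + 1)) (s : ℝ) (g : (Fin d → ℝ) → ℂ) : Prop :=
  ∃ φ : ℕ → (Fin (d + 1) → ℝ) → ℂ,
    (∀ j, ContDiff ℝ 1 (φ j)) ∧
    Tendsto (fun j => eLpNorm (fun x => φ j x - w x) 2 (volume.restrict (cube (d + 1) R)))
      atTop (𝓝 0) ∧
    (∀ k, Tendsto
      (fun j => eLpNorm (fun x => pd k (φ j) x - dw k x) 2 (volume.restrict (cube (d + 1) R)))
      atTop (𝓝 0)) ∧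
    Tendsto
      (fun j => eLpNorm (fun y : Fin d → ℝ => φ j (i.insertNth (α := fun _ => ℝ) s y) - g y) 2
        (volume.restrict (cube d R)))
      atTop (𝓝 0)

/-- Membership in `H²_{0,#}(Ω)`, `Ω = (-R, R)ⁿ`: the function has zero trace on every face of the
cube, and its normal derivative `∂_z u` has zero trace on the face `Γ₊ = {z = R}`. -/
def H2.ZeroSharp {d : ℕ} {R : ℝ} (u : H2 (cube (d + 1) R)) : Prop :=
  (∀ i, HasTrace R u.val u.grad i R 0 ∧ HasTrace R u.val u.grad i (-R) 0) ∧
  HasTrace R (u.grad (Fin.last d)) (u.hess (Fin.last d)) (Fin.last d) R 0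

/-! The elliptic operators. -/

/-- The principal part `L₀ u = ∑ a_ij u_{x_i x_j}`. -/
def opL0 {n : ℕ} {Ω : Set (Fin n → ℝ)} (a : Fin n → Fin n → (Fin n → ℝ) → ℝ)
    (u : H2 Ω) (x : Fin n → ℝ) : ℂ :=
  ∑ i, ∑ j, (a i j x : ℂ) * u.hess i j x

/-- The full operator `L u = L₀ u + ∑ b_i u_{x_i} + c u`. -/
def opL {n : ℕ} {Ω : Set (Fin n → ℝ)} (a : Fin n → Fin n → (Fin n → ℝ) → ℝ)
    (b : Fin n → (Fin n → ℝ) → ℝ) (c : (Fin n → ℝ) → ℝ)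
    (u : H2 Ω) (x : Fin n → ℝ) : ℂ :=
  opL0 a u x + ∑ i, (b i x : ℂ) * u.grad i x + (c x : ℂ) * u.val x

/-- The hypotheses on the principal coefficients: of class `C¹` up to the boundary, symmetric,
uniformly elliptic with constants `μ₁, μ₂`, with `a_in = 0` (`i ≠ n`) on `∂Ω \ {z = ±R}`, and
with `max_ij ‖a_ij‖` in `C¹(closure Ω)` at most `A`. -/
structure PrincipalCoeff (d : ℕ) (R μ₁ μ₂ A : ℝ)
    (a : Fin (d + 1) → Fin (d + 1) → (Fin (d + 1) → ℝ) → ℝ) : Prop where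
  contDiffOn : ∀ i j, ContDiffOn ℝ 1 (a i j) (closedCube (d + 1) R)
  symm : ∀ x ∈ closedCube (d + 1) R, ∀ i j, a i j x = a j i x
  elliptic : ∀ x ∈ closedCube (d + 1) R, ∀ ξ : Fin (d + 1) → ℝ,
    μ₁ * ∑ i, ξ i ^ 2 ≤ ∑ i, ∑ j, a i j x * ξ i * ξ j ∧
    ∑ i, ∑ j, a i j x * ξ i * ξ j ≤ μ₂ * ∑ i, ξ i ^ 2
  lateral : ∀ x ∈ frontier (cube (d + 1) R), zc x ≠ R → zc x ≠ -R →
    ∀ i, i ≠ Fin.last d → a i (Fin.last d) x = 0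
  norm_le : ∀ i j, c1Norm R (a i j) ≤ A

/-- The Carleman weight `exp(2 lam (z + 3R)^p)`. -/
def weight {d : ℕ} (R p lam : ℝ) (x : Fin (d + 1) → ℝ) : ℝ :=
  Real.exp (2 * lam * (zc x + 3 * R) ^ p)

/-! The special orthonormal basis of `L²(k₁, k₂)` and the matrices built from it.
Indices start at `0`, so that index `m` here is the index `m + 1` of the mathematics. -/

/-- The functions `(k - k₀)^m exp(k - k₀)`, `k₀ = (k₁ + k₂) / 2`. -/
def phi (k₁ k₂ : ℝ) (m : ℕ) (k : ℝ) : ℝ :=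
  (k - (k₁ + k₂) / 2) ^ m * Real.exp (k - (k₁ + k₂) / 2)

/-- The inner product of `L²(k₁, k₂)`. -/
def ip (k₁ k₂ : ℝ) (f g : ℝ → ℝ) : ℝ := ∫ k in k₁..k₂, f k * g k

/-- The Gram-Schmidt orthogonalization of the sequence `phi` in `L²(k₁, k₂)`. -/
def gs (k₁ k₂ : ℝ) (m : ℕ) : ℝ → ℝ :=
  phi k₁ k₂ m - ∑ i : Fin m,
    (ip k₁ k₂ (phi k₁ k₂ m) (gs k₁ k₂ i) / ip k₁ k₂ (gs k₁ k₂ i) (gs k₁ k₂ i)) • gs k₁ k₂ i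
termination_by m
decreasing_by all_goals exact i.2

/-- The Gram-Schmidt orthonormalization of the sequence `phi` in `L²(k₁, k₂)`. -/
def Psi (k₁ k₂ : ℝ) (m : ℕ) : ℝ → ℝ :=
  (Real.sqrt (ip k₁ k₂ (gs k₁ k₂ m) (gs k₁ k₂ m)))⁻¹ • gs k₁ k₂ m

/-- The matrix `D_N`. -/
def matD (k₁ k₂ : ℝ) (N : ℕ) : Matrix (Fin N) (Fin N) ℝ :=
  Matrix.of fun m r => ∫ k in k₁..k₂, Psi k₁ k₂ m k * deriv (Psi k₁ k₂ r) k

/-- The matrix `S_N`. -/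
def matS (k₁ k₂ : ℝ) (N : ℕ) : Matrix (Fin N) (Fin N) ℝ :=
  Matrix.of fun m r => ∫ k in k₁..k₂,
    (k ^ 2 * deriv (Psi k₁ k₂ r) k + 2 * k * Psi k₁ k₂ r k) * Psi k₁ k₂ m k

/-- The `m`-th component of `L W + D_N⁻¹ S_N 𝐧² W` at the point `x`. -/
def opSystem {n : ℕ} {Ω : Set (Fin n → ℝ)} (k₁ k₂ : ℝ) {N : ℕ}
    (a : Fin n → Fin n → (Fin n → ℝ) → ℝ) (b : Fin n → (Fin n → ℝ) → ℝ)
    (c nn : (Fin n → ℝ) → ℝ) (W : Fin N → H2 Ω) (x : Fin n → ℝ) (m : Fin N) : ℂ :=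
  opL a b c (W m) x +
    ∑ r, (((matD k₁ k₂ N)⁻¹ * matS k₁ k₂ N) m r : ℂ) * (nn x : ℂ) ^ 2 * (W r).val x

end Carleman

end

/-! Conjugation with the weight is the core. Put φ = (z + 3R)^p and v = e^{λφ} w for smooth real w.
Since φ depends on z alone, e^{λφ} L₀w equals ∑ a_ij ∂_ij v − 2λφ' (a∇v)_n + (λ²φ'² − λφ'') a_nn v
(`conj_classicalL0`). Completing squares bounds its square below by the divergence of an explicit
field (`carlemanField`) plus 2λφ'' (a_nn ⟨a∇v, ∇v⟩ + (λφ')² a_nn² v²), up to errors that carry a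
derivative of some a_ij, or φ''', or (λφ'')² v² (`carleman_divergence_eq`, `pointwise_carleman`).
Because φ'/φ'' = (z + 3R)/(p − 1) ≤ 4R/(p − 1), every error is a small multiple of the main term
once p is large, uniformly in λ ≥ 1 (`wt_bounds`); half of the main term absorbs them. This fixes
p₀.

For w vanishing on the boundary, the flux of the field is zero through the lateral faces, because
a_in = 0 there, and has the good sign at z = −R. At z = R it is at least −K ∫ |∂_z w|²
(`sum_integral_pd_carlemanField`). The constant K may depend on λ, since that term disappears in a
limit with λ fixed.

The passage from smooth functions to H² uses sine polynomials, which satisfy the Dirichlet condition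
but not the Neumann one. They are complete in L² by Stone–Weierstrass
(`ae_eq_zero_of_integral_sineFun`), the Laplacian is solvable among them, and ∑ ∫ |∂_ij w|² = ∫
|Δw|² (`integral_mixed_sq`). So if sine polynomials s_m tend to Δu and Δw_m = s_m, then w_m
converges in H², and comparison of sine coefficients shows that the limit is u
(`RealH20.exists_approximation`). The zero trace of ∂_z u on {z = R} makes the remaining boundary
term tend to zero (`tendsto_trace_zero`). Real and imaginary parts are treated separately; the
coefficients are real.

For the system, the lower order terms are bounded pointwise by a constant times |∇W|² + |W|², with
the matrix entering only through a bound on its entries. The factor λ on the other side absorbs them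
once λ ≥ λ₁ (`carleman_system`). -/

noncomputable section

namespace Carleman

/-! ### Topology and measure of the cube. -/

section Cube

variable {n : ℕ} {R : ℝ}

lemma cube_eq_pi : cube n R = Set.pi Set.univ fun _ => Set.Ioo (-R) R := by
  ext x; simp [cube]

lemma closedCube_eq_Icc : closedCube n R = Set.Icc (fun _ => -R) (fun _ => R) := by
  ext x; simp [closedCube, Pi.le_def, forall_and]

lemma isOpen_cube : IsOpen (cube n R) := by
  rw [cube_eq_pi]; exact isOpen_set_pi Set.finite_univ fun _ _ => isOpen_Ioo

lemma measurableSet_cube : MeasurableSet (cube n R) := isOpen_cube.measurableSet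

lemma isCompact_closedCube : IsCompact (closedCube n R) := by
  rw [closedCube_eq_Icc]; exact isCompact_Icc

lemma cube_subset_closedCube : cube n R ⊆ closedCube n R :=
  fun _ hx i => Set.Ioo_subset_Icc_self (hx i)

lemma cube_ae_eq_closedCube : cube n R =ᵐ[volume] closedCube n R := by
  rw [cube_eq_pi, closedCube_eq_Icc]; exact Measure.univ_pi_Ioo_ae_eq_Icc

lemma volume_cube_lt_top : volume (cube n R) < ⊤ :=
  (measure_mono cube_subset_closedCube).trans_lt isCompact_closedCube.measure_lt_top

instance : IsFiniteMeasure (volume.restrict (cube n R)) :=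
  ⟨by simpa using volume_cube_lt_top⟩

lemma frontier_cube (hR : 0 < R) : frontier (cube n R) = closedCube n R \ cube n R := by
  rw [isOpen_cube.frontier_eq, cube_eq_pi, closure_pi_set]
  congr 1
  ext x
  simp [closedCube, closure_Ioo (show -R ≠ R by linarith), Pi.le_def, forall_and]

lemma ae_restrict_cube_of_forall {P : (Fin n → ℝ) → Prop} (h : ∀ x ∈ cube n R, P x) :
    ∀ᵐ x ∂(volume.restrict (cube n R)), P x :=
  (ae_restrict_iff' measurableSet_cube).2 (ae_of_all _ h)

/-- A function continuous on the closed cube is bounded there. -/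
lemma exists_bound {f : (Fin n → ℝ) → ℝ} (hf : ContinuousOn f (closedCube n R)) :
    ∃ K, 0 ≤ K ∧ ∀ x ∈ closedCube n R, |f x| ≤ K := by
  obtain ⟨K, hK⟩ := isCompact_closedCube.exists_bound_of_continuousOn hf
  exact ⟨max K 0, le_max_right _ _, fun x hx => (hK x hx).trans (le_max_left _ _)⟩

lemma aestronglyMeasurable_of_continuousOn {f : (Fin n → ℝ) → ℝ}
    (hf : ContinuousOn f (closedCube n R)) :
    AEStronglyMeasurable f (volume.restrict (cube n R)) :=
  (hf.mono cube_subset_closedCube).aestronglyMeasurable measurableSet_cube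

lemma memLp_of_continuousOn {f : (Fin n → ℝ) → ℝ} (hf : ContinuousOn f (closedCube n R))
    (p : ENNReal) : MemLp f p (volume.restrict (cube n R)) := by
  obtain ⟨K, -, hK⟩ := exists_bound hf
  exact MemLp.of_bound (aestronglyMeasurable_of_continuousOn hf) K
    (ae_restrict_cube_of_forall fun x hx => hK x (cube_subset_closedCube hx))

lemma integrableOn_of_continuousOn {f : (Fin n → ℝ) → ℝ}
    (hf : ContinuousOn f (closedCube n R)) : IntegrableOn f (cube n R) :=
  memLp_one_iff_integrable.1 (memLp_of_continuousOn hf 1)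

end Cube

/-! ### Calculus rules for partial derivatives. -/

section PartialDerivative

variable {n : ℕ} {k : Fin n} {x : Fin n → ℝ} {f g : (Fin n → ℝ) → ℝ}

lemma pd_add (hf : DifferentiableAt ℝ f x) (hg : DifferentiableAt ℝ g x) :
    pd k (fun y => f y + g y) x = pd k f x + pd k g x := by
  simp [pd, fderiv_fun_add hf hg]

lemma pd_sub (hf : DifferentiableAt ℝ f x) (hg : DifferentiableAt ℝ g x) :
    pd k (fun y => f y - g y) x = pd k f x - pd k g x := by
  simp [pd, fderiv_fun_sub hf hg]

lemma pd_mul (hf : DifferentiableAt ℝ f x) (hg : DifferentiableAt ℝ g x) :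
    pd k (fun y => f y * g y) x = pd k f x * g x + f x * pd k g x := by
  simp [pd, fderiv_fun_mul hf hg]; ring

lemma pd_const_mul (c : ℝ) (hf : DifferentiableAt ℝ f x) :
    pd k (fun y => c * f y) x = c * pd k f x := by
  simp [pd, fderiv_const_mul hf]

lemma pd_sum {ι : Type*} (s : Finset ι) {F : ι → (Fin n → ℝ) → ℝ}
    (hF : ∀ i ∈ s, DifferentiableAt ℝ (F i) x) :
    pd k (fun y => ∑ i ∈ s, F i y) x = ∑ i ∈ s, pd k (F i) x := by
  simp [pd, fderiv_fun_sum hF]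

lemma pd_pow_two (hf : DifferentiableAt ℝ f x) :
    pd k (fun y => f y ^ 2) x = 2 * f x * pd k f x := by
  simp only [pow_two]; rw [pd_mul hf hf]; ring

/-- The partial derivative of a function of one coordinate. -/
lemma pd_comp_apply {g : ℝ → ℝ} {g' : ℝ} {j : Fin n} (hg : HasDerivAt g g' (x j)) :
    pd k (fun y => g (y j)) x = if k = j then g' else 0 := by
  have h1 : HasFDerivAt (fun y : Fin n → ℝ => y j)
    (ContinuousLinearMap.proj (R := ℝ) (φ := fun _ : Fin n => ℝ) j) x := hasFDerivAt_apply j x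
  have := (hg.comp_hasFDerivAt x h1).fderiv
  simp only [pd]
  rw [show (fun y : Fin n → ℝ => g (y j)) = g ∘ fun y => y j from rfl, this]
  by_cases h : k = j
  · subst h; simp
  · simp [h, Ne.symm h]

lemma pd_eq_deriv_update (hf : DifferentiableAt ℝ f x) :
    pd k f x = deriv (fun t => f (Function.update x k t)) (x k) := by
  have h1 := hasDerivAt_update (𝕜 := ℝ) x k (x k)
  have h2 : DifferentiableAt ℝ f (Function.update x k (x k)) := by simpa using hf
  have := (h2.hasFDerivAt.comp_hasDerivAt (x k) h1).deriv
  rw [show (fun t => f (Function.update x k t)) = f ∘ Function.update x k from rfl, this]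
  simp [pd]

lemma contDiff_pd {m : WithTop ℕ∞} (hf : ContDiff ℝ (m + 1) f) : ContDiff ℝ m (pd k f) :=
  (hf.fderiv_right le_rfl).clm_apply contDiff_const

lemma contDiff_infty_pd (hf : ContDiff ℝ ∞ f) : ContDiff ℝ ∞ (pd k f) :=
  contDiff_pd (by simpa using hf)

lemma pd_comm (hf : ContDiff ℝ 2 f) (i j : Fin n) (x : Fin n → ℝ) :
    pd i (pd j f) x = pd j (pd i f) x := by
  have hd : DifferentiableAt ℝ (fderiv ℝ f) x :=
    (hf.fderiv_right (m := 1) (by norm_num)).differentiable (by norm_num) x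
  have h : ∀ a b : Fin n, pd a (pd b f) x
      = fderiv ℝ (fderiv ℝ f) x (Pi.single a 1) (Pi.single b 1) := by
    intro a b
    change fderiv ℝ (fun y => fderiv ℝ f y (Pi.single b 1)) x (Pi.single a 1) = _
    rw [fderiv_clm_apply hd (by fun_prop)]
    simp
  rw [h, h]
  exact (hf.contDiffAt.isSymmSndFDerivAt (by simp)) _ _

end PartialDerivative

/-! ### The divergence theorem on the cube. -/

section Divergence

variable {d : ℕ} {R : ℝ}

lemma insertNth_mem_closedCube (i : Fin (d + 1)) {s : ℝ} (hs : s ∈ Set.Icc (-R) R)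
    {y : Fin d → ℝ} (hy : y ∈ closedCube d R) :
    i.insertNth (α := fun _ => ℝ) s y ∈ closedCube (d + 1) R := by
  intro j
  rcases Fin.eq_self_or_eq_succAbove i j with rfl | ⟨l, rfl⟩
  · simpa using hs
  · simpa using hy l

/-- Integration of a partial derivative over the cube. -/
lemma integral_pd (hR : 0 < R) (i : Fin (d + 1)) {f : (Fin (d + 1) → ℝ) → ℝ}
    (hc : ContinuousOn f (closedCube (d + 1) R))
    (hd : ∀ x ∈ cube (d + 1) R, DifferentiableAt ℝ f x)
    (hi : IntegrableOn (pd i f) (cube (d + 1) R)) :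
    ∫ x in cube (d + 1) R, pd i f x =
      (∫ y in cube d R, f (i.insertNth (α := fun _ => ℝ) R y)) -
        ∫ y in cube d R, f (i.insertNth (α := fun _ => ℝ) (-R) y) := by
  classical
  -- The field has `f` as its `i`-th component and zero elsewhere, so its divergence is the single
  -- derivative wanted and only two faces contribute. The theorem speaks of closed boxes; open and
  -- closed cubes differ by a null set.
  have key := integral_divergence_of_hasFDerivAt_off_countable' (E := ℝ)
    (fun _ : Fin (d + 1) => -R) (fun _ => R) (fun _ => by linarith)
    (fun j => if j = i then f else 0) (fun j x => if j = i then fderiv ℝ f x else 0) ∅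
    Set.countable_empty
    (by
      intro j
      rw [← closedCube_eq_Icc]
      by_cases h : j = i
      · simpa [h] using hc
      · simp only [if_neg h]; exact continuousOn_const)
    (by
      intro x hx j
      have hx' : x ∈ cube (d + 1) R := by rw [cube_eq_pi]; exact hx.1
      by_cases h : j = i
      · simpa [h] using (hd x hx').hasFDerivAt
      · simp only [if_neg h]; exact hasFDerivAt_const (0 : ℝ) x)
    (by
      have : (fun x => ∑ j, (if j = i then fderiv ℝ f x else 0) (Pi.single j 1)) = pd i f := by
        ext x
        rw [Finset.sum_eq_single i]
        · simp [pd]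
        · intro b _ hb; simp [hb]
        · simp
      rw [this, ← closedCube_eq_Icc]
      exact hi.congr_set_ae cube_ae_eq_closedCube.symm)
  have e1 : (fun x => ∑ j, (if j = i then fderiv ℝ f x else 0) (Pi.single j 1)) = pd i f := by
    ext x
    rw [Finset.sum_eq_single i]
    · simp [pd]
    · intro b _ hb; simp [hb]
    · simp
  rw [e1, ← closedCube_eq_Icc, ← setIntegral_congr_set cube_ae_eq_closedCube] at key
  rw [key, Finset.sum_eq_single i]
  · have e2 : Set.Icc ((fun _ : Fin (d + 1) => -R) ∘ i.succAbove)
      ((fun _ : Fin (d + 1) => R) ∘ i.succAbove) = closedCube d R := by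
      rw [closedCube_eq_Icc]; rfl
    rw [e2, ← setIntegral_congr_set cube_ae_eq_closedCube,
      ← setIntegral_congr_set cube_ae_eq_closedCube]
    simp
  · intro b _ hb; simp [hb]
  · simp

end Divergence

/-! ### Pointwise algebra of the Carleman inequality. -/

section PointwiseAlgebra

open Finset

variable {ι : Type*} [Fintype ι]

/-- The error terms in the pointwise Carleman identity. -/
def carlemanError (l : ι) (a : ι → ι → ℝ) (D : ι → ι → ι → ℝ) (V : ι → ℝ) (v s₁ s₂ s₃ : ℝ) : ℝ :=
  - 4 * s₁ * (∑ i, (∑ k, D i l k * V k) * ∑ j, a i j * V j)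
  - 4 * s₁ * ((∑ k, a l k * V k) * ∑ i, ∑ j, D i i j * V j)
  + 2 * s₁ * ((∑ i, D i l i) * ∑ i, ∑ j, a i j * V i * V j)
  + 2 * s₁ * (∑ i, a l i * ∑ j, ∑ k, D i j k * V j * V k)
  - 2 * s₁ ^ 3 * ((∑ i, (D i l l * a l i + a l l * D i l i)) * v ^ 2)
  - 4 * s₃ * (a l l * v * ∑ k, a l k * V k)
  - 4 * s₂ * (v * ∑ i, D i l l * ∑ j, a i j * V j)
  - 4 * s₂ * (a l l * v * ∑ i, ∑ j, D i i j * V j)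

/-- The divergence of the Carleman vector field, as computed by the product rule. -/
lemma carleman_divergence_eq [DecidableEq ι] (l : ι) (a : ι → ι → ℝ) (D : ι → ι → ι → ℝ) (H : ι → ι → ℝ)
    (V : ι → ℝ) (v s₁ s₂ s₃ T E Q : ℝ) (G T' E' G' : ι → ℝ)
    (ha : ∀ i j, a i j = a j i) (hH : ∀ i j, H i j = H j i)
    (hT : T = ∑ k, a l k * V k) (hG : ∀ i, G i = ∑ j, a i j * V j)
    (hE : E = ∑ i, ∑ j, a i j * V i * V j) (hQ : Q = ∑ i, ∑ j, a i j * H i j)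
    (hT' : ∀ i, T' i = ∑ k, (D i l k * V k + a l k * H i k))
    (hG' : ∀ i, G' i = ∑ j, (D i i j * V j + a i j * H i j))
    (hE' : ∀ i, E' i = ∑ j, ∑ k, (D i j k * V j * V k + a j k * H i j * V k
      + a j k * V j * H i k)) :
    ∑ i, ((-4 * ((if i = l then s₂ else 0) * T * G i + s₁ * T' i * G i + s₁ * T * G' i)
      + 2 * ((if i = l then s₂ else 0) * a l i * E + s₁ * D i l i * E + s₁ * a l i * E' i)
      - 2 * (3 * s₁ ^ 2 * (if i = l then s₂ else 0) * a l l * a l i * v ^ 2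
          + s₁ ^ 3 * D i l l * a l i * v ^ 2
          + s₁ ^ 3 * a l l * D i l i * v ^ 2 + s₁ ^ 3 * a l l * a l i * (2 * v * V i)))
      - 4 * ((if i = l then s₃ else 0) * a l l * v * G i + s₂ * D i l l * v * G i
          + s₂ * a l l * V i * G i + s₂ * a l l * v * G' i))
    = - 4 * s₁ * T * Q - 4 * s₁ ^ 3 * a l l * T * v - 4 * s₂ * a l l * v * Q
      - 4 * s₂ * T ^ 2 - 2 * s₂ * a l l * E - 6 * s₁ ^ 2 * s₂ * a l l ^ 2 * v ^ 2
      + carlemanError l a D V v s₁ s₂ s₃ := by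
  have hGl : G l = T := by rw [hG, hT]
  have e1 : ∑ i, (if i = l then s₂ else 0) * G i = s₂ * T := by simp [hGl]
  have e2 : ∑ i, (if i = l then s₂ else 0) * a l i = s₂ * a l l := by simp
  have e3 : ∑ i, (if i = l then s₃ else 0) * G i = s₃ * T := by simp [hGl]
  have e4 : ∑ i, a l i * V i = T := hT.symm
  have e5 : ∑ i, V i * G i = E := by
    rw [hE]; refine sum_congr rfl fun i _ => ?_
    rw [hG, mul_sum]; exact sum_congr rfl fun j _ => by ring
  have e6 : ∑ i, G' i = Q + ∑ i, ∑ j, D i i j * V j := by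
    simp only [hG', sum_add_distrib]; rw [hQ]; ring
  -- The decisive cancellation: here and in `e8` the same Hessian sum appears, once and twice
  -- respectively. The weights −4s₁ and 2s₁ cancel it, so second derivatives survive only through Q.
  have e7 : ∑ i, T' i * G i = (∑ i, (∑ k, D i l k * V k) * ∑ j, a i j * V j)
      + ∑ i, (∑ k, a l k * H i k) * G i := by
    rw [← sum_add_distrib]; refine sum_congr rfl fun i _ => ?_
    rw [hT', sum_add_distrib, hG]; ring
  have e8 : ∑ i, a l i * E' i = (∑ i, a l i * ∑ j, ∑ k, D i j k * V j * V k)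
      + 2 * ∑ i, (∑ k, a l k * H i k) * G i := by
    have h1 : ∀ i, E' i = (∑ j, ∑ k, D i j k * V j * V k) + 2 * ∑ j, H i j * G j := by
      intro i
      rw [hE']
      simp only [sum_add_distrib]
      have h2 : ∑ j, ∑ k, a j k * H i j * V k = ∑ j, H i j * G j := by
        refine sum_congr rfl fun j _ => ?_
        rw [hG, mul_sum]; exact sum_congr rfl fun k _ => by ring
      have h3 : ∑ j, ∑ k, a j k * V j * H i k = ∑ j, H i j * G j := by
        rw [sum_comm, ← h2]
        refine sum_congr rfl fun j _ => sum_congr rfl fun k _ => ?_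
        rw [ha k j]; ring
      rw [h2, h3]; ring
    have h4 : ∑ i, (∑ k, a l k * H i k) * G i = ∑ i, a l i * ∑ j, H i j * G j := by
      simp only [sum_mul, mul_sum]
      rw [sum_comm]
      refine sum_congr rfl fun j _ => sum_congr rfl fun k _ => ?_
      rw [hH k j]; ring
    rw [h4, mul_sum, ← sum_add_distrib]
    refine sum_congr rfl fun i _ => ?_
    rw [h1]; ring
  have e9 : ∑ i, D i l l * G i = ∑ i, D i l l * ∑ j, a i j * V j := by simp only [hG]
  have e10 : ∑ i, (D i l l * a l i + a l l * D i l i)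
      = ∑ i, D i l l * a l i + a l l * ∑ i, D i l i := by
    rw [sum_add_distrib, mul_sum]
  -- Each summand becomes a scalar independent of i times one of the summands evaluated in
  -- `e1`–`e9`.
  have hsplit : ∀ i, ((-4 * ((if i = l then s₂ else 0) * T * G i + s₁ * T' i * G i + s₁ * T * G' i)
      + 2 * ((if i = l then s₂ else 0) * a l i * E + s₁ * D i l i * E + s₁ * a l i * E' i)
      - 2 * (3 * s₁ ^ 2 * (if i = l then s₂ else 0) * a l l * a l i * v ^ 2
          + s₁ ^ 3 * D i l l * a l i * v ^ 2
          + s₁ ^ 3 * a l l * D i l i * v ^ 2 + s₁ ^ 3 * a l l * a l i * (2 * v * V i)))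
      - 4 * ((if i = l then s₃ else 0) * a l l * v * G i + s₂ * D i l l * v * G i
          + s₂ * a l l * V i * G i + s₂ * a l l * v * G' i))
      = (-4 * T) * ((if i = l then s₂ else 0) * G i) + (-4 * s₁) * (T' i * G i)
        + (-4 * s₁ * T) * G' i + (2 * E) * ((if i = l then s₂ else 0) * a l i)
        + (2 * s₁ * E) * D i l i + (2 * s₁) * (a l i * E' i)
        + (-6 * s₁ ^ 2 * a l l * v ^ 2) * ((if i = l then s₂ else 0) * a l i)
        + (-2 * s₁ ^ 3 * v ^ 2) * (D i l l * a l i)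
        + (-2 * s₁ ^ 3 * a l l * v ^ 2) * D i l i
        + (-4 * s₁ ^ 3 * a l l * v) * (a l i * V i)
        + (-4 * a l l * v) * ((if i = l then s₃ else 0) * G i)
        + (-4 * s₂ * v) * (D i l l * G i) + (-4 * s₂ * a l l) * (V i * G i)
        + (-4 * s₂ * a l l * v) * G' i := fun i => by ring
  simp only [hsplit, sum_add_distrib, ← mul_sum]
  rw [e1, e2, e3, e4, e5, e6, e7, e8, e9]
  unfold carlemanError
  rw [e10, ← hT, ← hE]
  ring

lemma abs_sum_mul_le {a V : ι → ℝ} {A : ℝ} (ha : ∀ i, |a i| ≤ A) :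
    |∑ i, a i * V i| ≤ A * ∑ i, |V i| := by
  rw [mul_sum]
  refine (abs_sum_le_sum_abs _ _).trans (sum_le_sum fun i _ => ?_)
  rw [abs_mul]
  exact mul_le_mul_of_nonneg_right (ha i) (abs_nonneg _)

lemma abs_sum_le_card_mul {f : ι → ℝ} {K : ℝ} (hf : ∀ i, |f i| ≤ K) :
    |∑ i, f i| ≤ Fintype.card ι * K := by
  refine (abs_sum_le_sum_abs _ _).trans ((sum_le_sum fun i _ => hf i).trans ?_)
  simp

lemma abs_quadratic_le {a : ι → ι → ℝ} {V : ι → ℝ} {A : ℝ} (hA : ∀ i j, |a i j| ≤ A) :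
    |∑ i, ∑ j, a i j * V i * V j| ≤ A * (∑ i, |V i|) ^ 2 := by
  have h : ∑ i, ∑ j, a i j * V i * V j = ∑ i, (∑ j, a i j * V j) * V i :=
    sum_congr rfl fun i _ => by rw [sum_mul]; exact sum_congr rfl fun j _ => by ring
  rw [h]
  refine (abs_sum_mul_le fun i => abs_sum_mul_le (hA i)).trans (le_of_eq (by ring))

/-- Each of the eight terms contains exactly two factors among the coefficients and their
derivatives, hence A²; a sum over an index not attached to V costs a factor card ι, and terms
without such a sum are enlarged by it. The numbers are 12 = 4 + 4 + 2 + 2, 4 = 2 · 2 and 8 = 4 + 4.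
-/
lemma abs_carlemanError_le (l : ι) {a : ι → ι → ℝ} {D : ι → ι → ι → ℝ} {V : ι → ℝ}
    {v s₁ s₂ s₃ A : ℝ} (hA : 0 ≤ A) (ha : ∀ i j, |a i j| ≤ A) (hD : ∀ k i j, |D k i j| ≤ A)
    (h₁ : 0 ≤ s₁) (h₂ : 0 ≤ s₂) (h₃ : 0 ≤ s₃) :
    |carlemanError l a D V v s₁ s₂ s₃| ≤ Fintype.card ι * A ^ 2 *
      (12 * s₁ * (∑ i, |V i|) ^ 2 + 4 * s₁ ^ 3 * v ^ 2 + 4 * s₃ * |v| * ∑ i, |V i|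
        + 8 * s₂ * |v| * ∑ i, |V i|) := by
  set S := ∑ i, |V i| with hS
  have hS0 : 0 ≤ S := sum_nonneg fun i _ => abs_nonneg _
  set N : ℝ := ((Fintype.card ι : ℕ) : ℝ) with hN
  have hN1 : 1 ≤ N := by
    have : 0 < Fintype.card ι := Fintype.card_pos_iff.2 ⟨l⟩
    rw [hN]; exact_mod_cast this
  have b0 : |∑ k, a l k * V k| ≤ A * S := abs_sum_mul_le (ha l)
  have bD : |∑ i, ∑ j, D i i j * V j| ≤ N * (A * S) :=
    abs_sum_le_card_mul fun i => abs_sum_mul_le (hD i i)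
  have b1 : |∑ i, (∑ k, D i l k * V k) * ∑ j, a i j * V j| ≤ N * (A * S * (A * S)) :=
    abs_sum_le_card_mul fun i => by
      rw [abs_mul]
      exact mul_le_mul (abs_sum_mul_le (hD i l)) (abs_sum_mul_le (ha i)) (abs_nonneg _)
        (by positivity)
  have b2 : |(∑ k, a l k * V k) * ∑ i, ∑ j, D i i j * V j| ≤ A * S * (N * (A * S)) := by
    rw [abs_mul]; exact mul_le_mul b0 bD (abs_nonneg _) (by positivity)
  have b3 : |(∑ i, D i l i) * ∑ i, ∑ j, a i j * V i * V j| ≤ N * A * (A * S ^ 2) := by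
    rw [abs_mul]
    exact mul_le_mul (abs_sum_le_card_mul fun i => hD i l i) (abs_quadratic_le ha) (abs_nonneg _)
      (by positivity)
  have b4 : |∑ i, a l i * ∑ j, ∑ k, D i j k * V j * V k| ≤ N * (A * (A * S ^ 2)) :=
    abs_sum_le_card_mul fun i => by
      rw [abs_mul]
      exact mul_le_mul (ha l i) (abs_quadratic_le (hD i)) (abs_nonneg _) hA
  have b5 : |(∑ i, (D i l l * a l i + a l l * D i l i)) * v ^ 2| ≤ N * (A * A + A * A) * v ^ 2 := by
    rw [abs_mul, abs_of_nonneg (sq_nonneg v)]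
    refine mul_le_mul_of_nonneg_right (abs_sum_le_card_mul fun i => ?_) (sq_nonneg v)
    refine (abs_add_le _ _).trans (add_le_add ?_ ?_)
    · rw [abs_mul]; exact mul_le_mul (hD i l l) (ha l i) (abs_nonneg _) hA
    · rw [abs_mul]; exact mul_le_mul (ha l l) (hD i l i) (abs_nonneg _) hA
  have b6 : |a l l * v * ∑ k, a l k * V k| ≤ N * (A * |v| * (A * S)) := by
    rw [abs_mul, abs_mul]
    refine (mul_le_mul (mul_le_mul_of_nonneg_right (ha l l) (abs_nonneg _)) b0 (abs_nonneg _)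
      (by positivity)).trans (le_mul_of_one_le_left (by positivity) hN1)
  have b7 : |v * ∑ i, D i l l * ∑ j, a i j * V j| ≤ |v| * (N * (A * (A * S))) := by
    rw [abs_mul]
    refine mul_le_mul_of_nonneg_left (abs_sum_le_card_mul fun i => ?_) (abs_nonneg _)
    rw [abs_mul]
    exact mul_le_mul (hD i l l) (abs_sum_mul_le (ha i)) (abs_nonneg _) hA
  have b8 : |a l l * v * ∑ i, ∑ j, D i i j * V j| ≤ A * |v| * (N * (A * S)) := by
    rw [abs_mul, abs_mul]
    exact mul_le_mul (mul_le_mul_of_nonneg_right (ha l l) (abs_nonneg _)) bD (abs_nonneg _)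
      (by positivity)
  rw [abs_le] at b1 b2 b3 b4 b5 b6 b7 b8
  have h₁3 : 0 ≤ s₁ ^ 3 := by positivity
  unfold carlemanError
  rw [abs_le]
  constructor
  · linarith [mul_le_mul_of_nonneg_left b1.2 h₁, mul_le_mul_of_nonneg_left b2.2 h₁,
      mul_le_mul_of_nonneg_left b3.1 h₁, mul_le_mul_of_nonneg_left b4.1 h₁,
      mul_le_mul_of_nonneg_left b5.2 h₁3, mul_le_mul_of_nonneg_left b6.2 h₃,
      mul_le_mul_of_nonneg_left b7.2 h₂, mul_le_mul_of_nonneg_left b8.2 h₂]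
  · linarith [mul_le_mul_of_nonneg_left b1.1 h₁, mul_le_mul_of_nonneg_left b2.1 h₁,
      mul_le_mul_of_nonneg_left b3.2 h₁, mul_le_mul_of_nonneg_left b4.2 h₁,
      mul_le_mul_of_nonneg_left b5.1 h₁3, mul_le_mul_of_nonneg_left b6.1 h₃,
      mul_le_mul_of_nonneg_left b7.1 h₂, mul_le_mul_of_nonneg_left b8.1 h₂]

/-- The pointwise Carleman inequality. -/
lemma pointwise_carleman (l : ι) {a : ι → ι → ℝ} {D : ι → ι → ι → ℝ} {V : ι → ℝ}
    {v s₁ s₂ s₃ A δ μ f T E Q div : ℝ}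
    (hA : 0 ≤ A) (ha : ∀ i j, |a i j| ≤ A) (hD : ∀ k i j, |D k i j| ≤ A)
    (hμ : 0 < μ) (hll : μ ≤ a l l) (hEμ : μ * ∑ i, V i ^ 2 ≤ E)
    (h₁ : 0 ≤ s₁) (h₂ : 0 ≤ s₂) (h₃ : 0 ≤ s₃)
    (h12 : s₁ ≤ δ * s₂) (h31 : s₃ ≤ δ * (s₁ * s₂)) (h21 : s₂ ≤ δ * s₁ ^ 2) (h1 : 1 ≤ δ * s₁)
    (hδ0 : 0 ≤ δ) (hδ : 18 * (Fintype.card ι : ℝ) ^ 2 * A ^ 2 * δ ≤ μ ^ 2)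
    (hf : f = Q + s₁ ^ 2 * a l l * v - 2 * s₁ * T - s₂ * a l l * v)
    (hdiv : div = - 4 * s₁ * T * Q - 4 * s₁ ^ 3 * a l l * T * v - 4 * s₂ * a l l * v * Q
      - 4 * s₂ * T ^ 2 - 2 * s₂ * a l l * E - 6 * s₁ ^ 2 * s₂ * a l l ^ 2 * v ^ 2
      + carlemanError l a D V v s₁ s₂ s₃) :
    div + μ ^ 2 * s₂ * (∑ i, V i ^ 2 + s₁ ^ 2 * v ^ 2) ≤ f ^ 2 := by
  have herr := (abs_le.1 (abs_carlemanError_le l (V := V) (v := v) hA ha hD h₁ h₂ h₃)).2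
  set S := ∑ i, |V i| with hS
  have hS0 : 0 ≤ S := sum_nonneg fun i _ => abs_nonneg _
  set N : ℝ := ((Fintype.card ι : ℕ) : ℝ) with hN
  have hN1 : 1 ≤ N := by
    have : 0 < Fintype.card ι := Fintype.card_pos_iff.2 ⟨l⟩
    rw [hN]; exact_mod_cast this
  set g2 := ∑ i, V i ^ 2 with hg2
  have hg0 : 0 ≤ g2 := sum_nonneg fun i _ => sq_nonneg _
  -- Cauchy–Schwarz from the ℓ¹ to the ℓ² norm costs a second factor N, whence the square of the
  -- dimension in `hδ`.
  have hSg : S ^ 2 ≤ N * g2 := by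
    have := sq_sum_le_card_mul_sum_sq (s := univ) (f := fun i => |V i|)
    simpa [hS, hN, hg2] using this
  set Y := s₁ * |v| with hY
  have hY0 : 0 ≤ Y := by positivity
  have hY2 : s₁ ^ 2 * v ^ 2 = Y ^ 2 := by rw [hY, mul_pow, sq_abs]
  -- By the comparisons between s₁, s₂ and s₃, every error is δs₂ times a quadratic form in S and Y
  -- = s₁|v|, the quantities in the main term.
  have c1 : s₁ * S ^ 2 ≤ δ * s₂ * S ^ 2 := mul_le_mul_of_nonneg_right h12 (sq_nonneg _)
  have c2 : s₁ ^ 3 * v ^ 2 ≤ δ * s₂ * Y ^ 2 := by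
    rw [← hY2]
    have := mul_le_mul_of_nonneg_right h12 (show 0 ≤ s₁ ^ 2 * v ^ 2 by positivity)
    linarith [this]
  have c3 : s₃ * |v| * S ≤ δ * s₂ * (Y * S) := by
    have := mul_le_mul_of_nonneg_right h31 (show 0 ≤ |v| * S by positivity)
    rw [hY]; linarith [this]
  have c4 : s₂ * |v| * S ≤ δ * s₂ * (Y * S) := by
    have := mul_le_mul_of_nonneg_right h1 (show 0 ≤ s₂ * |v| * S by positivity)
    rw [hY]; linarith [this]
  have hll0 : 0 ≤ a l l := hμ.le.trans hll
  have hllA : a l l ^ 2 ≤ A ^ 2 := pow_le_pow_left₀ hll0 ((le_abs_self _).trans (ha l l)) 2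
  have c5 : (s₂ * a l l * v) ^ 2 ≤ A ^ 2 * (δ * s₂ * Y ^ 2) := by
    rw [← hY2]
    have h5 : s₂ ^ 2 * v ^ 2 ≤ δ * s₂ * (s₁ ^ 2 * v ^ 2) := by
      have := mul_le_mul_of_nonneg_right h21 (show 0 ≤ s₂ * v ^ 2 by positivity)
      linarith [this]
    calc (s₂ * a l l * v) ^ 2 = a l l ^ 2 * (s₂ ^ 2 * v ^ 2) := by ring
      _ ≤ A ^ 2 * (s₂ ^ 2 * v ^ 2) := mul_le_mul_of_nonneg_right hllA (by positivity)
      _ ≤ _ := mul_le_mul_of_nonneg_left h5 (by positivity)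
  have hYS : Y * S ≤ (Y ^ 2 + S ^ 2) / 2 := by nlinarith [sq_nonneg (Y - S)]
  have hds : 0 ≤ δ * s₂ := by positivity
  have hYS' := mul_le_mul_of_nonneg_left hYS hds
  have hNA : 0 ≤ N * A ^ 2 := by positivity
  -- After YS ≤ (Y² + S²)/2 the coefficients are 12 + 6 = 18 for S² and 4 + 6 = 10 for Y²; the
  -- square (s₂ a_ll v)² adds 1 to the latter. The constant 18 in `hδ` dominates all of them.
  have herr2 : carlemanError l a D V v s₁ s₂ s₃ + (s₂ * a l l * v) ^ 2
      ≤ μ ^ 2 * s₂ * (g2 + Y ^ 2) := by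
    have k1 : 12 * s₁ * S ^ 2 + 4 * s₁ ^ 3 * v ^ 2 + 4 * s₃ * |v| * S + 8 * s₂ * |v| * S
        ≤ δ * s₂ * (18 * S ^ 2 + 10 * Y ^ 2) := by linarith
    have k2 := mul_le_mul_of_nonneg_left k1 hNA
    have k3 : A ^ 2 * (δ * s₂ * Y ^ 2) ≤ N * A ^ 2 * (δ * s₂ * Y ^ 2) := by
      have : 0 ≤ A ^ 2 * (δ * s₂ * Y ^ 2) := by positivity
      linarith [le_mul_of_one_le_left this hN1]
    have k4 : 18 * S ^ 2 + 11 * Y ^ 2 ≤ 18 * N * (g2 + Y ^ 2) := by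
      have h6 : Y ^ 2 ≤ N * Y ^ 2 := le_mul_of_one_le_left (sq_nonneg Y) hN1
      linarith [sq_nonneg Y]
    have k5 := mul_le_mul_of_nonneg_left k4 (show 0 ≤ N * A ^ 2 * (δ * s₂) by positivity)
    have k6 := mul_le_mul_of_nonneg_right hδ (show 0 ≤ s₂ * (g2 + Y ^ 2) by positivity)
    linarith
  have hmainE : μ ^ 2 * s₂ * g2 ≤ s₂ * a l l * E := by
    have : μ * (μ * g2) ≤ a l l * E := mul_le_mul hll hEμ (by positivity) hll0
    have := mul_le_mul_of_nonneg_left this h₂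
    linarith
  have hmainY : μ ^ 2 * s₂ * Y ^ 2 ≤ s₁ ^ 2 * s₂ * a l l ^ 2 * v ^ 2 := by
    have : μ ^ 2 ≤ a l l ^ 2 := pow_le_pow_left₀ hμ.le hll 2
    have := mul_le_mul_of_nonneg_right this (show 0 ≤ s₂ * Y ^ 2 by positivity)
    rw [← hY2] at this ⊢
    linarith
  -- With X = Q + s₁² a_ll v, t = 2s₁T and q = s₂ a_ll v one has f = X − t − q, and f² minus the
  -- left side is (X + q)² + (t + q)². Compared with `div` this leaves twice the main term, of which
  -- `herr2` consumes one copy.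
  have hsq : -4 * s₁ * T * (Q + s₁ ^ 2 * a l l * v) - 4 * s₂ * a l l * v * (Q + s₁ ^ 2 * a l l * v)
      - (s₂ * a l l * v) ^ 2 ≤ f ^ 2 := by
    rw [hf]
    linarith only [sq_nonneg (Q + s₁ ^ 2 * a l l * v + s₂ * a l l * v),
      sq_nonneg (2 * s₁ * T + s₂ * a l l * v)]
  have hT2 : 0 ≤ s₂ * T ^ 2 := by positivity
  rw [hY2, hdiv]
  linarith

end PointwiseAlgebra

/-! ### Functions that are C¹ up to the boundary. -/

section ContDiffOnCube

variable {n : ℕ} {R : ℝ}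

lemma uniqueDiffOn_closedCube (hR : 0 < R) : UniqueDiffOn ℝ (closedCube n R) := by
  refine uniqueDiffOn_convex ?_ ⟨0, ?_⟩
  · rw [closedCube_eq_Icc]; exact convex_Icc _ _
  · refine interior_mono cube_subset_closedCube ?_
    rw [isOpen_cube.interior_eq]
    intro i; simp [hR]

lemma closedCube_mem_nhds {x : Fin n → ℝ} (hx : x ∈ cube n R) : closedCube n R ∈ 𝓝 x :=
  mem_of_superset (isOpen_cube.mem_nhds hx) cube_subset_closedCube

lemma differentiableAt_of_contDiffOn {f : (Fin n → ℝ) → ℝ}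
    (hf : ContDiffOn ℝ 1 f (closedCube n R)) {x : Fin n → ℝ} (hx : x ∈ cube n R) :
    DifferentiableAt ℝ f x :=
  (hf.differentiableOn one_ne_zero).differentiableAt (closedCube_mem_nhds hx)

/-- In the interior `pd` agrees with the derivative within the closed cube, which is continuous on a
compact set. At boundary points `pd` itself carries no information, so the bound is claimed on the
open cube only. -/
lemma exists_bound_pd (hR : 0 < R) {f : (Fin n → ℝ) → ℝ}
    (hf : ContDiffOn ℝ 1 f (closedCube n R)) (k : Fin n) :
    ∃ K, ∀ x ∈ cube n R, |pd k f x| ≤ K := by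
  have hc : ContinuousOn (fun x => fderivWithin ℝ f (closedCube n R) x (Pi.single k 1))
      (closedCube n R) :=
    (hf.continuousOn_fderivWithin (uniqueDiffOn_closedCube hR) le_rfl).clm_apply
      continuousOn_const
  obtain ⟨K, -, hK⟩ := exists_bound hc
  refine ⟨K, fun x hx => ?_⟩
  have := hK x (cube_subset_closedCube hx)
  rwa [fderivWithin_of_mem_nhds (closedCube_mem_nhds hx)] at this

lemma measurable_pd (k : Fin n) (f : (Fin n → ℝ) → ℝ) : Measurable (pd k f) :=
  measurable_fderiv_apply_const ℝ f _

lemma integrableOn_pd (hR : 0 < R) {f : (Fin n → ℝ) → ℝ}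
    (hf : ContDiffOn ℝ 1 f (closedCube n R)) (k : Fin n) :
    IntegrableOn (pd k f) (cube n R) := by
  obtain ⟨K, hK⟩ := exists_bound_pd hR hf k
  exact memLp_one_iff_integrable.1 (MemLp.of_bound (measurable_pd k f).aestronglyMeasurable K
    (ae_restrict_cube_of_forall hK))

lemma integral_pd_of_contDiffOn {d : ℕ} (hR : 0 < R) (i : Fin (d + 1))
    {f : (Fin (d + 1) → ℝ) → ℝ} (hf : ContDiffOn ℝ 1 f (closedCube (d + 1) R)) :
    ∫ x in cube (d + 1) R, pd i f x =
      (∫ y in cube d R, f (i.insertNth (α := fun _ => ℝ) R y)) -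
        ∫ y in cube d R, f (i.insertNth (α := fun _ => ℝ) (-R) y) :=
  integral_pd hR i hf.continuousOn (fun _ hx => differentiableAt_of_contDiffOn hf hx)
    (integrableOn_pd hR hf i)

lemma cNorm_nonneg (f : (Fin n → ℝ) → ℝ) : 0 ≤ cNorm R f :=
  Real.sSup_nonneg (by rintro _ ⟨x, -, rfl⟩; exact abs_nonneg _)

lemma abs_le_cNorm {f : (Fin n → ℝ) → ℝ} (hf : ContinuousOn f (closedCube n R))
    {x : Fin n → ℝ} (hx : x ∈ closedCube n R) : |f x| ≤ cNorm R f := by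
  obtain ⟨K, -, hK⟩ := exists_bound hf
  exact le_csSup ⟨K, by rintro _ ⟨y, hy, rfl⟩; exact hK y hy⟩ ⟨x, hx, rfl⟩

end ContDiffOnCube

/-! ### Pointwise bounds for the principal coefficients. -/

namespace PrincipalCoeff

variable {d : ℕ} {R μ₁ μ₂ A : ℝ} {a : Fin (d + 1) → Fin (d + 1) → (Fin (d + 1) → ℝ) → ℝ}

lemma abs_le (h : PrincipalCoeff d R μ₁ μ₂ A a) (i j : Fin (d + 1)) {x : Fin (d + 1) → ℝ}
    (hx : x ∈ closedCube (d + 1) R) : |a i j x| ≤ A := by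
  refine (abs_le_cNorm (h.contDiffOn i j).continuousOn hx).trans (le_trans ?_ (h.norm_le i j))
  refine le_add_of_nonneg_right (Finset.sum_nonneg fun k _ => Real.sSup_nonneg ?_)
  rintro _ ⟨x, -, rfl⟩; exact abs_nonneg _

/-- The real supremum of an unbounded set is 0 by convention, so boundedness of the derivative must
be known before the norm controls it. -/
lemma abs_pd_le (h : PrincipalCoeff d R μ₁ μ₂ A a) (hR : 0 < R) (k i j : Fin (d + 1))
    {x : Fin (d + 1) → ℝ} (hx : x ∈ cube (d + 1) R) : |pd k (a i j) x| ≤ A := by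
  obtain ⟨K, hK⟩ := exists_bound_pd hR (h.contDiffOn i j) k
  have h1 : |pd k (a i j) x| ≤ sSup ((fun x => |pd k (a i j) x|) '' cube (d + 1) R) :=
    le_csSup ⟨K, by rintro _ ⟨y, hy, rfl⟩; exact hK y hy⟩ ⟨x, hx, rfl⟩
  have h2 : sSup ((fun x => |pd k (a i j) x|) '' cube (d + 1) R)
      ≤ ∑ k, sSup ((fun x => |pd k (a i j) x|) '' cube (d + 1) R) :=
    Finset.single_le_sum (f := fun k => sSup ((fun x => |pd k (a i j) x|) '' cube (d + 1) R))
      (fun k _ => Real.sSup_nonneg (by rintro _ ⟨x, -, rfl⟩; exact abs_nonneg _))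
      (Finset.mem_univ k)
  exact h1.trans (h2.trans ((le_add_of_nonneg_left (cNorm_nonneg _)).trans (h.norm_le i j)))

lemma nonneg (h : PrincipalCoeff d R μ₁ μ₂ A a) (hR : 0 < R) : 0 ≤ A :=
  (abs_nonneg _).trans (h.abs_le 0 0 (x := 0) fun i => by simp [hR.le])

lemma le_last (h : PrincipalCoeff d R μ₁ μ₂ A a) {x : Fin (d + 1) → ℝ}
    (hx : x ∈ closedCube (d + 1) R) (l : Fin (d + 1)) : μ₁ ≤ a l l x := by
  have := (h.elliptic x hx (Pi.single l 1)).1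
  simpa [Pi.single_apply, Finset.sum_ite_eq, ite_pow] using this

end PrincipalCoeff

/-! ### The weight and its derivatives. -/

section Weights

variable {d : ℕ} {R p lam : ℝ}

/-- `lam φ'` for `φ = (z + 3R)^p`. -/
def wt₁ (R p lam : ℝ) (x : Fin (d + 1) → ℝ) : ℝ := lam * (p * (zc x + 3 * R) ^ (p - 1))

/-- `lam φ''` for `φ = (z + 3R)^p`. -/
def wt₂ (R p lam : ℝ) (x : Fin (d + 1) → ℝ) : ℝ :=
  lam * (p * ((p - 1) * (zc x + 3 * R) ^ (p - 1 - 1)))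

/-- `lam φ'''` for `φ = (z + 3R)^p`. -/
def wt₃ (R p lam : ℝ) (x : Fin (d + 1) → ℝ) : ℝ :=
  lam * (p * ((p - 1) * ((p - 1 - 1) * (zc x + 3 * R) ^ (p - 1 - 1 - 1))))

/-- `exp(lam φ)` for `φ = (z + 3R)^p`. -/
def expWt (R p lam : ℝ) (x : Fin (d + 1) → ℝ) : ℝ := Real.exp (lam * (zc x + 3 * R) ^ p)

lemma expWt_sq (x : Fin (d + 1) → ℝ) : expWt R p lam x ^ 2 = weight R p lam x := by
  rw [expWt, weight, ← Real.exp_nat_mul]; congr 1; push_cast; ring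

lemma two_mul_le_zc_add {x : Fin (d + 1) → ℝ} (hx : x ∈ closedCube (d + 1) R) :
    2 * R ≤ zc x + 3 * R := by
  have := (hx (Fin.last d)).1; unfold zc; linarith

lemma zc_add_le {x : Fin (d + 1) → ℝ} (hx : x ∈ closedCube (d + 1) R) :
    zc x + 3 * R ≤ 4 * R := by
  have := (hx (Fin.last d)).2; unfold zc; linarith

lemma contDiff_zc {m : WithTop ℕ∞} : ContDiff ℝ m (zc : (Fin (d + 1) → ℝ) → ℝ) :=
  contDiff_apply ℝ ℝ (Fin.last d)

lemma contDiffOn_rpow_zc (hR : 0 < R) (q : ℝ) :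
    ContDiffOn ℝ 1 (fun x : Fin (d + 1) → ℝ => (zc x + 3 * R) ^ q) (closedCube (d + 1) R) := by
  refine ContDiffOn.rpow_const_of_ne (contDiff_zc.add contDiff_const).contDiffOn fun x hx => ?_
  have := two_mul_le_zc_add hx
  linarith

lemma contDiffOn_wt₁ (hR : 0 < R) :
    ContDiffOn ℝ 1 (wt₁ R p lam : (Fin (d + 1) → ℝ) → ℝ) (closedCube (d + 1) R) :=
  contDiffOn_const.mul (contDiffOn_const.mul (contDiffOn_rpow_zc hR _))

lemma contDiffOn_wt₂ (hR : 0 < R) :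
    ContDiffOn ℝ 1 (wt₂ R p lam : (Fin (d + 1) → ℝ) → ℝ) (closedCube (d + 1) R) :=
  contDiffOn_const.mul (contDiffOn_const.mul (contDiffOn_const.mul (contDiffOn_rpow_zc hR _)))

lemma contDiffOn_expWt (hR : 0 < R) :
    ContDiffOn ℝ 1 (expWt R p lam : (Fin (d + 1) → ℝ) → ℝ) (closedCube (d + 1) R) :=
  (contDiffOn_const.mul (contDiffOn_rpow_zc hR _)).exp

lemma hasDerivAt_rpow_shift {t : ℝ} (ht : 0 < t + 3 * R) (q : ℝ) :
    HasDerivAt (fun t => (t + 3 * R) ^ q) (q * (t + 3 * R) ^ (q - 1)) t := by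
  have := ((hasDerivAt_id t).add_const (3 * R)).rpow_const (p := q) (Or.inl ht.ne')
  simpa using this

lemma pd_wt₁ {x : Fin (d + 1) → ℝ} (hx : 0 < zc x + 3 * R) (k : Fin (d + 1)) :
    pd k (wt₁ R p lam) x = if k = Fin.last d then wt₂ R p lam x else 0 :=
  pd_comp_apply (g := fun t => lam * (p * (t + 3 * R) ^ (p - 1)))
    (((hasDerivAt_rpow_shift hx (p - 1)).const_mul p).const_mul lam)

lemma pd_wt₂ {x : Fin (d + 1) → ℝ} (hx : 0 < zc x + 3 * R) (k : Fin (d + 1)) :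
    pd k (wt₂ R p lam) x = if k = Fin.last d then wt₃ R p lam x else 0 :=
  pd_comp_apply (g := fun t => lam * (p * ((p - 1) * (t + 3 * R) ^ (p - 1 - 1))))
    ((((hasDerivAt_rpow_shift hx (p - 1 - 1)).const_mul (p - 1)).const_mul p).const_mul lam)

lemma pd_expWt {x : Fin (d + 1) → ℝ} (hx : 0 < zc x + 3 * R) (k : Fin (d + 1)) :
    pd k (expWt R p lam) x
      = if k = Fin.last d then expWt R p lam x * wt₁ R p lam x else 0 :=
  pd_comp_apply (g := fun t => Real.exp (lam * (t + 3 * R) ^ p))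
    ((hasDerivAt_rpow_shift hx p).const_mul lam).exp

/-- Comparison of the derivatives of the weight. -/
lemma wt_bounds (hR : 1 ≤ R) (hp : 2 ≤ p) (hlam : 1 ≤ lam) {x : Fin (d + 1) → ℝ}
    (hx : x ∈ closedCube (d + 1) R) :
    lam ≤ wt₁ R p lam x ∧ lam ≤ wt₂ R p lam x ∧ 0 ≤ wt₃ R p lam x ∧
      wt₁ R p lam x ≤ 4 * R / (p - 1) * wt₂ R p lam x ∧
      wt₃ R p lam x ≤ 4 * R / (p - 1) * (wt₁ R p lam x * wt₂ R p lam x) ∧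
      wt₂ R p lam x ≤ 4 * R / (p - 1) * wt₁ R p lam x ^ 2 ∧
      1 ≤ 4 * R / (p - 1) * wt₁ R p lam x := by
  have hy2 := two_mul_le_zc_add hx
  have hy4 := zc_add_le hx
  unfold wt₁ wt₂ wt₃
  set y := zc x + 3 * R with hy
  have hy0 : 0 < y := by linarith
  have hy1 : 1 ≤ y := by linarith
  -- With r = y^(p−3) all powers in play become r times an integer power of y, and the comparisons
  -- become polynomial.
  set r := y ^ (p - 1 - 1 - 1) with hr
  have hr0 : 0 < r := Real.rpow_pos_of_pos hy0 _
  have e2 : y ^ (p - 1 - 1) = r * y := by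
    rw [hr, ← Real.rpow_add_one hy0.ne']; congr 1; ring
  have e1 : y ^ (p - 1) = r * y * y := by
    rw [← e2, ← Real.rpow_add_one hy0.ne']; congr 1; ring
  have g2 : 1 ≤ r * y := by rw [← e2]; exact Real.one_le_rpow hy1 (by linarith)
  have g1 : 1 ≤ r * y * y := by nlinarith
  rw [e1, e2]
  have hp1 : 0 < p - 1 := by linarith
  -- Although δ = 4R/(p − 1) is small, δp stays at least 1; this is what makes the threshold for λ
  -- independent of p.
  have hδ : 1 ≤ 4 * R / (p - 1) * p := by
    rw [div_mul_eq_mul_div, le_div_iff₀ hp1]; nlinarith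
  have hδ0 : 0 < 4 * R / (p - 1) := by positivity
  set δ := 4 * R / (p - 1) with hδdef
  have hδp : δ * (p - 1) = 4 * R := by rw [hδdef]; field_simp
  have hlam0 : 0 < lam := by linarith
  have hp0 : 0 < p := by linarith
  have q1 : 1 ≤ δ * (lam * (p * (r * y * y))) := by
    calc (1 : ℝ) ≤ (δ * p) * (lam * (r * y * y)) :=
          one_le_mul_of_one_le_of_one_le hδ (one_le_mul_of_one_le_of_one_le hlam g1)
      _ = _ := by ring
  -- Here y ≥ 2R ≥ 2, and Bernoulli's inequality gives y^p ≥ 2^p ≥ 1 + p.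
  have g3 : p ≤ r * y * y * y := by
    rw [← e1, ← Real.rpow_add_one hy0.ne', sub_add_cancel]
    have h2 : (2 : ℝ) ^ p ≤ y ^ p := Real.rpow_le_rpow (by norm_num) (by linarith) hp0.le
    have h3 := one_add_mul_self_le_rpow_one_add (s := 1) (by norm_num) (p := p) (by linarith)
    norm_num at h3
    linarith
  -- The quotients s₁s₂/s₃ and s₁²/s₂ are λp y^p divided by p − 2 and p − 1, so this one inequality
  -- yields both remaining comparisons.
  have q3 : p - 1 ≤ δ * p * lam * (r * y * y * y) := by
    have h2 : 1 ≤ δ * p * lam := one_le_mul_of_one_le_of_one_le hδ hlam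
    have h3 : r * y * y * y ≤ δ * p * lam * (r * y * y * y) :=
      le_mul_of_one_le_left (by positivity) h2
    linarith
  refine ⟨?_, ?_, ?_, ?_, ?_, ?_, q1⟩
  · exact le_mul_of_one_le_right hlam0.le (one_le_mul_of_one_le_of_one_le (by linarith) g1)
  · exact le_mul_of_one_le_right hlam0.le (one_le_mul_of_one_le_of_one_le (by linarith)
      (one_le_mul_of_one_le_of_one_le (by linarith) g2))
  · have : 0 ≤ p - 1 - 1 := by linarith
    positivity
  · calc lam * (p * (r * y * y)) = lam * p * (r * y) * y := by ring
      _ ≤ lam * p * (r * y) * (4 * R) := by gcongr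
      _ = _ := by rw [← hδp]; ring
  · calc lam * (p * ((p - 1) * ((p - 1 - 1) * r)))
        = lam * p * (p - 1) * r * (p - 1 - 1) := by ring
      _ ≤ lam * p * (p - 1) * r * (δ * p * lam * (r * y * y * y)) :=
          mul_le_mul_of_nonneg_left (le_trans (by linarith) q3) (by positivity)
      _ = _ := by ring
  · calc lam * (p * ((p - 1) * (r * y))) = lam * p * (r * y) * (p - 1) := by ring
      _ ≤ lam * p * (r * y) * (δ * p * lam * (r * y * y * y)) :=
          mul_le_mul_of_nonneg_left q3 (by positivity)
      _ = _ := by ring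

end Weights

/-! ### The conjugated operator and the Carleman vector field. -/

section Field

variable {d : ℕ} {R p lam : ℝ}

lemma pd_pow_three {n : ℕ} {k : Fin n} {x : Fin n → ℝ} {f : (Fin n → ℝ) → ℝ}
    (hf : DifferentiableAt ℝ f x) :
    pd k (fun y => f y ^ 3) x = 3 * f x ^ 2 * pd k f x := by
  have : (fun y => f y ^ 3) = fun y => f y ^ 2 * f y := by ext; ring
  rw [this, pd_mul (hf.fun_pow 2) hf, pd_pow_two hf]; ring

/-- The product `exp(lam φ) w`. -/
def conj₀ (R p lam : ℝ) (w : (Fin (d + 1) → ℝ) → ℝ) (x : Fin (d + 1) → ℝ) : ℝ :=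
  expWt R p lam x * w x

/-- The indicator of the last coordinate. -/
def dl (i : Fin (d + 1)) : ℝ := if i = Fin.last d then 1 else 0

/-- The partial derivatives of `exp(lam φ) w`. -/
def conj₁ (R p lam : ℝ) (w : (Fin (d + 1) → ℝ) → ℝ) (i : Fin (d + 1)) (x : Fin (d + 1) → ℝ) : ℝ :=
  expWt R p lam x * (pd i w x + dl i * (wt₁ R p lam x * w x))

/-- The second partial derivatives of `exp(lam φ) w`. -/
def conj₂ (R p lam : ℝ) (w : (Fin (d + 1) → ℝ) → ℝ) (k i : Fin (d + 1))
    (x : Fin (d + 1) → ℝ) : ℝ :=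
  expWt R p lam x * (pd k (pd i w) x + dl k * wt₁ R p lam x * pd i w x
    + dl i * wt₁ R p lam x * pd k w x
    + dl k * dl i * (wt₁ R p lam x ^ 2 + wt₂ R p lam x) * w x)

variable {w : (Fin (d + 1) → ℝ) → ℝ} {x : Fin (d + 1) → ℝ}

lemma differentiableAt_wt₁ (hR : 0 < R) (hx : x ∈ cube (d + 1) R) :
    DifferentiableAt ℝ (wt₁ R p lam) x :=
  differentiableAt_of_contDiffOn (contDiffOn_wt₁ hR) hx

lemma differentiableAt_expWt (hR : 0 < R) (hx : x ∈ cube (d + 1) R) :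
    DifferentiableAt ℝ (expWt R p lam) x :=
  differentiableAt_of_contDiffOn (contDiffOn_expWt hR) hx

lemma differentiable_pd (hw : ContDiff ℝ ∞ w) (i : Fin (d + 1)) : Differentiable ℝ (pd i w) :=
  (contDiff_infty_pd hw).differentiable (by simp)

lemma contDiffOn_conj₀ (hR : 0 < R) (hw : ContDiff ℝ ∞ w) :
    ContDiffOn ℝ 1 (conj₀ R p lam w) (closedCube (d + 1) R) :=
  (contDiffOn_expWt hR).mul (hw.of_le (by norm_cast)).contDiffOn

lemma contDiffOn_conj₁ (hR : 0 < R) (hw : ContDiff ℝ ∞ w) (i : Fin (d + 1)) :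
    ContDiffOn ℝ 1 (conj₁ R p lam w i) (closedCube (d + 1) R) :=
  (contDiffOn_expWt hR).mul
    (((contDiff_infty_pd hw).of_le (by norm_cast)).contDiffOn.add
    (contDiffOn_const.mul ((contDiffOn_wt₁ hR).mul
      (hw.of_le (by norm_cast)).contDiffOn)))

lemma pd_conj₀ (hR : 0 < R) (hw : ContDiff ℝ ∞ w) (hx : x ∈ cube (d + 1) R) (k : Fin (d + 1)) :
    pd k (conj₀ R p lam w) x = conj₁ R p lam w k x := by
  have hy : 0 < zc x + 3 * R := by
    have := two_mul_le_zc_add (cube_subset_closedCube hx); linarith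
  have h1 : DifferentiableAt ℝ w x := hw.differentiable (by simp) x
  unfold conj₀ conj₁
  rw [pd_mul (differentiableAt_expWt hR hx) h1, pd_expWt hy, dl]
  split_ifs <;> ring

lemma pd_conj₁ (hR : 0 < R) (hw : ContDiff ℝ ∞ w) (hx : x ∈ cube (d + 1) R)
    (k i : Fin (d + 1)) :
    pd k (conj₁ R p lam w i) x = conj₂ R p lam w k i x := by
  have hy : 0 < zc x + 3 * R := by
    have := two_mul_le_zc_add (cube_subset_closedCube hx); linarith
  have h1 : DifferentiableAt ℝ w x := hw.differentiable (by simp) x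
  have h2 : DifferentiableAt ℝ (pd i w) x := differentiable_pd hw i x
  have h3 : DifferentiableAt ℝ (wt₁ R p lam) x := differentiableAt_wt₁ hR hx
  unfold conj₁ conj₂
  rw [pd_mul (differentiableAt_expWt hR hx) (h2.fun_add ((h3.fun_mul h1).const_mul _)),
    pd_add h2 ((h3.fun_mul h1).const_mul _), pd_const_mul _ (h3.fun_mul h1), pd_mul h3 h1,
    pd_expWt hy, pd_wt₁ hy]
  simp only [dl]
  split_ifs <;> ring

lemma conj₂_symm (hw : ContDiff ℝ ∞ w) (k i : Fin (d + 1)) :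
    conj₂ R p lam w k i x = conj₂ R p lam w i k x := by
  unfold conj₂
  rw [pd_comm (hw.of_le (by norm_cast)) k i]; ring

variable {a : Fin (d + 1) → Fin (d + 1) → (Fin (d + 1) → ℝ) → ℝ}

/-- The conormal derivatives of `exp(lam φ) w`. -/
def conormal (R p lam : ℝ) (a : Fin (d + 1) → Fin (d + 1) → (Fin (d + 1) → ℝ) → ℝ)
    (w : (Fin (d + 1) → ℝ) → ℝ) (i : Fin (d + 1)) (x : Fin (d + 1) → ℝ) : ℝ :=
  ∑ j, a i j x * conj₁ R p lam w j x

/-- The energy density of `exp(lam φ) w`. -/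
def energy (R p lam : ℝ) (a : Fin (d + 1) → Fin (d + 1) → (Fin (d + 1) → ℝ) → ℝ)
    (w : (Fin (d + 1) → ℝ) → ℝ) (x : Fin (d + 1) → ℝ) : ℝ :=
  ∑ i, ∑ j, a i j x * conj₁ R p lam w i x * conj₁ R p lam w j x

/-- The vector field whose divergence enters the pointwise Carleman inequality. -/
def carlemanField (R p lam : ℝ) (a : Fin (d + 1) → Fin (d + 1) → (Fin (d + 1) → ℝ) → ℝ)
    (w : (Fin (d + 1) → ℝ) → ℝ) (i : Fin (d + 1)) (x : Fin (d + 1) → ℝ) : ℝ :=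
  -4 * (wt₁ R p lam x * conormal R p lam a w (Fin.last d) x * conormal R p lam a w i x)
    + 2 * (wt₁ R p lam x * a (Fin.last d) i x * energy R p lam a w x)
    - 2 * (wt₁ R p lam x ^ 3 * a (Fin.last d) (Fin.last d) x * a (Fin.last d) i x
        * conj₀ R p lam w x ^ 2)
    - 4 * (wt₂ R p lam x * a (Fin.last d) (Fin.last d) x * conj₀ R p lam w x
        * conormal R p lam a w i x)

/-- The product rule for the shape of `carlemanField`, with opaque factors, arranged to match the
left side of `carleman_divergence_eq` term by term. -/
lemma pd_field {n : ℕ} {s t T G E v c e : (Fin n → ℝ) → ℝ} {x : Fin n → ℝ} (k : Fin n)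
    (hs : DifferentiableAt ℝ s x) (ht : DifferentiableAt ℝ t x) (hT : DifferentiableAt ℝ T x)
    (hG : DifferentiableAt ℝ G x) (hE : DifferentiableAt ℝ E x) (hv : DifferentiableAt ℝ v x)
    (hc : DifferentiableAt ℝ c x) (he : DifferentiableAt ℝ e x) :
    pd k (fun y => -4 * (s y * T y * G y) + 2 * (s y * c y * E y)
      - 2 * (s y ^ 3 * e y * c y * v y ^ 2) - 4 * (t y * e y * v y * G y)) x =
    -4 * (pd k s x * T x * G x + s x * pd k T x * G x + s x * T x * pd k G x)
      + 2 * (pd k s x * c x * E x + s x * pd k c x * E x + s x * c x * pd k E x)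
      - 2 * (3 * s x ^ 2 * pd k s x * e x * c x * v x ^ 2 + s x ^ 3 * pd k e x * c x * v x ^ 2
          + s x ^ 3 * e x * pd k c x * v x ^ 2 + s x ^ 3 * e x * c x * (2 * v x * pd k v x))
      - 4 * (pd k t x * e x * v x * G x + t x * pd k e x * v x * G x + t x * e x * pd k v x * G x
          + t x * e x * v x * pd k G x) := by
  rw [pd_sub (by fun_prop) (by fun_prop), pd_sub (by fun_prop) (by fun_prop),
    pd_add (by fun_prop) (by fun_prop), pd_const_mul _ (by fun_prop), pd_const_mul _ (by fun_prop),
    pd_const_mul _ (by fun_prop), pd_const_mul _ (by fun_prop),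
    pd_mul (f := fun y => s y * T y) (by fun_prop) hG, pd_mul hs hT,
    pd_mul (f := fun y => s y * c y) (by fun_prop) hE, pd_mul hs hc,
    pd_mul (f := fun y => s y ^ 3 * e y * c y) (g := fun y => v y ^ 2) (by fun_prop) (by fun_prop),
    pd_mul (f := fun y => s y ^ 3 * e y) (by fun_prop) hc,
    pd_mul (f := fun y => s y ^ 3) (by fun_prop) he, pd_pow_three hs, pd_pow_two hv,
    pd_mul (f := fun y => t y * e y * v y) (by fun_prop) hG,
    pd_mul (f := fun y => t y * e y) (by fun_prop) hv, pd_mul ht he]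
  ring

lemma contDiffOn_conormal (hR : 0 < R) (hw : ContDiff ℝ ∞ w)
    (ha : ∀ i j, ContDiffOn ℝ 1 (a i j) (closedCube (d + 1) R)) (i : Fin (d + 1)) :
    ContDiffOn ℝ 1 (conormal R p lam a w i) (closedCube (d + 1) R) :=
  ContDiffOn.sum fun j _ => (ha i j).mul (contDiffOn_conj₁ hR hw j)

lemma contDiffOn_energy (hR : 0 < R) (hw : ContDiff ℝ ∞ w)
    (ha : ∀ i j, ContDiffOn ℝ 1 (a i j) (closedCube (d + 1) R)) :
    ContDiffOn ℝ 1 (energy R p lam a w) (closedCube (d + 1) R) :=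
  ContDiffOn.sum fun i _ => ContDiffOn.sum fun j _ =>
    ((ha i j).mul (contDiffOn_conj₁ hR hw i)).mul (contDiffOn_conj₁ hR hw j)

lemma contDiffOn_carlemanField (hR : 0 < R) (hw : ContDiff ℝ ∞ w)
    (ha : ∀ i j, ContDiffOn ℝ 1 (a i j) (closedCube (d + 1) R)) (i : Fin (d + 1)) :
    ContDiffOn ℝ 1 (carlemanField R p lam a w i) (closedCube (d + 1) R) := by
  have h1 := contDiffOn_conormal (p := p) (lam := lam) hR hw ha
  have h2 := contDiffOn_energy (p := p) (lam := lam) hR hw ha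
  have h3 := contDiffOn_conj₀ (p := p) (lam := lam) hR hw
  have h4 : ContDiffOn ℝ 1 (wt₁ R p lam : (Fin (d + 1) → ℝ) → ℝ) _ := contDiffOn_wt₁ hR
  have h5 : ContDiffOn ℝ 1 (wt₂ R p lam : (Fin (d + 1) → ℝ) → ℝ) _ := contDiffOn_wt₂ hR
  exact (((contDiffOn_const.mul ((h4.mul (h1 _)).mul (h1 i))).add
    (contDiffOn_const.mul ((h4.mul (ha _ _)).mul h2))).sub
    (contDiffOn_const.mul ((((h4.pow 3).mul (ha _ _)).mul (ha _ _)).mul (h3.pow 2)))).sub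
    (contDiffOn_const.mul (((h5.mul (ha _ _)).mul h3).mul (h1 i)))

lemma pd_conormal (hR : 0 < R) (hw : ContDiff ℝ ∞ w)
    (ha : ∀ i j, ContDiffOn ℝ 1 (a i j) (closedCube (d + 1) R)) (hx : x ∈ cube (d + 1) R)
    (k i : Fin (d + 1)) :
    pd k (conormal R p lam a w i) x = ∑ j, (pd k (a i j) x * conj₁ R p lam w j x
      + a i j x * conj₂ R p lam w k j x) := by
  have h1 := fun j => differentiableAt_of_contDiffOn (contDiffOn_conj₁ (p := p) (lam := lam) hR hw j) hx
  have h2 := fun i j => differentiableAt_of_contDiffOn (ha i j) hx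
  unfold conormal
  rw [pd_sum _ fun j _ => (h2 i j).fun_mul (h1 j)]
  refine Finset.sum_congr rfl fun j _ => ?_
  rw [← pd_conj₁ hR hw hx]
  exact pd_mul (h2 i j) (h1 j)

lemma pd_energy (hR : 0 < R) (hw : ContDiff ℝ ∞ w)
    (ha : ∀ i j, ContDiffOn ℝ 1 (a i j) (closedCube (d + 1) R)) (hx : x ∈ cube (d + 1) R)
    (k : Fin (d + 1)) :
    pd k (energy R p lam a w) x = ∑ i, ∑ j,
      (pd k (a i j) x * conj₁ R p lam w i x * conj₁ R p lam w j x
      + a i j x * conj₂ R p lam w k i x * conj₁ R p lam w j x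
      + a i j x * conj₁ R p lam w i x * conj₂ R p lam w k j x) := by
  have h1 := fun j => differentiableAt_of_contDiffOn (contDiffOn_conj₁ (p := p) (lam := lam) hR hw j) hx
  have h2 := fun i j => differentiableAt_of_contDiffOn (ha i j) hx
  have h3 := fun i j => (h2 i j).fun_mul (h1 i)
  unfold energy
  rw [pd_sum _ fun i _ => DifferentiableAt.fun_sum fun j _ => (h3 i j).fun_mul (h1 j)]
  refine Finset.sum_congr rfl fun i _ => ?_
  rw [pd_sum _ fun j _ => (h3 i j).fun_mul (h1 j)]
  refine Finset.sum_congr rfl fun j _ => ?_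
  rw [← pd_conj₁ hR hw hx, ← pd_conj₁ hR hw hx]
  have e1 := pd_mul (k := k) (h3 i j) (h1 j)
  have e2 := pd_mul (k := k) (h2 i j) (h1 i)
  rw [e1, e2]
  ring

/-- The operator `∑ a_ij ∂_i ∂_j` on functions. -/
def classicalL0 (a : Fin (d + 1) → Fin (d + 1) → (Fin (d + 1) → ℝ) → ℝ)
    (w : (Fin (d + 1) → ℝ) → ℝ) (x : Fin (d + 1) → ℝ) : ℝ :=
  ∑ i, ∑ j, a i j x * pd j (pd i w) x

/-- Substituting w = e^{−λφ} v, each derivative ∂_i becomes ∂_i − λ∂_iφ. Since φ depends on z alone,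
the first and zeroth order terms involve only the last row of the coefficients; symmetry merges the
two first order terms. The proof expands the derivatives of v in those of w. -/
lemma conj_classicalL0 (hw : ContDiff ℝ ∞ w) (hs : ∀ i j, a i j x = a j i x) :
    expWt R p lam x * classicalL0 a w x =
      (∑ i, ∑ j, a i j x * conj₂ R p lam w i j x)
      + wt₁ R p lam x ^ 2 * a (Fin.last d) (Fin.last d) x * conj₀ R p lam w x
      - 2 * wt₁ R p lam x * conormal R p lam a w (Fin.last d) x
      - wt₂ R p lam x * a (Fin.last d) (Fin.last d) x * conj₀ R p lam w x := by
  have hc : ∀ i j, pd j (pd i w) x = pd i (pd j w) x := fun i j =>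
    pd_comm (hw.of_le (by norm_cast)) j i x
  set l := Fin.last d with hl
  set s := wt₁ R p lam x
  set t := wt₂ R p lam x
  set θ := expWt R p lam x
  set P := ∑ j, a l j x * pd j w x with hP
  have e0 : ∀ f : Fin (d + 1) → ℝ, ∑ i, dl i * f i = f l := by
    intro f; simp [dl, hl]
  have e1 : conormal R p lam a w l x = θ * (P + s * a l l x * w x) := by
    have : ∀ j, a l j x * conj₁ R p lam w j x
        = θ * (a l j x * pd j w x) + θ * (dl j * (a l j x * (s * w x))) := by
      intro j; unfold conj₁; ring
    unfold conormal
    simp only [this, Finset.sum_add_distrib, ← Finset.mul_sum, e0]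
    rw [← hP]; ring
  have e2 : ∑ i, ∑ j, a i j x * conj₂ R p lam w i j x
      = θ * (classicalL0 a w x + 2 * s * P + (s ^ 2 + t) * a l l x * w x) := by
    have : ∀ i j, a i j x * conj₂ R p lam w i j x = θ * (a i j x * pd j (pd i w) x)
        + (θ * s) * (dl i * (a i j x * pd j w x)) + (θ * s) * (dl j * (a j i x * pd i w x))
        + (θ * (s ^ 2 + t) * w x) * (dl i * (dl j * a i j x)) := by
      intro i j; rw [hc, hs j i]; unfold conj₂; ring
    simp only [this, Finset.sum_add_distrib, ← Finset.mul_sum, e0]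
    unfold classicalL0
    rw [← hP]; ring
  rw [e1, e2]; unfold conj₀; ring

end Field

/-! ### The Carleman estimate for smooth functions. -/

section SmoothEstimate

variable {d : ℕ} {R p lam μ₁ μ₂ A : ℝ} {w : (Fin (d + 1) → ℝ) → ℝ} {x : Fin (d + 1) → ℝ}
  {a : Fin (d + 1) → Fin (d + 1) → (Fin (d + 1) → ℝ) → ℝ}

/-- The pointwise Carleman inequality for smooth functions. -/
lemma pointwise_carleman_smooth (hR : 1 ≤ R) (hμ : 0 < μ₁)
    (ha : PrincipalCoeff d R μ₁ μ₂ A a) (hp : 2 ≤ p)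
    (hδ : 18 * ((d + 1 : ℕ) : ℝ) ^ 2 * A ^ 2 * (4 * R / (p - 1)) ≤ μ₁ ^ 2) (hlam : 1 ≤ lam)
    (hw : ContDiff ℝ ∞ w) (hx : x ∈ cube (d + 1) R) :
    ∑ i, pd i (carlemanField R p lam a w i) x
      + μ₁ ^ 2 * wt₂ R p lam x * (∑ i, conj₁ R p lam w i x ^ 2
        + wt₁ R p lam x ^ 2 * conj₀ R p lam w x ^ 2)
      ≤ (expWt R p lam x * classicalL0 a w x) ^ 2 := by
  have hR0 : 0 < R := by linarith
  have hx' := cube_subset_closedCube hx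
  obtain ⟨b1, b2, b3, b12, b31, b21, b11⟩ := wt_bounds hR hp hlam hx'
  have hy : 0 < zc x + 3 * R := by have := two_mul_le_zc_add hx'; linarith
  have hE := ha.elliptic x hx' fun i => conj₁ R p lam w i x
  refine pointwise_carleman (Fin.last d) (a := fun i j => a i j x)
    (D := fun k i j => pd k (a i j) x) (V := fun i => conj₁ R p lam w i x)
    (v := conj₀ R p lam w x) (s₁ := wt₁ R p lam x) (s₂ := wt₂ R p lam x) (s₃ := wt₃ R p lam x)
    (A := A) (δ := 4 * R / (p - 1)) (T := conormal R p lam a w (Fin.last d) x)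
    (E := energy R p lam a w x) (Q := ∑ i, ∑ j, a i j x * conj₂ R p lam w i j x)
    (ha.nonneg hR0) (fun i j => ha.abs_le i j hx') (fun k i j => ha.abs_pd_le hR0 k i j hx) hμ
    (ha.le_last hx' _) hE.1 (by linarith) (by linarith) b3 b12 b31 b21 b11
    (div_nonneg (by linarith) (by linarith)) (by simpa using hδ)
    (conj_classicalL0 hw (ha.symm x hx')) ?_
  have hT := fun i => differentiableAt_of_contDiffOn
    (contDiffOn_conormal (p := p) (lam := lam) hR0 hw ha.contDiffOn i) hx
  -- Used backwards, the identity reduces the goal to the product rule for each component of the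
  -- field.
  rw [← carleman_divergence_eq (Fin.last d) (fun i j => a i j x) (fun k i j => pd k (a i j) x)
    (fun i j => conj₂ R p lam w i j x) (fun i => conj₁ R p lam w i x)
    (conj₀ R p lam w x) (wt₁ R p lam x) (wt₂ R p lam x) (wt₃ R p lam x)
    (conormal R p lam a w (Fin.last d) x) (energy R p lam a w x)
    (∑ i, ∑ j, a i j x * conj₂ R p lam w i j x) (fun i => conormal R p lam a w i x)
    (fun i => pd i (conormal R p lam a w (Fin.last d)) x)
    (fun i => pd i (energy R p lam a w) x) (fun i => pd i (conormal R p lam a w i) x)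
    (ha.symm x hx') (conj₂_symm hw) rfl (fun _ => rfl) rfl rfl
    (fun i => pd_conormal hR0 hw ha.contDiffOn hx i _)
    (fun i => pd_conormal hR0 hw ha.contDiffOn hx i i)
    (fun i => pd_energy hR0 hw ha.contDiffOn hx i)]
  refine Finset.sum_congr rfl fun i _ => ?_
  have key := pd_field (x := x) i (differentiableAt_wt₁ (p := p) (lam := lam) hR0 hx)
    (differentiableAt_of_contDiffOn (contDiffOn_wt₂ (p := p) (lam := lam) hR0) hx)
    (hT (Fin.last d)) (hT i)
    (differentiableAt_of_contDiffOn
      (contDiffOn_energy (p := p) (lam := lam) hR0 hw ha.contDiffOn) hx)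
    (differentiableAt_of_contDiffOn (contDiffOn_conj₀ (p := p) (lam := lam) hR0 hw) hx)
    (differentiableAt_of_contDiffOn (ha.contDiffOn (Fin.last d) i) hx)
    (differentiableAt_of_contDiffOn (ha.contDiffOn (Fin.last d) (Fin.last d)) hx)
  rw [pd_wt₁ hy, pd_wt₂ hy, pd_conj₀ hR0 hw hx] at key
  exact key

lemma dl_sq (i : Fin (d + 1)) : dl i ^ 2 = dl i := by unfold dl; split_ifs <;> norm_num

lemma sum_dl : ∑ i : Fin (d + 1), dl i = 1 := by simp [dl]

/-- Returning from v to w: e^{λφ}∂_i w is ∂_i v, corrected by −s₁v in the last direction only, so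
e^{2λφ}|∇w|² ≤ 2|∇v|² + 2s₁²v². Together with λ²e^{2λφ}w² ≤ s₁²v² this costs the factor 3, and s₂ ≥
λ supplies the factor λ. -/
lemma conj_energy_lower (hR : 1 ≤ R) (hp : 2 ≤ p) (hlam : 1 ≤ lam)
    (hx : x ∈ closedCube (d + 1) R) :
    lam / 3 * ((∑ i, pd i w x ^ 2 + lam ^ 2 * w x ^ 2) * weight R p lam x) ≤
      wt₂ R p lam x * (∑ i, conj₁ R p lam w i x ^ 2
        + wt₁ R p lam x ^ 2 * conj₀ R p lam w x ^ 2) := by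
  obtain ⟨b1, b2, -⟩ := wt_bounds hR hp hlam hx
  rw [← expWt_sq]
  set s := wt₁ R p lam x
  set θ := expWt R p lam x with hθ
  have h1 : (∑ i, pd i w x ^ 2) * θ ^ 2
      ≤ 2 * ∑ i, conj₁ R p lam w i x ^ 2 + 2 * (s ^ 2 * conj₀ R p lam w x ^ 2) := by
    have : ∀ i, pd i w x ^ 2 * θ ^ 2 ≤ 2 * conj₁ R p lam w i x ^ 2
        + dl i * (2 * (s ^ 2 * conj₀ R p lam w x ^ 2)) := by
      intro i
      rw [← dl_sq i]
      unfold conj₁ conj₀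
      -- With P = ∂_i w and r the correction, 2(P + r)² + 2r² − P² = (P + 2r)².
      nlinarith only [sq_nonneg (θ * (pd i w x + 2 * (dl i * (s * w x))))]
    rw [Finset.sum_mul]
    refine (Finset.sum_le_sum fun i _ => this i).trans (le_of_eq ?_)
    rw [Finset.sum_add_distrib, ← Finset.mul_sum, ← Finset.sum_mul, sum_dl, one_mul]
  have h2 : lam ^ 2 * w x ^ 2 * θ ^ 2 ≤ s ^ 2 * conj₀ R p lam w x ^ 2 := by
    have : lam ^ 2 ≤ s ^ 2 := pow_le_pow_left₀ (by linarith) b1 2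
    unfold conj₀
    nlinarith [mul_le_mul_of_nonneg_right this (sq_nonneg (θ * w x))]
  have h3 : 0 ≤ ∑ i, conj₁ R p lam w i x ^ 2 := Finset.sum_nonneg fun i _ => sq_nonneg _
  set X := ∑ i, conj₁ R p lam w i x ^ 2 + s ^ 2 * conj₀ R p lam w x ^ 2 with hX
  have hX0 : 0 ≤ X := by positivity
  calc lam / 3 * ((∑ i, pd i w x ^ 2 + lam ^ 2 * w x ^ 2) * θ ^ 2)
      ≤ lam / 3 * (3 * X) := by
        refine mul_le_mul_of_nonneg_left ?_ (by linarith)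
        rw [add_mul, hX]; linarith
    _ = lam * X := by ring
    _ ≤ _ := mul_le_mul_of_nonneg_right b2 hX0

/-- The function vanishes on all hyperplanes containing a face of the cube. -/
def VanishesOnFaces {n : ℕ} (R : ℝ) (w : (Fin n → ℝ) → ℝ) : Prop :=
  ∀ x i, x i = R ∨ x i = -R → w x = 0

/-- The coordinate line in a tangential direction stays in the hyperplane; this is why vanishing is
required on entire hyperplanes and not just on faces. -/
lemma VanishesOnFaces.pd_eq_zero {n : ℕ} {w : (Fin n → ℝ) → ℝ} (h : VanishesOnFaces R w)
    (hw : Differentiable ℝ w) {x : Fin n → ℝ} {i j : Fin n} (hij : j ≠ i)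
    (hx : x i = R ∨ x i = -R) : pd j w x = 0 := by
  rw [pd_eq_deriv_update (hw x)]
  have : (fun t => w (Function.update x j t)) = fun _ => 0 := by
    ext t
    refine h _ i ?_
    rwa [Function.update_of_ne hij.symm]
  rw [this]; simp

/-- On such a hyperplane v = 0 and ∇v is normal, so both quadratic terms are multiples of the same
square, with weights −4 and +2. -/
lemma carlemanField_on_face (hw : ContDiff ℝ ∞ w) (hv : VanishesOnFaces R w) {i : Fin (d + 1)}
    (hx : x i = R ∨ x i = -R) :
    carlemanField R p lam a w i x = -2 * wt₁ R p lam x * a (Fin.last d) i x * a i i x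
      * (expWt R p lam x * pd i w x) ^ 2 := by
  have h0 : w x = 0 := hv x i hx
  have hV : ∀ j, conj₁ R p lam w j x = if j = i then expWt R p lam x * pd i w x else 0 := by
    intro j
    unfold conj₁
    split_ifs with h
    · subst h; simp [h0]
    · rw [hv.pd_eq_zero (hw.differentiable (by simp)) h hx, h0]; simp
  have hG : ∀ k, conormal R p lam a w k x = a k i x * (expWt R p lam x * pd i w x) := by
    intro k; unfold conormal; simp [hV]
  have hE : energy R p lam a w x = a i i x * (expWt R p lam x * pd i w x) ^ 2 := by
    unfold energy
    simp only [hV, mul_ite, ite_mul, mul_zero, zero_mul, Finset.sum_ite_eq', Finset.mem_univ,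
      if_true]
    ring
  unfold carlemanField
  rw [hG, hG, hE, conj₀, h0]; ring

lemma insertNth_mem_frontier (hR : 0 < R) (i : Fin (d + 1)) {s : ℝ} (hs : s = R ∨ s = -R)
    {y : Fin d → ℝ} (hy : y ∈ cube d R) :
    i.insertNth (α := fun _ => ℝ) s y ∈ frontier (cube (d + 1) R) := by
  rw [frontier_cube hR]
  refine ⟨insertNth_mem_closedCube i ?_ (cube_subset_closedCube hy), fun h => ?_⟩
  · rcases hs with rfl | rfl <;> constructor <;> linarith
  · have := h i
    simp only [Fin.insertNth_apply_same, Set.mem_Ioo] at this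
    rcases hs with rfl | rfl <;> linarith [this.1, this.2]

/-- The face value of the field has the factor a_in, and the face parameter lies in the open cube,
so z ≠ ±R and the lateral hypothesis applies. -/
lemma carlemanField_lateral (hR : 0 < R) (ha : PrincipalCoeff d R μ₁ μ₂ A a)
    (hw : ContDiff ℝ ∞ w) (hv : VanishesOnFaces R w) {i : Fin (d + 1)} (hi : i ≠ Fin.last d)
    {s : ℝ} (hs : s = R ∨ s = -R) {y : Fin d → ℝ} (hy : y ∈ cube d R) :
    carlemanField R p lam a w i (i.insertNth (α := fun _ => ℝ) s y) = 0 := by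
  have hfr := insertNth_mem_frontier hR i hs hy
  have hcl : i.insertNth (α := fun _ => ℝ) s y ∈ closedCube (d + 1) R := by
    rw [frontier_cube hR] at hfr; exact hfr.1
  obtain ⟨l, hl⟩ := Fin.exists_succAbove_eq hi.symm
  have hz : zc (i.insertNth (α := fun _ => ℝ) s y) = y l := by
    unfold zc; rw [← hl]; simp
  have h0 : a i (Fin.last d) (i.insertNth (α := fun _ => ℝ) s y) = 0 :=
    ha.lateral _ hfr (by rw [hz]; exact (hy l).2.ne) (by rw [hz]; exact (hy l).1.ne') i hi
  rw [carlemanField_on_face hw hv (by simpa using hs), ha.symm _ hcl, h0]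
  ring

lemma integrableOn_face {f : (Fin (d + 1) → ℝ) → ℝ} (i : Fin (d + 1)) {s : ℝ}
    (hs : s ∈ Set.Icc (-R) R) (hf : ContinuousOn f (closedCube (d + 1) R)) :
    IntegrableOn (fun y => f (i.insertNth (α := fun _ => ℝ) s y)) (cube d R) := by
  refine integrableOn_of_continuousOn (hf.comp ?_ fun y hy => insertNth_mem_closedCube i hs hy)
  have h : Continuous fun y : Fin d → ℝ => i.insertNth (α := fun _ => ℝ) s y :=
    Continuous.finInsertNth i continuous_const continuous_id
  exact h.continuousOn

/-- Only z = ±R contributes. The normal component is nonpositive on both faces, so its flux through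
z = −R is nonnegative and only z = R costs something. K bounds 2s₁a_nn²e^{2λφ}; it may depend on p,
λ and the coefficients, but it is fixed before w, which is what the later limit needs. -/
lemma sum_integral_pd_carlemanField (hR : 1 ≤ R) (ha : PrincipalCoeff d R μ₁ μ₂ A a)
    (hp : 2 ≤ p) (hlam : 1 ≤ lam) :
    ∃ K, 0 ≤ K ∧ ∀ w : (Fin (d + 1) → ℝ) → ℝ, ContDiff ℝ ∞ w → VanishesOnFaces R w →
      -(K * ∫ y in cube d R, pd (Fin.last d) w
          ((Fin.last d).insertNth (α := fun _ => ℝ) R y) ^ 2) ≤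
        ∑ i, ∫ x in cube (d + 1) R, pd i (carlemanField R p lam a w i) x := by
  have hR0 : 0 < R := by linarith
  set l := Fin.last d with hl
  have hcf : ContinuousOn (fun x => 2 * wt₁ R p lam x * a l l x * a l l x * expWt R p lam x ^ 2)
      (closedCube (d + 1) R) :=
    (((continuousOn_const.mul (contDiffOn_wt₁ hR0).continuousOn).mul
      (ha.contDiffOn l l).continuousOn).mul (ha.contDiffOn l l).continuousOn).mul
      ((contDiffOn_expWt hR0).continuousOn.pow 2)
  obtain ⟨K, hK0, hK⟩ := exists_bound hcf
  refine ⟨K, hK0, fun w hw hv => ?_⟩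
  rw [Finset.sum_eq_single l]
  · rw [integral_pd_of_contDiffOn hR0 l (contDiffOn_carlemanField hR0 hw ha.contDiffOn l)]
    have hcont := (contDiffOn_carlemanField (p := p) (lam := lam) hR0 hw ha.contDiffOn l).continuousOn
    have hpdc : Continuous (pd l w) := (contDiff_infty_pd hw).continuous
    have hRm : R ∈ Set.Icc (-R) R := ⟨by linarith, le_rfl⟩
    have hRm' : -R ∈ Set.Icc (-R) R := ⟨le_rfl, by linarith⟩
    have h1 : ∫ y in cube d R, carlemanField R p lam a w l (l.insertNth (α := fun _ => ℝ) (-R) y)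
        ≤ 0 := by
      refine setIntegral_nonpos measurableSet_cube fun y hy => ?_
      rw [carlemanField_on_face hw hv (by simp)]
      obtain ⟨b1, -⟩ := wt_bounds hR hp hlam
        (insertNth_mem_closedCube l hRm' (cube_subset_closedCube hy))
      have : 0 ≤ wt₁ R p lam (l.insertNth (α := fun _ => ℝ) (-R) y) *
        (a l l (l.insertNth (α := fun _ => ℝ) (-R) y) * (expWt R p lam
          (l.insertNth (α := fun _ => ℝ) (-R) y) * pd l w
          (l.insertNth (α := fun _ => ℝ) (-R) y))) ^ 2 :=
        mul_nonneg (by linarith) (sq_nonneg _)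
      rw [← hl]
      linarith
    have h2 : -(K * ∫ y in cube d R, pd l w (l.insertNth (α := fun _ => ℝ) R y) ^ 2) ≤
        ∫ y in cube d R, carlemanField R p lam a w l (l.insertNth (α := fun _ => ℝ) R y) := by
      rw [← integral_const_mul, ← integral_neg]
      refine setIntegral_mono_on ?_ (integrableOn_face l hRm hcont) measurableSet_cube
        fun y hy => ?_
      · exact ((integrableOn_face l hRm (f := fun x => pd l w x ^ 2)
          (hpdc.pow 2).continuousOn).const_mul K).neg
      · have hmem := insertNth_mem_closedCube l hRm (cube_subset_closedCube hy)
        rw [carlemanField_on_face hw hv (by simp)]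
        have := mul_le_mul_of_nonneg_right ((le_abs_self _).trans (hK _ hmem))
          (sq_nonneg (pd l w (l.insertNth (α := fun _ => ℝ) R y)))
        rw [← hl]
        linarith
    linarith
  · intro i _ hi
    rw [integral_pd_of_contDiffOn hR0 i (contDiffOn_carlemanField hR0 hw ha.contDiffOn i)]
    rw [setIntegral_eq_zero_of_forall_eq_zero, setIntegral_eq_zero_of_forall_eq_zero, sub_zero]
    · exact fun y hy => carlemanField_lateral hR0 ha hw hv hi (Or.inr rfl) hy
    · exact fun y hy => carlemanField_lateral hR0 ha hw hv hi (Or.inl rfl) hy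
  · simp

lemma continuousOn_weight (hR : 0 < R) :
    ContinuousOn (weight R p lam : (Fin (d + 1) → ℝ) → ℝ) (closedCube (d + 1) R) := by
  refine ((contDiffOn_expWt (p := p) (lam := lam) hR).continuousOn.pow 2).congr fun x _ => ?_
  exact (expWt_sq x).symm

/-- The Carleman estimate for smooth functions vanishing on the boundary of the cube. -/
theorem smooth_carleman (hR : 1 ≤ R) (hμ : 0 < μ₁) (ha : PrincipalCoeff d R μ₁ μ₂ A a)
    (hp : 2 ≤ p) (hδ : 18 * ((d + 1 : ℕ) : ℝ) ^ 2 * A ^ 2 * (4 * R / (p - 1)) ≤ μ₁ ^ 2)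
    (hlam : 1 ≤ lam) :
    ∃ K, 0 ≤ K ∧ ∀ w : (Fin (d + 1) → ℝ) → ℝ, ContDiff ℝ ∞ w → VanishesOnFaces R w →
      μ₁ ^ 2 / 3 * lam * ∫ x in cube (d + 1) R,
          (∑ i, pd i w x ^ 2 + lam ^ 2 * w x ^ 2) * weight R p lam x ≤
        (∫ x in cube (d + 1) R, classicalL0 a w x ^ 2 * weight R p lam x)
          + K * ∫ y in cube d R, pd (Fin.last d) w
            ((Fin.last d).insertNth (α := fun _ => ℝ) R y) ^ 2 := by
  have hR0 : 0 < R := by linarith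
  obtain ⟨K, hK0, hK⟩ := sum_integral_pd_carlemanField hR ha hp hlam
  refine ⟨K, hK0, fun w hw hv => ?_⟩
  have hpdc : ∀ i, Continuous (pd i w) := fun i => (contDiff_infty_pd hw).continuous
  have hpdc2 : ∀ i j, Continuous (pd j (pd i w)) := fun i j =>
    (contDiff_infty_pd (contDiff_infty_pd hw)).continuous
  have hwt : ContinuousOn (weight R p lam : (Fin (d + 1) → ℝ) → ℝ) (closedCube (d + 1) R) :=
    continuousOn_weight hR0
  have i1 : IntegrableOn (fun x => (∑ i, pd i w x ^ 2 + lam ^ 2 * w x ^ 2) * weight R p lam x)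
      (cube (d + 1) R) := by
    refine integrableOn_of_continuousOn (ContinuousOn.mul ?_ hwt)
    exact ((continuous_finsetSum _ fun i _ => (hpdc i).pow 2).add
      (continuous_const.mul (hw.continuous.pow 2))).continuousOn
  have i2 : IntegrableOn (fun x => classicalL0 a w x ^ 2 * weight R p lam x)
      (cube (d + 1) R) := by
    refine integrableOn_of_continuousOn (ContinuousOn.mul (ContinuousOn.pow ?_ 2) hwt)
    exact continuousOn_finsetSum _ fun i _ => continuousOn_finsetSum _ fun j _ =>
      (ha.contDiffOn i j).continuousOn.mul (hpdc2 i j).continuousOn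
  have i3 : ∀ i, IntegrableOn (pd i (carlemanField R p lam a w i)) (cube (d + 1) R) := fun i =>
    integrableOn_pd hR0 (contDiffOn_carlemanField hR0 hw ha.contDiffOn i) i
  have hle : ∫ x in cube (d + 1) R, (∑ i, pd i (carlemanField R p lam a w i) x
      + μ₁ ^ 2 / 3 * lam * ((∑ i, pd i w x ^ 2 + lam ^ 2 * w x ^ 2) * weight R p lam x)) ≤
      ∫ x in cube (d + 1) R, classicalL0 a w x ^ 2 * weight R p lam x := by
    refine setIntegral_mono_on ((integrable_finsetSum _ fun i _ => i3 i).add (i1.const_mul _))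
      i2 measurableSet_cube fun x hx => ?_
    have h1 := pointwise_carleman_smooth hR hμ ha hp hδ hlam hw hx
    have h2 := mul_le_mul_of_nonneg_left
      (conj_energy_lower (w := w) hR hp hlam (cube_subset_closedCube hx)) (sq_nonneg μ₁)
    rw [mul_pow, expWt_sq] at h1
    linarith
  rw [integral_add (integrable_finsetSum _ fun i _ => i3 i) (i1.const_mul _),
    integral_finsetSum _ fun i _ => i3 i, integral_const_mul] at hle
  have := hK w hw hv
  linarith

end SmoothEstimate

/-! ### Convergence in L². -/

section L2Convergence

variable {α : Type*} [MeasurableSpace α] {μ : Measure α} {f f' : ℕ → α → ℝ} {g g' : α → ℝ}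

/-- Convergence in `L²(μ)` of a sequence of square integrable real functions. -/
structure L2Tendsto (μ : Measure α) (f : ℕ → α → ℝ) (g : α → ℝ) : Prop where
  memLp : ∀ m, MemLp (f m) 2 μ
  memLp_lim : MemLp g 2 μ
  tendsto : Tendsto (fun m => eLpNorm (f m - g) 2 μ) atTop (𝓝 0)

namespace L2Tendsto

lemma tendsto_toLp (h : L2Tendsto μ f g) :
    Tendsto (fun m => (h.memLp m).toLp (f m)) atTop (𝓝 (h.memLp_lim.toLp g)) :=
  (Lp.tendsto_Lp_iff_tendsto_eLpNorm'' _ h.memLp _ h.memLp_lim).2 h.tendsto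

lemma const (hg : MemLp g 2 μ) : L2Tendsto μ (fun _ => g) g :=
  ⟨fun _ => hg, hg, by simp⟩

lemma add (h : L2Tendsto μ f g) (h' : L2Tendsto μ f' g') :
    L2Tendsto μ (fun m x => f m x + f' m x) (fun x => g x + g' x) := by
  refine ⟨fun m => (h.memLp m).add (h'.memLp m), h.memLp_lim.add h'.memLp_lim, ?_⟩
  have h0 := h.tendsto.add h'.tendsto
  rw [add_zero] at h0
  refine tendsto_of_tendsto_of_tendsto_of_le_of_le tendsto_const_nhds h0 (fun _ => bot_le)
    fun m => ?_
  have e : (fun x => f m x + f' m x) - (fun x => g x + g' x) = (f m - g) + (f' m - g') := by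
    ext x; simp; ring
  rw [e]
  exact eLpNorm_add_le ((h.memLp m).sub h.memLp_lim).1 ((h'.memLp m).sub h'.memLp_lim).1
    (by norm_num)

lemma bdd_mul {c : α → ℝ} {K : ℝ} (hc : AEStronglyMeasurable c μ) (hK : ∀ᵐ x ∂μ, |c x| ≤ K)
    (h : L2Tendsto μ f g) : L2Tendsto μ (fun m x => c x * f m x) (fun x => c x * g x) := by
  have hm : ∀ {u : α → ℝ}, MemLp u 2 μ → MemLp (fun x => c x * u x) 2 μ := fun hu =>
    MemLp.of_le_mul (c := K) hu (hc.mul hu.1) (by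
      filter_upwards [hK] with x hx
      rw [norm_mul]; exact mul_le_mul_of_nonneg_right hx (norm_nonneg _))
  refine ⟨fun m => hm (h.memLp m), hm h.memLp_lim, ?_⟩
  have h0 := ENNReal.Tendsto.const_mul (a := ENNReal.ofReal K) h.tendsto
    (Or.inr ENNReal.ofReal_ne_top)
  rw [mul_zero] at h0
  refine tendsto_of_tendsto_of_tendsto_of_le_of_le tendsto_const_nhds h0 (fun _ => bot_le)
    fun m => ?_
  refine eLpNorm_le_mul_eLpNorm_of_ae_le_mul ?_ 2
  filter_upwards [hK] with x hx
  simp only [Pi.sub_apply, ← mul_sub, norm_mul]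
  exact mul_le_mul_of_nonneg_right hx (norm_nonneg _)

lemma const_mul (c : ℝ) (h : L2Tendsto μ f g) :
    L2Tendsto μ (fun m x => c * f m x) (fun x => c * g x) :=
  h.bdd_mul (c := fun _ => c) aestronglyMeasurable_const (ae_of_all _ fun _ => le_rfl)

lemma sub (h : L2Tendsto μ f g) (h' : L2Tendsto μ f' g') :
    L2Tendsto μ (fun m x => f m x - f' m x) (fun x => g x - g' x) := by
  simpa [sub_eq_add_neg] using h.add (h'.const_mul (-1))

lemma sum {ι : Type*} (s : Finset ι) {f : ι → ℕ → α → ℝ} {g : ι → α → ℝ}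
    (h : ∀ i ∈ s, L2Tendsto μ (f i) (g i)) :
    L2Tendsto μ (fun m x => ∑ i ∈ s, f i m x) (fun x => ∑ i ∈ s, g i x) := by
  classical
  induction s using Finset.induction_on with
  | empty => simpa using const (g := fun _ : α => (0 : ℝ)) MemLp.zero'
  | insert i s hi ih =>
    simp only [Finset.sum_insert hi]
    exact (h i (Finset.mem_insert_self _ _)).add
      (ih fun j hj => h j (Finset.mem_insert_of_mem hj))

lemma congr_lim (h : L2Tendsto μ f g) (hg : g =ᵐ[μ] g') : L2Tendsto μ f g' :=
  ⟨h.memLp, (memLp_congr_ae hg).1 h.memLp_lim, h.tendsto.congr fun _ =>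
    eLpNorm_congr_ae (EventuallyEq.rfl.sub hg)⟩

/-- Continuity of the L² inner product. -/
lemma integral_mul (h : L2Tendsto μ f g) (h' : L2Tendsto μ f' g') :
    Tendsto (fun m => ∫ x, f m x * f' m x ∂μ) atTop (𝓝 (∫ x, g x * g' x ∂μ)) := by
  have key : ∀ {u v : α → ℝ} (hu : MemLp u 2 μ) (hv : MemLp v 2 μ),
      inner ℝ (hu.toLp u) (hv.toLp v) = ∫ x, u x * v x ∂μ := by
    intro u v hu hv
    rw [L2.inner_def]
    refine integral_congr_ae ?_
    filter_upwards [hu.coeFn_toLp, hv.coeFn_toLp] with x h1 h2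
    rw [h1, h2]; simp [mul_comm]
  have := h.tendsto_toLp.inner (𝕜 := ℝ) h'.tendsto_toLp
  simpa only [key] using this

lemma integral_sq_mul {c : α → ℝ} {K : ℝ} (hc : AEStronglyMeasurable c μ)
    (hK : ∀ᵐ x ∂μ, |c x| ≤ K) (h : L2Tendsto μ f g) :
    Tendsto (fun m => ∫ x, f m x ^ 2 * c x ∂μ) atTop (𝓝 (∫ x, g x ^ 2 * c x ∂μ)) := by
  have := (h.bdd_mul hc hK).integral_mul h
  refine (this.congr fun m => ?_).trans (le_of_eq ?_)
  · congr 1; ext x; ring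
  · congr 2; ext x; ring

lemma integral_sq (h : L2Tendsto μ f g) :
    Tendsto (fun m => ∫ x, f m x ^ 2 ∂μ) atTop (𝓝 (∫ x, g x ^ 2 ∂μ)) := by
  simpa [pow_two] using h.integral_mul h

end L2Tendsto

lemma norm_toLp_sq (hg : MemLp g 2 μ) : ‖hg.toLp g‖ ^ 2 = ∫ x, g x ^ 2 ∂μ := by
  rw [← real_inner_self_eq_norm_sq, L2.inner_def]
  refine integral_congr_ae ?_
  filter_upwards [hg.coeFn_toLp] with x h1
  rw [h1]; simp [pow_two]

/-- A sequence whose increments are controlled by those of a convergent sequence converges. -/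
lemma exists_L2Tendsto_of_le {s : ℕ → α → ℝ} {t : α → ℝ} (hs : L2Tendsto μ s t) {C : ℝ}
    (hf : ∀ m, MemLp (f m) 2 μ)
    (h : ∀ m l, ∫ x, (f m x - f l x) ^ 2 ∂μ ≤ C * ∫ x, (s m x - s l x) ^ 2 ∂μ) :
    ∃ g, L2Tendsto μ f g := by
  -- No sign is assumed for C, hence the maximum with 0 under the root.
  have hC : ∀ m l, dist ((hf m).toLp (f m)) ((hf l).toLp (f l)) ≤
      Real.sqrt (max C 0) * dist ((hs.memLp m).toLp (s m)) ((hs.memLp l).toLp (s l)) := by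
    intro m l
    rw [dist_eq_norm, dist_eq_norm, ← MemLp.toLp_sub, ← MemLp.toLp_sub]
    refine le_of_sq_le_sq ?_ (by positivity)
    rw [mul_pow, Real.sq_sqrt (le_max_right _ _), norm_toLp_sq, norm_toLp_sq]
    refine (h m l).trans (mul_le_mul_of_nonneg_right (le_max_left _ _) ?_)
    exact integral_nonneg fun x => sq_nonneg _
  have hcs : CauchySeq fun m => (hs.memLp m).toLp (s m) := hs.tendsto_toLp.cauchySeq
  have hcf : CauchySeq fun m => (hf m).toLp (f m) := by
    rw [Metric.cauchySeq_iff] at hcs ⊢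
    intro ε hε
    have hD : 0 < Real.sqrt (max C 0) + 1 := by positivity
    obtain ⟨N, hN⟩ := hcs (ε / (Real.sqrt (max C 0) + 1)) (by positivity)
    refine ⟨N, fun m hm l hl => (hC m l).trans_lt ?_⟩
    have h1 := hN m hm l hl
    rw [lt_div_iff₀ hD] at h1
    nlinarith [dist_nonneg (x := (hs.memLp m).toLp (s m)) (y := (hs.memLp l).toLp (s l))]
  obtain ⟨G, hG⟩ := cauchySeq_tendsto_of_complete hcf
  refine ⟨G, hf, Lp.memLp G, ?_⟩
  refine (Lp.tendsto_Lp_iff_tendsto_eLpNorm'' _ hf _ (Lp.memLp G)).1 ?_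
  rwa [Lp.toLp_coeFn]

end L2Convergence

/-! ### Weak derivatives of real functions. -/

section WeakDerivative

variable {n : ℕ} {R : ℝ} {k : Fin n} {u g g' : (Fin n → ℝ) → ℝ}

/-- Weak partial derivatives in the cube of real functions. -/
def IsRealWeakDeriv (R : ℝ) (k : Fin n) (u g : (Fin n → ℝ) → ℝ) : Prop :=
  ∀ ψ : (Fin n → ℝ) → ℝ, ContDiff ℝ ∞ ψ → HasCompactSupport ψ → tsupport ψ ⊆ cube n R →
    ∫ x in cube n R, pd k ψ x * u x = - ∫ x in cube n R, ψ x * g x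

lemma integrable_cont_mul {c f : (Fin n → ℝ) → ℝ} (hc : ContinuousOn c (closedCube n R))
    (hf : MemLp f 2 (volume.restrict (cube n R))) :
    Integrable (fun x => c x * f x) (volume.restrict (cube n R)) :=
  (memLp_of_continuousOn hc 2).integrable_mul hf

/-- The fundamental lemma of the calculus of variations, applied to g − g'. -/
lemma IsRealWeakDeriv.ae_eq (h : IsRealWeakDeriv R k u g) (h' : IsRealWeakDeriv R k u g')
    (hg : MemLp g 2 (volume.restrict (cube n R)))
    (hg' : MemLp g' 2 (volume.restrict (cube n R))) :
    g =ᵐ[volume.restrict (cube n R)] g' := by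
  have key := isOpen_cube.ae_eq_zero_of_integral_contDiff_smul_eq_zero (U := cube n R)
    (f := fun x => g x - g' x) (μ := volume.restrict (cube n R))
    (((hg.sub hg').integrable (by norm_num)).locallyIntegrable.locallyIntegrableOn _) ?_
  · have h2 := ae_restrict_mem (μ := volume) (measurableSet_cube (n := n) (R := R))
    filter_upwards [key, h2] with x hx hx'
    exact sub_eq_zero.1 (hx hx')
  · intro ψ h1 h2 h3
    have e1 := h ψ h1 h2 h3
    have e2 := h' ψ h1 h2 h3
    simp only [smul_eq_mul, mul_sub]
    rw [integral_sub (integrable_cont_mul h1.continuous.continuousOn hg)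
      (integrable_cont_mul h1.continuous.continuousOn hg')]
    linarith

lemma vanish_off_tsupport {ψ : (Fin n → ℝ) → ℝ} (h : tsupport ψ ⊆ cube n R) {x : Fin n → ℝ}
    (hx : x ∉ cube n R) : ψ x = 0 :=
  image_eq_zero_of_notMem_tsupport fun h' => hx (h h')

end WeakDerivative

/-! ### Weak derivatives as limits of classical ones. -/

section WeakLimit

variable {d : ℕ} {R : ℝ}

/-- Integration by parts against a test function vanishing on the two faces orthogonal to the
direction of differentiation. -/
lemma integral_pd_mul_of_vanish (hR : 0 < R) (i : Fin (d + 1)) {f ψ : (Fin (d + 1) → ℝ) → ℝ}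
    (hf : ContDiff ℝ 1 f) (hψ : ContDiff ℝ 1 ψ) (hv : ∀ x, x i = R ∨ x i = -R → ψ x * f x = 0) :
    ∫ x in cube (d + 1) R, pd i ψ x * f x = - ∫ x in cube (d + 1) R, ψ x * pd i f x := by
  have h := integral_pd_of_contDiffOn hR i (f := fun x => ψ x * f x) (hψ.mul hf).contDiffOn
  have e : ∀ s, s = R ∨ s = -R → ∀ y : Fin d → ℝ, ψ (i.insertNth (α := fun _ => ℝ) s y) *
      f (i.insertNth (α := fun _ => ℝ) s y) = 0 := fun s hs y => hv _ (by simpa using hs)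
  simp only [e R (Or.inl rfl), e (-R) (Or.inr rfl), integral_zero, sub_zero] at h
  have hc : ∀ {f : (Fin (d + 1) → ℝ) → ℝ}, ContDiff ℝ 1 f → Continuous (pd i f) :=
    fun hf => (contDiff_pd (m := 0) (by simpa using hf)).continuous
  have e2 : ∀ x, pd i (fun x => ψ x * f x) x = pd i ψ x * f x + ψ x * pd i f x := fun x =>
    pd_mul (hψ.differentiable one_ne_zero x) (hf.differentiable one_ne_zero x)
  simp only [e2] at h
  have i1 : IntegrableOn (fun x => pd i ψ x * f x) (cube (d + 1) R) :=
    integrableOn_of_continuousOn ((hc hψ).mul hf.continuous).continuousOn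
  have i2 : IntegrableOn (fun x => ψ x * pd i f x) (cube (d + 1) R) :=
    integrableOn_of_continuousOn (hψ.continuous.mul (hc hf)).continuousOn
  rw [integral_add i1 i2] at h
  linarith

lemma isRealWeakDeriv_of_contDiff (hR : 0 < R) (i : Fin (d + 1)) {f : (Fin (d + 1) → ℝ) → ℝ}
    (hf : ContDiff ℝ 1 f) : IsRealWeakDeriv R i f (pd i f) := by
  intro ψ h1 h2 h3
  refine integral_pd_mul_of_vanish hR i hf (h1.of_le (by norm_cast)) fun x hx => ?_
  rw [vanish_off_tsupport h3, zero_mul]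
  intro h
  have := h i
  rcases hx with hx | hx <;> rw [hx] at this <;> simp at this

/-- Weak differentiation is closed: both sides of the defining identity are L² pairings with a fixed
function. -/
lemma IsRealWeakDeriv.of_L2Tendsto {i : Fin (d + 1)} {f f' : ℕ → (Fin (d + 1) → ℝ) → ℝ}
    {u g : (Fin (d + 1) → ℝ) → ℝ} (h : ∀ m, IsRealWeakDeriv R i (f m) (f' m))
    (hf : L2Tendsto (volume.restrict (cube (d + 1) R)) f u)
    (hf' : L2Tendsto (volume.restrict (cube (d + 1) R)) f' g) : IsRealWeakDeriv R i u g := by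
  intro ψ h1 h2 h3
  have c1 : MemLp (pd i ψ) 2 (volume.restrict (cube (d + 1) R)) :=
    memLp_of_continuousOn (contDiff_infty_pd h1).continuous.continuousOn 2
  have c2 : MemLp ψ 2 (volume.restrict (cube (d + 1) R)) :=
    memLp_of_continuousOn h1.continuous.continuousOn 2
  have t1 := (L2Tendsto.const c1).integral_mul hf
  have t2 := ((L2Tendsto.const c2).integral_mul hf').neg
  exact tendsto_nhds_unique (t1.congr fun m => h m ψ h1 h2 h3) t2

/-- Limits of classical derivatives are weak derivatives. -/
lemma L2Tendsto.pd_of_isRealWeakDeriv (hR : 0 < R) {i : Fin (d + 1)}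
    {f : ℕ → (Fin (d + 1) → ℝ) → ℝ} {u g g' : (Fin (d + 1) → ℝ) → ℝ}
    (hc : ∀ m, ContDiff ℝ 1 (f m)) (hf : L2Tendsto (volume.restrict (cube (d + 1) R)) f u)
    (hf' : L2Tendsto (volume.restrict (cube (d + 1) R)) (fun m => pd i (f m)) g')
    (hg : MemLp g 2 (volume.restrict (cube (d + 1) R))) (hug : IsRealWeakDeriv R i u g) :
    L2Tendsto (volume.restrict (cube (d + 1) R)) (fun m => pd i (f m)) g :=
  hf'.congr_lim ((IsRealWeakDeriv.of_L2Tendsto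
    (fun m => isRealWeakDeriv_of_contDiff hR i (hc m)) hf hf').ae_eq hug hf'.memLp_lim hg)

end WeakLimit

/-! ### Tensor products of functions of one variable. -/

section ProductFunctions

variable {n : ℕ}

/-- The tensor product of functions of one variable. -/
def prodFun (h : Fin n → ℝ → ℝ) (x : Fin n → ℝ) : ℝ := ∏ j, h j (x j)

lemma contDiff_prodFun {m : WithTop ℕ∞} {h : Fin n → ℝ → ℝ} (hh : ∀ j, ContDiff ℝ m (h j)) :
    ContDiff ℝ m (prodFun h) :=
  contDiff_prod fun j _ => (hh j).comp (contDiff_apply ℝ ℝ j)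

lemma prodFun_update (h : Fin n → ℝ → ℝ) (i : Fin n) (f : ℝ → ℝ) (x : Fin n → ℝ) :
    prodFun (Function.update h i f) x = f (x i) * ∏ j ∈ Finset.univ.erase i, h j (x j) := by
  unfold prodFun
  rw [← Finset.mul_prod_erase _ _ (Finset.mem_univ i), Function.update_self]
  congr 1
  refine Finset.prod_congr rfl fun j hj => ?_
  rw [Function.update_of_ne (Finset.ne_of_mem_erase hj)]

/-- Writing the derivative as an updated tensor product allows the rule to be applied a second time.
-/
lemma pd_prodFun {h : Fin n → ℝ → ℝ} (hh : ∀ j, Differentiable ℝ (h j)) (i : Fin n)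
    (x : Fin n → ℝ) :
    pd i (prodFun h) x = prodFun (Function.update h i (deriv (h i))) x := by
  have hd : DifferentiableAt ℝ (prodFun h) x := by
    unfold prodFun
    have h1 : ∀ j, DifferentiableAt ℝ (fun x : Fin n → ℝ => h j (x j)) x := fun j =>
      (hh j (x j)).comp x (differentiableAt_apply (𝕜 := ℝ) j x)
    exact (HasFDerivAt.finsetProd fun j _ => (h1 j).hasFDerivAt).differentiableAt
  rw [pd_eq_deriv_update hd, prodFun_update]
  have : (fun t => prodFun h (Function.update x i t)) =
      fun t => h i t * ∏ j ∈ Finset.univ.erase i, h j (x j) := by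
    ext t
    unfold prodFun
    rw [← Finset.mul_prod_erase _ _ (Finset.mem_univ i), Function.update_self]
    congr 1
    refine Finset.prod_congr rfl fun j hj => ?_
    rw [Function.update_of_ne (Finset.ne_of_mem_erase hj)]
  rw [this, deriv_mul_const (hh i _)]

end ProductFunctions

/-! ### Cutoffs on an interval. -/

section Cutoff

/-- A cutoff function for the interval `(-R, R)`. -/
def cutoff (R m t : ℝ) : ℝ :=
  Real.smoothTransition (m * (R - t) - 1) * Real.smoothTransition (m * (R + t) - 1)

variable {R m t : ℝ}

lemma contDiff_cutoff {k : ℕ∞} : ContDiff ℝ k (cutoff R m) := by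
  unfold cutoff
  exact (Real.smoothTransition.contDiff.comp (by fun_prop)).mul
    (Real.smoothTransition.contDiff.comp (by fun_prop))

lemma abs_cutoff_le_one : |cutoff R m t| ≤ 1 := by
  unfold cutoff
  rw [abs_of_nonneg (mul_nonneg (Real.smoothTransition.nonneg _) (Real.smoothTransition.nonneg _))]
  exact mul_le_one₀ (Real.smoothTransition.le_one _) (Real.smoothTransition.nonneg _)
    (Real.smoothTransition.le_one _)

/-- The shift by −1 puts the transition between the distances 1/m and 2/m from the endpoints (for m
> 0), so the support stays away from them. -/
lemma cutoff_eq_zero (h : m * (R - t) ≤ 1 ∨ m * (R + t) ≤ 1) : cutoff R m t = 0 := by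
  unfold cutoff
  rcases h with h | h
  · rw [Real.smoothTransition.zero_of_nonpos (x := m * (R - t) - 1) (by linarith), zero_mul]
  · rw [Real.smoothTransition.zero_of_nonpos (x := m * (R + t) - 1) (by linarith), mul_zero]

lemma cutoff_eq_one (h : 2 ≤ m * (R - t)) (h' : 2 ≤ m * (R + t)) : cutoff R m t = 1 := by
  unfold cutoff
  rw [Real.smoothTransition.one_of_one_le (by linarith),
    Real.smoothTransition.one_of_one_le (by linarith), mul_one]

/-- The derivative vanishes off [0, 1], and s + 1 ≤ 2 there. In the application s + 1 is m times the
distance to an endpoint. -/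
lemma exists_smoothTransition_bound :
    ∃ K, 0 ≤ K ∧ ∀ s, -1 ≤ s → |deriv Real.smoothTransition s| * (s + 1) ≤ K := by
  have hc : Continuous (deriv Real.smoothTransition) :=
    (Real.smoothTransition.contDiff (n := 1)).continuous_deriv le_rfl
  obtain ⟨K, hK⟩ := (isCompact_Icc (a := (0 : ℝ)) (b := 1)).exists_bound_of_continuousOn
    hc.continuousOn
  have hK0 : 0 ≤ K := (norm_nonneg _).trans (hK 0 (by simp))
  refine ⟨2 * K, by positivity, fun s hs => ?_⟩
  rcases lt_or_ge s 0 with h | h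
  · have : Real.smoothTransition =ᶠ[𝓝 s] fun _ => 0 := by
      filter_upwards [gt_mem_nhds h] with y hy using Real.smoothTransition.zero_of_nonpos hy.le
    rw [this.deriv_eq]; simp [hK0]
  · rcases le_or_gt s 1 with h1 | h1
    · have := hK s ⟨h, h1⟩
      rw [Real.norm_eq_abs] at this
      nlinarith [abs_nonneg (deriv Real.smoothTransition s)]
    · have : Real.smoothTransition =ᶠ[𝓝 s] fun _ => 1 := by
        filter_upwards [lt_mem_nhds h1] with y hy using Real.smoothTransition.one_of_one_le hy.le
      rw [this.deriv_eq]; simp [hK0]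

lemma deriv_cutoff : deriv (cutoff R m) t =
    -(m * deriv Real.smoothTransition (m * (R - t) - 1)) *
        Real.smoothTransition (m * (R + t) - 1) +
      Real.smoothTransition (m * (R - t) - 1) *
        (m * deriv Real.smoothTransition (m * (R + t) - 1)) := by
  have hd : Differentiable ℝ Real.smoothTransition :=
    (Real.smoothTransition.contDiff (n := 1)).differentiable (by norm_num)
  have h1 : HasDerivAt (fun t => m * (R - t) - 1) (-m) t := by
    simpa using (((hasDerivAt_id t).const_sub R).const_mul m).sub_const 1
  have h2 : HasDerivAt (fun t => m * (R + t) - 1) m t := by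
    simpa using (((hasDerivAt_id t).const_add R).const_mul m).sub_const 1
  have h3 := ((hd _).hasDerivAt.comp t h1).mul ((hd _).hasDerivAt.comp t h2)
  have h4 : deriv (cutoff R m) t = _ := h3.deriv
  rw [h4]
  simp only [Function.comp]
  ring

/-- The derivative of the cutoff is of order m, but only where the distance to an endpoint is of
order 1/m; a factor v vanishing linearly at the endpoints compensates, uniformly in m. -/
lemma exists_deriv_cutoff_bound :
    ∃ K, 0 ≤ K ∧ ∀ R m t v C : ℝ, 0 ≤ m → t ∈ Set.Ioo (-R) R → 0 ≤ C → |v| ≤ C * (R - t) →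
      |v| ≤ C * (R + t) → |deriv (cutoff R m) t * v| ≤ K * C := by
  obtain ⟨K, hK0, hK⟩ := exists_smoothTransition_bound
  refine ⟨2 * K, by positivity, fun R m t v C hm ht hC h1 h2 => ?_⟩
  have a1 : 0 ≤ R - t := by linarith [ht.2]
  have a2 : 0 ≤ R + t := by linarith [ht.1]
  have b1 := hK (m * (R - t) - 1) (by nlinarith [mul_nonneg hm a1])
  have b2 := hK (m * (R + t) - 1) (by nlinarith [mul_nonneg hm a2])
  rw [sub_add_cancel] at b1 b2
  have key : ∀ D S r : ℝ, 0 ≤ r → |v| ≤ C * r → 0 ≤ S → S ≤ 1 → |D| * (m * r) ≤ K →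
      |m * D * S * v| ≤ K * C := by
    intro D S r hr hv hS hS1 hD
    rw [abs_mul, abs_mul, abs_mul, abs_of_nonneg hm, abs_of_nonneg hS]
    calc m * |D| * S * |v| ≤ m * |D| * 1 * (C * r) := by gcongr
      _ = |D| * (m * r) * C := by ring
      _ ≤ K * C := mul_le_mul_of_nonneg_right hD hC
  have k1 := key _ _ _ a1 h1 (Real.smoothTransition.nonneg (m * (R + t) - 1))
    (Real.smoothTransition.le_one _) b1
  have k2 := key _ _ _ a2 h2 (Real.smoothTransition.nonneg (m * (R - t) - 1))
    (Real.smoothTransition.le_one _) b2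
  rw [deriv_cutoff]
  rw [abs_le] at k1 k2 ⊢
  constructor <;> linarith

lemma eventually_cutoff (ht : t ∈ Set.Ioo (-R) R) :
    ∀ᶠ m : ℕ in atTop, cutoff R m t = 1 ∧ deriv (cutoff R m) t = 0 := by
  have a1 : 0 < R - t := by linarith [ht.2]
  have a2 : 0 < R + t := by linarith [ht.1]
  have t1 : Tendsto (fun m : ℕ => (m : ℝ) * (R - t)) atTop atTop :=
    tendsto_natCast_atTop_atTop.atTop_mul_const a1
  have t2 : Tendsto (fun m : ℕ => (m : ℝ) * (R + t)) atTop atTop :=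
    tendsto_natCast_atTop_atTop.atTop_mul_const a2
  filter_upwards [t1.eventually_gt_atTop 2, t2.eventually_gt_atTop 2] with m h1 h2
  refine ⟨cutoff_eq_one h1.le h2.le, ?_⟩
  have : cutoff R m =ᶠ[𝓝 t] fun _ => 1 := by
    have c1 : ContinuousAt (fun s => (m : ℝ) * (R - s)) t := by fun_prop
    have c2 : ContinuousAt (fun s => (m : ℝ) * (R + s)) t := by fun_prop
    filter_upwards [c1.eventually (lt_mem_nhds h1), c2.eventually (lt_mem_nhds h2)] with s h3 h4
    exact cutoff_eq_one h3.le h4.le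
  rw [this.deriv_eq]; simp

end Cutoff

/-! ### Cutoffs on the cube and larger classes of test functions. -/

section CubeCutoff

variable {n : ℕ} {R : ℝ}

/-- A cutoff function for the cube. -/
def cubeCutoff (n : ℕ) (R : ℝ) (m : ℕ) : (Fin n → ℝ) → ℝ := prodFun fun _ => cutoff R m

lemma contDiff_cubeCutoff (m : ℕ) : ContDiff ℝ ∞ (cubeCutoff n R m) :=
  contDiff_prodFun fun _ => contDiff_cutoff

lemma tsupport_cubeCutoff {m : ℕ} (hm : 0 < m) :
    tsupport (cubeCutoff n R m) ⊆ closedCube n (R - 1 / m) := by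
  refine closure_minimal (fun x hx i => ?_) isCompact_closedCube.isClosed
  by_contra hi
  refine hx (Finset.prod_eq_zero (Finset.mem_univ i) (cutoff_eq_zero ?_))
  have hm' : (0 : ℝ) < m := by exact_mod_cast hm
  rw [Set.mem_Icc, not_and_or, not_le, not_le] at hi
  have e : (m : ℝ) * (1 / m) = 1 := by field_simp
  rcases hi with hi | hi
  · right; nlinarith
  · left; nlinarith

lemma closedCube_sub_subset {m : ℕ} (hm : 0 < m) : closedCube n (R - 1 / m) ⊆ cube n R := by
  intro x hx i
  have hm' : (0 : ℝ) < 1 / m := by positivity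
  exact ⟨by linarith [(hx i).1], by linarith [(hx i).2]⟩

lemma abs_cubeCutoff_le_one (m : ℕ) (x : Fin n → ℝ) : |cubeCutoff n R m x| ≤ 1 := by
  unfold cubeCutoff prodFun
  rw [Finset.abs_prod]
  exact Finset.prod_le_one (fun _ _ => abs_nonneg _) fun _ _ => abs_cutoff_le_one

lemma pd_cubeCutoff (m : ℕ) (i : Fin n) (x : Fin n → ℝ) :
    ∃ c, |c| ≤ 1 ∧ pd i (cubeCutoff n R m) x = c * deriv (cutoff R m) (x i) := by
  refine ⟨∏ j ∈ Finset.univ.erase i, cutoff R m (x j), ?_, ?_⟩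
  · rw [Finset.abs_prod]
    exact Finset.prod_le_one (fun _ _ => abs_nonneg _) fun _ _ => abs_cutoff_le_one
  · unfold cubeCutoff
    rw [pd_prodFun (fun _ => (contDiff_cutoff (k := 1)).differentiable (by norm_num)),
      prodFun_update, mul_comm]

/-- The mean value inequality between x and its projection to a face; in the sup norm their distance
is the difference of the i-th coordinates. -/
lemma abs_le_of_vanish {ψ : (Fin n → ℝ) → ℝ} (hψ : ContDiff ℝ ∞ ψ) {i : Fin n}
    (hv : ∀ x, x i = R ∨ x i = -R → ψ x = 0) :
    ∃ C, 0 ≤ C ∧ ∀ x ∈ cube n R, |ψ x| ≤ C * (R - x i) ∧ |ψ x| ≤ C * (R + x i) := by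
  have hc : Continuous (fderiv ℝ ψ) := hψ.continuous_fderiv (by simp)
  obtain ⟨C, hC⟩ := (isCompact_closedCube (n := n) (R := R)).exists_bound_of_continuousOn
    hc.continuousOn
  have hconv : Convex ℝ (closedCube n R) := by rw [closedCube_eq_Icc]; exact convex_Icc _ _
  refine ⟨max C 0, le_max_right _ _, fun x hx => ?_⟩
  have hx' := cube_subset_closedCube hx
  have hR : 0 < R := by linarith [(hx i).1, (hx i).2]
  have key : ∀ s, s = R ∨ s = -R → |ψ x| ≤ max C 0 * |x i - s| := by
    intro s hs
    have hmem : Function.update x i s ∈ closedCube n R := by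
      intro j
      rcases eq_or_ne j i with rfl | h
      · rw [Function.update_self]; rcases hs with rfl | rfl <;> constructor <;> linarith
      · rw [Function.update_of_ne h]; exact hx' j
    have := hconv.norm_image_sub_le_of_norm_fderiv_le (𝕜 := ℝ) (f := ψ) (C := max C 0)
      (fun y _ => hψ.differentiable (by simp) y)
      (fun y hy => (hC y hy).trans (le_max_left _ _)) hmem hx'
    rw [hv (Function.update x i s) (by simpa using hs), sub_zero, Real.norm_eq_abs] at this
    refine this.trans (mul_le_mul_of_nonneg_left ?_ (le_max_right _ _))
    refine (pi_norm_le_iff_of_nonneg (abs_nonneg _)).2 fun j => ?_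
    rcases eq_or_ne j i with rfl | h
    · simp
    · simp [Function.update_of_ne h]
  constructor
  · have := key R (Or.inl rfl)
    rwa [abs_of_nonpos (a := x i - R) (by linarith [(hx i).2]), neg_sub] at this
  · have := key (-R) (Or.inr rfl)
    rwa [sub_neg_eq_add, add_comm, abs_of_nonneg (a := R + x i) (by linarith [(hx i).1])] at this

/-- The defining identity of weak derivatives extends to smooth test functions that vanish on the
two faces orthogonal to the direction of differentiation. -/
lemma IsRealWeakDeriv.integral_eq {i : Fin n} {u g ψ : (Fin n → ℝ) → ℝ}
    (h : IsRealWeakDeriv R i u g) (hu : MemLp u 2 (volume.restrict (cube n R)))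
    (hg : MemLp g 2 (volume.restrict (cube n R))) (hψ : ContDiff ℝ ∞ ψ)
    (hv : ∀ x, x i = R ∨ x i = -R → ψ x = 0) :
    ∫ x in cube n R, pd i ψ x * u x = - ∫ x in cube n R, ψ x * g x := by
  obtain ⟨C, hC0, hC⟩ := abs_le_of_vanish hψ hv
  obtain ⟨K, hK0, hK⟩ := exists_deriv_cutoff_bound
  have hpc : Continuous (pd i ψ) := (contDiff_infty_pd hψ).continuous
  obtain ⟨P, hP0, hP⟩ := exists_bound (R := R) hpc.continuousOn
  obtain ⟨Q, hQ0, hQ⟩ := exists_bound (R := R) hψ.continuous.continuousOn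
  have hchi : ∀ m, ContDiff ℝ ∞ (fun x => cubeCutoff n R m x * ψ x) := fun m =>
    (contDiff_cubeCutoff m).mul hψ
  have hpd : ∀ m x, pd i (fun x => cubeCutoff n R m x * ψ x) x =
      pd i (cubeCutoff n R m) x * ψ x + cubeCutoff n R m x * pd i ψ x := fun m x =>
    pd_mul ((contDiff_cubeCutoff m).differentiable (by simp) x) (hψ.differentiable (by simp) x)
  -- Dominated convergence with test functions χ_m ψ. Only the i-th derivative falls on χ_m, so
  -- vanishing of ψ on the two faces orthogonal to direction i suffices to bound ∂_iχ_m ψ uniformly;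
  -- pointwise this term is eventually zero.
  have t1 : Tendsto (fun m : ℕ => ∫ x in cube n R, pd i (fun x => cubeCutoff n R m x * ψ x) x * u x)
      atTop (𝓝 (∫ x in cube n R, pd i ψ x * u x)) := by
    refine tendsto_integral_of_dominated_convergence (fun x => (K * C + P) * |u x|)
      (fun m => ?_) ((hu.integrable (by norm_num)).abs.const_mul _) (fun m => ?_) ?_
    · exact (contDiff_infty_pd (hchi m)).continuous.aestronglyMeasurable.mul hu.1
    · refine ae_restrict_cube_of_forall fun x hx => ?_
      rw [norm_mul, Real.norm_eq_abs, Real.norm_eq_abs]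
      refine mul_le_mul_of_nonneg_right ?_ (abs_nonneg _)
      rw [hpd]
      refine (abs_add_le _ _).trans (add_le_add ?_ ?_)
      · obtain ⟨c, hc1, hc⟩ := pd_cubeCutoff (R := R) m i x
        rw [hc, mul_assoc, abs_mul]
        refine (mul_le_of_le_one_left (abs_nonneg _) hc1).trans ?_
        exact hK R m (x i) (ψ x) C (Nat.cast_nonneg m) (hx i) hC0 (hC x hx).1 (hC x hx).2
      · rw [abs_mul]
        exact (mul_le_of_le_one_left (abs_nonneg _) (abs_cubeCutoff_le_one m x)).trans
          (hP x (cube_subset_closedCube hx))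
    · refine ae_restrict_cube_of_forall fun x hx => ?_
      refine Filter.Tendsto.congr' (f₁ := fun _ => pd i ψ x * u x) ?_ tendsto_const_nhds
      have h1 : ∀ᶠ m : ℕ in atTop, ∀ j, cutoff R m (x j) = 1 ∧ deriv (cutoff R m) (x j) = 0 :=
        eventually_all.2 fun j => eventually_cutoff (hx j)
      filter_upwards [h1] with m hm
      obtain ⟨c, -, hc⟩ := pd_cubeCutoff (R := R) m i x
      rw [hpd, hc, (hm i).2]
      have : cubeCutoff n R m x = 1 := by
        unfold cubeCutoff prodFun
        exact Finset.prod_eq_one fun j _ => (hm j).1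
      rw [this]; ring
  have t2 : Tendsto (fun m : ℕ => ∫ x in cube n R, cubeCutoff n R m x * ψ x * g x)
      atTop (𝓝 (∫ x in cube n R, ψ x * g x)) := by
    refine tendsto_integral_of_dominated_convergence (fun x => Q * |g x|)
      (fun m => ?_) ((hg.integrable (by norm_num)).abs.const_mul _) (fun m => ?_) ?_
    · exact (hchi m).continuous.aestronglyMeasurable.mul hg.1
    · refine ae_restrict_cube_of_forall fun x hx => ?_
      rw [norm_mul, Real.norm_eq_abs, Real.norm_eq_abs]
      refine mul_le_mul_of_nonneg_right ?_ (abs_nonneg _)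
      rw [abs_mul]
      exact (mul_le_of_le_one_left (abs_nonneg _) (abs_cubeCutoff_le_one m x)).trans
        (hQ x (cube_subset_closedCube hx))
    · refine ae_restrict_cube_of_forall fun x hx => ?_
      refine Filter.Tendsto.congr' (f₁ := fun _ => ψ x * g x) ?_ tendsto_const_nhds
      have h1 : ∀ᶠ m : ℕ in atTop, ∀ j, cutoff R m (x j) = 1 ∧ deriv (cutoff R m) (x j) = 0 :=
        eventually_all.2 fun j => eventually_cutoff (hx j)
      filter_upwards [h1] with m hm
      have : cubeCutoff n R m x = 1 := by
        unfold cubeCutoff prodFun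
        exact Finset.prod_eq_one fun j _ => (hm j).1
      rw [this]; ring
  refine tendsto_nhds_unique_of_eventuallyEq t1 t2.neg ?_
  filter_upwards [eventually_gt_atTop 0] with m hm
  have hsupp : tsupport (fun x => cubeCutoff n R m x * ψ x) ⊆ closedCube n (R - 1 / m) :=
    (tsupport_mul_subset_left).trans (tsupport_cubeCutoff hm)
  exact h _ (hchi m) (isCompact_closedCube.of_isClosed_subset (isClosed_tsupport _) hsupp)
    (hsupp.trans (closedCube_sub_subset hm))

end CubeCutoff

/-! ### Traces and boundary integrals. -/

section Traces

variable {d : ℕ} {R : ℝ}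

/-- The trace on a face of the cube of a real function with given weak gradient is zero. -/
def HasRealZeroTrace (R : ℝ) (w : (Fin (d + 1) → ℝ) → ℝ)
    (dw : Fin (d + 1) → (Fin (d + 1) → ℝ) → ℝ) (i : Fin (d + 1)) (s : ℝ) : Prop :=
  ∃ φ : ℕ → (Fin (d + 1) → ℝ) → ℝ, (∀ j, ContDiff ℝ 1 (φ j)) ∧
    L2Tendsto (volume.restrict (cube (d + 1) R)) φ w ∧
    (∀ k, L2Tendsto (volume.restrict (cube (d + 1) R)) (fun j => pd k (φ j)) (dw k)) ∧
    L2Tendsto (volume.restrict (cube d R))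
      (fun j y => φ j (i.insertNth (α := fun _ => ℝ) s y)) (fun _ => 0)

lemma continuous_insertNth (i : Fin (d + 1)) (s : ℝ) :
    Continuous fun y : Fin d → ℝ => i.insertNth (α := fun _ => ℝ) s y :=
  Continuous.finInsertNth i continuous_const continuous_id

lemma continuous_pd {f : (Fin (d + 1) → ℝ) → ℝ} (hf : ContDiff ℝ 1 f) (i : Fin (d + 1)) :
    Continuous (pd i f) := (contDiff_pd (m := 0) (by simpa using hf)).continuous

/-- For the smooth approximants the only boundary term is the pairing of ψ with their restriction to
the face x_i = s, which tends to zero; ψ kills the opposite face. Absolute values make the sign of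
the face irrelevant. -/
lemma HasRealZeroTrace.integral_eq_of_vanish (hR : 0 < R) {w ψ : (Fin (d + 1) → ℝ) → ℝ}
    {dw : Fin (d + 1) → (Fin (d + 1) → ℝ) → ℝ} {i : Fin (d + 1)} {s : ℝ} (hs : s = R ∨ s = -R)
    (h : HasRealZeroTrace R w dw i s) (hψ : ContDiff ℝ 1 ψ)
    (hv : ∀ x, x i = -s → ψ x = 0) :
    ∫ x in cube (d + 1) R, pd i ψ x * w x = - ∫ x in cube (d + 1) R, ψ x * dw i x := by
  obtain ⟨φ, h1, h2, h3, h4⟩ := h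
  have c1 : MemLp (pd i ψ) 2 (volume.restrict (cube (d + 1) R)) :=
    memLp_of_continuousOn (continuous_pd hψ i).continuousOn 2
  have c2 : MemLp ψ 2 (volume.restrict (cube (d + 1) R)) :=
    memLp_of_continuousOn hψ.continuous.continuousOn 2
  have c3 : MemLp (fun y => ψ (i.insertNth (α := fun _ => ℝ) s y)) 2
      (volume.restrict (cube d R)) :=
    memLp_of_continuousOn (hψ.continuous.comp (continuous_insertNth i s)).continuousOn 2
  have t1 := (L2Tendsto.const c1).integral_mul h2
  have t2 := (L2Tendsto.const c2).integral_mul (h3 i)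
  have t3 := (L2Tendsto.const c3).integral_mul h4
  simp only [mul_zero, integral_zero] at t3
  have key : ∀ j, |(∫ x in cube (d + 1) R, pd i ψ x * φ j x)
      + ∫ x in cube (d + 1) R, ψ x * pd i (φ j) x| =
      |∫ y in cube d R, ψ (i.insertNth (α := fun _ => ℝ) s y) *
        φ j (i.insertNth (α := fun _ => ℝ) s y)| := by
    intro j
    have e1 := integral_pd_of_contDiffOn hR i (f := fun x => ψ x * φ j x)
      (hψ.mul (h1 j)).contDiffOn
    have e2 : ∀ x, pd i (fun x => ψ x * φ j x) x = pd i ψ x * φ j x + ψ x * pd i (φ j) x :=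
      fun x => pd_mul (hψ.differentiable one_ne_zero x) ((h1 j).differentiable one_ne_zero x)
    simp only [e2] at e1
    have i1 : IntegrableOn (fun x => pd i ψ x * φ j x) (cube (d + 1) R) :=
      integrableOn_of_continuousOn ((continuous_pd hψ i).mul (h1 j).continuous).continuousOn
    have i2 : IntegrableOn (fun x => ψ x * pd i (φ j) x) (cube (d + 1) R) :=
      integrableOn_of_continuousOn (hψ.continuous.mul (continuous_pd (h1 j) i)).continuousOn
    rw [integral_add i1 i2] at e1
    have e3 : ∀ y : Fin d → ℝ, ψ (i.insertNth (α := fun _ => ℝ) (-s) y) = 0 := fun y =>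
      hv _ (by simp)
    rcases hs with rfl | rfl
    · simp only [e3, zero_mul, integral_zero, sub_zero] at e1
      rw [e1]
    · rw [neg_neg] at e3
      simp only [e3, zero_mul, integral_zero, zero_sub] at e1
      rw [e1, abs_neg]
  have t4 := (t1.add t2).abs
  simp only [key] at t4
  have t5 := tendsto_nhds_unique t4 t3.abs
  rw [abs_zero, abs_eq_zero] at t5
  linarith

/-- Integration by parts for functions with zero traces on two opposite faces. -/
lemma integral_pd_mul_of_trace (hR : 0 < R) {w ψ : (Fin (d + 1) → ℝ) → ℝ}
    {dw : Fin (d + 1) → (Fin (d + 1) → ℝ) → ℝ} {i : Fin (d + 1)}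
    (h : HasRealZeroTrace R w dw i R) (h' : HasRealZeroTrace R w dw i (-R))
    (hw : MemLp w 2 (volume.restrict (cube (d + 1) R)))
    (hdw : MemLp (dw i) 2 (volume.restrict (cube (d + 1) R))) (hψ : ContDiff ℝ 1 ψ) :
    ∫ x in cube (d + 1) R, pd i ψ x * w x = - ∫ x in cube (d + 1) R, ψ x * dw i x := by
  -- The two traces come with different approximating sequences, so the faces are treated one at a
  -- time: the affine partition of unity (R ± x_i)/(2R) splits ψ into pieces, each vanishing on one
  -- of them.
  have hl₁ : ContDiff ℝ 1 fun x : Fin (d + 1) → ℝ => (R + x i) / (2 * R) := by fun_prop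
  have hl₂ : ContDiff ℝ 1 fun x : Fin (d + 1) → ℝ => (R - x i) / (2 * R) := by fun_prop
  have hψ₁ := hl₁.mul hψ
  have hψ₂ := hl₂.mul hψ
  have e1 := h.integral_eq_of_vanish hR (Or.inl rfl) hψ₁ (fun x hx => by rw [hx]; ring)
  have e2 := h'.integral_eq_of_vanish hR (Or.inr rfl) hψ₂ (fun x hx => by rw [hx]; ring)
  have hsum : ∀ x : Fin (d + 1) → ℝ, ψ x = (R + x i) / (2 * R) * ψ x + (R - x i) / (2 * R) * ψ x := by
    intro x; field_simp; ring
  have hpd : ∀ x, pd i ψ x = pd i (fun x => (R + x i) / (2 * R) * ψ x) x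
      + pd i (fun x => (R - x i) / (2 * R) * ψ x) x := by
    intro x
    rw [← pd_add (hψ₁.differentiable one_ne_zero x) (hψ₂.differentiable one_ne_zero x)]
    simp only [← hsum]
  have s1 : ∫ x in cube (d + 1) R, pd i ψ x * w x =
      (∫ x in cube (d + 1) R, pd i (fun x => (R + x i) / (2 * R) * ψ x) x * w x) +
      ∫ x in cube (d + 1) R, pd i (fun x => (R - x i) / (2 * R) * ψ x) x * w x := by
    rw [← integral_add (integrable_cont_mul (continuous_pd hψ₁ i).continuousOn hw)
      (integrable_cont_mul (continuous_pd hψ₂ i).continuousOn hw)]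
    congr 1; ext x; rw [hpd]; ring
  have s2 : ∫ x in cube (d + 1) R, ψ x * dw i x =
      (∫ x in cube (d + 1) R, (R + x i) / (2 * R) * ψ x * dw i x) +
      ∫ x in cube (d + 1) R, (R - x i) / (2 * R) * ψ x * dw i x := by
    rw [← integral_add (integrable_cont_mul hψ₁.continuous.continuousOn hdw)
      (integrable_cont_mul hψ₂.continuous.continuousOn hdw)]
    congr 1; ext x; rw [← add_mul, ← hsum]
  rw [s1, s2, e1, e2]; ring

/-- The function (R + x_i)/(2R) · f² equals f² on the upper face and 0 on the lower one; integrate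
its i-th derivative. R ≥ 1 bounds the derivative of the affine factor by 1. -/
lemma trace_inequality (hR : 1 ≤ R) (i : Fin (d + 1)) {f : (Fin (d + 1) → ℝ) → ℝ}
    (hf : ContDiff ℝ 1 f) :
    ∫ y in cube d R, f (i.insertNth (α := fun _ => ℝ) R y) ^ 2 ≤
      2 * ((∫ x in cube (d + 1) R, f x ^ 2) + ∫ x in cube (d + 1) R, pd i f x ^ 2) := by
  have hR0 : 0 < R := by linarith
  have hl : ContDiff ℝ 1 fun x : Fin (d + 1) → ℝ => (R + x i) / (2 * R) := by fun_prop
  have e1 := integral_pd_of_contDiffOn hR0 i (f := fun x => (R + x i) / (2 * R) * f x ^ 2)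
    (hl.mul (hf.pow 2)).contDiffOn
  simp only [Fin.insertNth_apply_same] at e1
  have e2 : (R + R) / (2 * R) = 1 := by field_simp; ring
  simp only [e2, add_neg_cancel, zero_div, zero_mul, one_mul, integral_zero, sub_zero] at e1
  have i1 : IntegrableOn (fun x => f x ^ 2) (cube (d + 1) R) :=
    integrableOn_of_continuousOn (hf.continuous.pow 2).continuousOn
  have i2 : IntegrableOn (fun x => pd i f x ^ 2) (cube (d + 1) R) :=
    integrableOn_of_continuousOn ((continuous_pd hf i).pow 2).continuousOn
  rw [← e1, ← integral_add i1 i2, ← integral_const_mul]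
  refine setIntegral_mono_on (integrableOn_pd hR0 (hl.mul (hf.pow 2)).contDiffOn i)
    ((i1.add i2).const_mul 2) measurableSet_cube fun x hx => ?_
  have hp : pd i (fun x : Fin (d + 1) → ℝ => (R + x i) / (2 * R)) x = 1 / (2 * R) := by
    have hd : HasDerivAt (fun t => (R + t) / (2 * R)) (1 / (2 * R)) (x i) :=
      ((hasDerivAt_id (x i)).const_add R).div_const (2 * R)
    have := pd_comp_apply (k := i) hd
    simpa using this
  have hfx : DifferentiableAt ℝ f x := hf.differentiable one_ne_zero x
  rw [pd_mul (hl.differentiable one_ne_zero x) (hfx.fun_pow 2), pd_pow_two hfx, hp]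
  have b1 : 1 / (2 * R) ≤ 1 := by rw [div_le_one (by linarith)]; linarith
  have b2 : 0 ≤ (R + x i) / (2 * R) := div_nonneg (by linarith [(hx i).1]) (by linarith)
  have b3 : (R + x i) / (2 * R) ≤ 1 := by rw [div_le_one (by linarith)]; linarith [(hx i).2]
  set c := (R + x i) / (2 * R)
  have b4 : c * (2 * f x * pd i f x) ≤ f x ^ 2 + pd i f x ^ 2 := by
    have : 2 * f x * pd i f x ≤ f x ^ 2 + pd i f x ^ 2 := two_mul_le_add_sq _ _
    calc c * (2 * f x * pd i f x) ≤ c * (f x ^ 2 + pd i f x ^ 2) := by gcongr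
      _ ≤ _ := mul_le_of_le_one_left (by positivity) b3
  have b5 : 1 / (2 * R) * f x ^ 2 ≤ f x ^ 2 := mul_le_of_le_one_left (sq_nonneg _) b1
  linarith [sq_nonneg (pd i f x)]

/-- If functions converge in `H¹` to a function with zero trace on the upper face, then their
restrictions to that face tend to zero. -/
lemma tendsto_trace_zero (hR : 1 ≤ R) {i : Fin (d + 1)} {f : ℕ → (Fin (d + 1) → ℝ) → ℝ}
    {w : (Fin (d + 1) → ℝ) → ℝ} {dw : Fin (d + 1) → (Fin (d + 1) → ℝ) → ℝ}
    (hc : ∀ m, ContDiff ℝ 1 (f m)) (hf : L2Tendsto (volume.restrict (cube (d + 1) R)) f w)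
    (hf' : L2Tendsto (volume.restrict (cube (d + 1) R)) (fun m => pd i (f m)) (dw i))
    (h : HasRealZeroTrace R w dw i R) :
    Tendsto (fun m => ∫ y in cube d R, f m (i.insertNth (α := fun _ => ℝ) R y) ^ 2)
      atTop (𝓝 0) := by
  obtain ⟨φ, h1, h2, h3, h4⟩ := h
  have t1 := (hf.sub h2).integral_sq
  have t2 := (hf'.sub (h3 i)).integral_sq
  have t3 := h4.integral_sq
  simp only [sub_self, ne_eq, OfNat.ofNat_ne_zero, not_false_eq_true, zero_pow,
    integral_zero] at t1 t2 t3
  -- From f² ≤ 2(f − φ)² + 2φ² on the face, with the first term estimated by the trace inequality,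
  -- whose constant 2 turns the factor 2 into 4.
  have t4 := ((t1.add t2).const_mul 4).add (t3.const_mul 2)
  simp only [add_zero, mul_zero] at t4
  refine squeeze_zero (fun m => integral_nonneg fun y => sq_nonneg _) (fun m => ?_) t4
  have hsub : ContDiff ℝ 1 fun x => f m x - φ m x := (hc m).sub (h1 m)
  have k1 := trace_inequality hR i hsub
  have k2 : ∀ x, pd i (fun x => f m x - φ m x) x = pd i (f m) x - pd i (φ m) x := fun x =>
    pd_sub ((hc m).differentiable one_ne_zero x) ((h1 m).differentiable one_ne_zero x)
  simp only [k2] at k1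
  have cn := continuous_insertNth i R
  have j1 : IntegrableOn (fun y => (f m (i.insertNth (α := fun _ => ℝ) R y)
      - φ m (i.insertNth (α := fun _ => ℝ) R y)) ^ 2) (cube d R) :=
    integrableOn_of_continuousOn ((hsub.continuous.comp cn).pow 2).continuousOn
  have j2 : IntegrableOn (fun y => φ m (i.insertNth (α := fun _ => ℝ) R y) ^ 2) (cube d R) :=
    integrableOn_of_continuousOn (((h1 m).continuous.comp cn).pow 2).continuousOn
  have j3 : IntegrableOn (fun y => f m (i.insertNth (α := fun _ => ℝ) R y) ^ 2) (cube d R) :=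
    integrableOn_of_continuousOn (((hc m).continuous.comp cn).pow 2).continuousOn
  have k3 : ∫ y in cube d R, f m (i.insertNth (α := fun _ => ℝ) R y) ^ 2 ≤
      ∫ y in cube d R, (2 * (f m (i.insertNth (α := fun _ => ℝ) R y)
      - φ m (i.insertNth (α := fun _ => ℝ) R y)) ^ 2
      + 2 * φ m (i.insertNth (α := fun _ => ℝ) R y) ^ 2) := by
    refine setIntegral_mono_on j3 ((j1.const_mul 2).add (j2.const_mul 2)) measurableSet_cube
      fun y _ => ?_
    nlinarith [sq_nonneg (f m (i.insertNth (α := fun _ => ℝ) R y)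
      - 2 * φ m (i.insertNth (α := fun _ => ℝ) R y))]
  rw [integral_add (j1.const_mul 2) (j2.const_mul 2), integral_const_mul,
    integral_const_mul] at k3
  linarith

end Traces

/-! ### Sine polynomials. -/

section Sines

variable {n : ℕ} {R : ℝ}

/-- The one-dimensional Dirichlet sine modes of the interval `(-R, R)`. -/
def sinMode (R : ℝ) (k : ℕ) (t : ℝ) : ℝ := Real.sin (k * (Real.pi / (2 * R)) * (t + R))

/-- The Dirichlet sine modes of the cube. -/
def sineFun (R : ℝ) (k : Fin n → ℕ) : (Fin n → ℝ) → ℝ := prodFun fun j => sinMode R (k j)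

/-- The space of sine polynomials. -/
def sineSpan (n : ℕ) (R : ℝ) : Submodule ℝ ((Fin n → ℝ) → ℝ) :=
  Submodule.span ℝ (Set.range fun k : Fin n → ℕ => sineFun R k)

/-- The Laplace operator. -/
def lap (w : (Fin n → ℝ) → ℝ) (x : Fin n → ℝ) : ℝ := ∑ i, pd i (pd i w) x

lemma contDiff_sinMode {m : WithTop ℕ∞} (k : ℕ) : ContDiff ℝ m (sinMode R k) := by
  unfold sinMode; fun_prop

lemma sinMode_zero (t : ℝ) : sinMode R 0 t = 0 := by simp [sinMode]

lemma sinMode_face (hR : 0 < R) (k : ℕ) {t : ℝ} (ht : t = R ∨ t = -R) : sinMode R k t = 0 := by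
  unfold sinMode
  rcases ht with rfl | rfl
  · rw [show (k : ℝ) * (Real.pi / (2 * t)) * (t + t) = k * Real.pi by field_simp; ring]
    exact Real.sin_nat_mul_pi k
  · simp

lemma abs_sinMode_le_one (k : ℕ) (t : ℝ) : |sinMode R k t| ≤ 1 := Real.abs_sin_le_one _

lemma deriv_sinMode (k : ℕ) : deriv (sinMode R k) = fun t =>
    (k * (Real.pi / (2 * R))) * Real.cos (k * (Real.pi / (2 * R)) * (t + R)) := by
  ext t
  have h : HasDerivAt (fun t => (k : ℝ) * (Real.pi / (2 * R)) * (t + R))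
      (k * (Real.pi / (2 * R))) t := by
    simpa using ((hasDerivAt_id t).add_const R).const_mul ((k : ℝ) * (Real.pi / (2 * R)))
  have := h.sin.deriv
  unfold sinMode
  rw [this]; ring

lemma deriv_deriv_sinMode (k : ℕ) : deriv (deriv (sinMode R k)) = fun t =>
    -(k * (Real.pi / (2 * R))) ^ 2 * sinMode R k t := by
  rw [deriv_sinMode]
  ext t
  have h : HasDerivAt (fun t => (k : ℝ) * (Real.pi / (2 * R)) * (t + R))
      (k * (Real.pi / (2 * R))) t := by
    simpa using ((hasDerivAt_id t).add_const R).const_mul ((k : ℝ) * (Real.pi / (2 * R)))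
  have := (h.cos.const_mul ((k : ℝ) * (Real.pi / (2 * R)))).deriv
  rw [this, sinMode]; ring

lemma contDiff_sineFun (k : Fin n → ℕ) : ContDiff ℝ ∞ (sineFun R k) :=
  contDiff_prodFun fun _ => contDiff_sinMode _

lemma vanishesOnFaces_sineFun (hR : 0 < R) (k : Fin n → ℕ) : VanishesOnFaces R (sineFun R k) :=
  fun _ i hx => Finset.prod_eq_zero (Finset.mem_univ i) (sinMode_face hR _ hx)

lemma abs_sineFun_le_one (k : Fin n → ℕ) (x : Fin n → ℝ) : |sineFun R k x| ≤ 1 := by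
  unfold sineFun prodFun
  rw [Finset.abs_prod]
  exact Finset.prod_le_one (fun _ _ => abs_nonneg _) fun _ _ => abs_sinMode_le_one _ _

lemma sineFun_eq_zero {k : Fin n → ℕ} {i : Fin n} (hk : k i = 0) : sineFun R k = 0 := by
  ext x
  exact Finset.prod_eq_zero (Finset.mem_univ i) (by simp only [hk, sinMode_zero])

lemma pd_pd_sineFun (k : Fin n → ℕ) (i : Fin n) (x : Fin n → ℝ) :
    pd i (pd i (sineFun R k)) x = -(k i * (Real.pi / (2 * R))) ^ 2 * sineFun R k x := by
  have hd : ∀ j, Differentiable ℝ (sinMode R (k j)) := fun j =>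
    (contDiff_sinMode (m := 1) (k j)).differentiable one_ne_zero
  have h1 : pd i (sineFun R k) =
      prodFun (Function.update (fun j => sinMode R (k j)) i (deriv (sinMode R (k i)))) := by
    ext y; exact pd_prodFun hd i y
  rw [h1, pd_prodFun]
  · rw [Function.update_idem, Function.update_self, prodFun_update, deriv_deriv_sinMode]
    unfold sineFun prodFun
    rw [← Finset.mul_prod_erase _ _ (Finset.mem_univ i)]
    ring
  · intro j
    rcases eq_or_ne j i with rfl | h
    · rw [Function.update_self, deriv_sinMode]; fun_prop
    · rw [Function.update_of_ne h]; exact hd j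

/-- This is 2 cos θ sin kθ = sin (k+1)θ + sin (k−1)θ. The hypothesis avoids truncated subtraction;
for k = 1 the second mode is the zero function, which is why the index 0 is admitted. -/
lemma cos_mul_sineFun (k : Fin n → ℕ) (i : Fin n) (hk : k i ≠ 0) (x : Fin n → ℝ) :
    Real.cos (Real.pi / (2 * R) * (x i + R)) * sineFun R k x =
      (1 / 2) * sineFun R (Function.update k i (k i + 1)) x
      + (1 / 2) * sineFun R (Function.update k i (k i - 1)) x := by
  have h : ∀ m, sineFun R (Function.update k i m) x =
      sinMode R m (x i) * ∏ j ∈ Finset.univ.erase i, sinMode R (k j) (x j) := by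
    intro m
    rw [← prodFun_update (fun j => sinMode R (k j)) i (sinMode R m) x]
    unfold sineFun
    congr 1
    ext j t
    rcases eq_or_ne j i with rfl | hj
    · simp
    · simp [Function.update_of_ne hj]
  have h0 := h (k i)
  rw [Function.update_eq_self] at h0
  rw [h, h, h0]
  obtain ⟨m, hm⟩ := Nat.exists_eq_succ_of_ne_zero hk
  rw [hm]
  have key : Real.cos (Real.pi / (2 * R) * (x i + R)) * sinMode R (m + 1) (x i) =
      (1 / 2) * sinMode R (m + 1 + 1) (x i) + (1 / 2) * sinMode R (m + 1 - 1) (x i) := by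
    unfold sinMode
    rw [show m + 1 - 1 = m by omega]
    set θ := Real.pi / (2 * R) * (x i + R) with hθ
    have e1 : ((m + 1 + 1 : ℕ) : ℝ) * (Real.pi / (2 * R)) * (x i + R) = (m + 1) * θ + θ := by
      rw [hθ]; push_cast; ring
    have e2 : (m : ℝ) * (Real.pi / (2 * R)) * (x i + R) = (m + 1) * θ - θ := by
      rw [hθ]; ring
    have e3 : ((m + 1 : ℕ) : ℝ) * (Real.pi / (2 * R)) * (x i + R) = (m + 1) * θ := by
      rw [hθ]; push_cast; ring
    rw [e1, e2, e3, Real.sin_add, Real.sin_sub]; ring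
  simp only [Nat.succ_eq_add_one]
  rw [← mul_assoc, key]; ring

lemma sineFun_mem (k : Fin n → ℕ) : sineFun R k ∈ sineSpan n R :=
  Submodule.subset_span ⟨k, rfl⟩

lemma contDiff_of_mem_sineSpan {w : (Fin n → ℝ) → ℝ} (hw : w ∈ sineSpan n R) :
    ContDiff ℝ ∞ w := by
  induction hw using Submodule.span_induction with
  | mem x h => obtain ⟨k, rfl⟩ := h; exact contDiff_sineFun k
  | zero => exact contDiff_const
  | add x y _ _ hx hy => exact hx.add hy
  | smul a x _ hx => exact contDiff_const.smul hx

lemma vanishesOnFaces_of_mem_sineSpan (hR : 0 < R) {w : (Fin n → ℝ) → ℝ}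
    (hw : w ∈ sineSpan n R) : VanishesOnFaces R w := by
  induction hw using Submodule.span_induction with
  | mem x h => obtain ⟨k, rfl⟩ := h; exact vanishesOnFaces_sineFun hR k
  | zero => exact fun _ _ _ => rfl
  | add x y _ _ hx hy => intro z i h; simp [hx z i h, hy z i h]
  | smul a x _ hx => intro z i h; simp [hx z i h]

lemma pd_pd_add {u v : (Fin n → ℝ) → ℝ} (hu : ContDiff ℝ ∞ u) (hv : ContDiff ℝ ∞ v) (i j : Fin n) :
    pd i (pd j (u + v)) = pd i (pd j u) + pd i (pd j v) := by
  have h1 : pd j (u + v) = fun x => pd j u x + pd j v x := by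
    ext x; exact pd_add (hu.differentiable (by simp) x) (hv.differentiable (by simp) x)
  ext x
  rw [h1]
  exact pd_add ((contDiff_infty_pd hu).differentiable (by simp) x)
    ((contDiff_infty_pd hv).differentiable (by simp) x)

lemma pd_pd_smul {u : (Fin n → ℝ) → ℝ} (c : ℝ) (hu : ContDiff ℝ ∞ u) (i j : Fin n) :
    pd i (pd j (c • u)) = c • pd i (pd j u) := by
  have h1 : pd j (c • u) = fun x => c * pd j u x := by
    ext x; exact pd_const_mul c (hu.differentiable (by simp) x)
  ext x
  rw [h1]
  exact pd_const_mul c ((contDiff_infty_pd hu).differentiable (by simp) x)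

lemma pd_zero (j : Fin n) : pd j (0 : (Fin n → ℝ) → ℝ) = 0 := by ext x; simp [pd]

lemma lap_zero : lap (0 : (Fin n → ℝ) → ℝ) = 0 := by ext x; simp [lap, pd_zero]

lemma lap_add {u v : (Fin n → ℝ) → ℝ} (hu : ContDiff ℝ ∞ u) (hv : ContDiff ℝ ∞ v) :
    lap (u + v) = lap u + lap v := by
  ext x; unfold lap
  simp only [pd_pd_add hu hv, Pi.add_apply, Finset.sum_add_distrib]

lemma lap_smul {u : (Fin n → ℝ) → ℝ} (c : ℝ) (hu : ContDiff ℝ ∞ u) :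
    lap (c • u) = c • lap u := by
  ext x; unfold lap
  simp only [pd_pd_smul c hu, Pi.smul_apply, smul_eq_mul, Finset.mul_sum]

lemma lap_sub {u v : (Fin n → ℝ) → ℝ} (hu : ContDiff ℝ ∞ u) (hv : ContDiff ℝ ∞ v) :
    lap (u - v) = lap u - lap v := by
  have : u - v = u + (-1 : ℝ) • v := by ext; simp [sub_eq_add_neg]
  have hv' : ContDiff ℝ ∞ ((-1 : ℝ) • v) := hv.const_smul (-1 : ℝ)
  rw [this, lap_add hu hv', lap_smul _ hv]
  ext; simp [sub_eq_add_neg]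

/-- Every mode is an eigenfunction of each ∂_i². Consequently pure second derivatives again vanish
on all faces. -/
lemma pd_pd_mem_sineSpan {w : (Fin n → ℝ) → ℝ} (hw : w ∈ sineSpan n R) (i : Fin n) :
    pd i (pd i w) ∈ sineSpan n R := by
  induction hw using Submodule.span_induction with
  | mem x h =>
    obtain ⟨k, rfl⟩ := h
    have : pd i (pd i (sineFun R k)) = (-(k i * (Real.pi / (2 * R))) ^ 2) • sineFun R k := by
      ext x; exact pd_pd_sineFun k i x
    simp only [this]
    exact Submodule.smul_mem _ _ (sineFun_mem k)
  | zero =>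
    rw [pd_zero, pd_zero]; exact Submodule.zero_mem _
  | add x y hx hy h1 h2 =>
    rw [pd_pd_add (contDiff_of_mem_sineSpan hx) (contDiff_of_mem_sineSpan hy)]
    exact Submodule.add_mem _ h1 h2
  | smul a x hx h1 =>
    rw [pd_pd_smul _ (contDiff_of_mem_sineSpan hx)]
    exact Submodule.smul_mem _ _ h1

/-- The eigenvalues of the Dirichlet Laplacian of the cube. -/
def sineEigenvalue (R : ℝ) (k : Fin n → ℕ) : ℝ := ∑ i, (k i * (Real.pi / (2 * R))) ^ 2

lemma lap_sineFun (k : Fin n → ℕ) : lap (sineFun R k) = -(sineEigenvalue R k) • sineFun R k := by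
  ext x; unfold lap sineEigenvalue
  simp only [pd_pd_sineFun, Pi.smul_apply, smul_eq_mul]
  rw [← Finset.sum_mul, ← Finset.sum_neg_distrib]

lemma sineEigenvalue_pos {d : ℕ} (hR : 0 < R) {k : Fin (d + 1) → ℕ} (hk : ∀ i, k i ≠ 0) :
    0 < sineEigenvalue R k := by
  refine Finset.sum_pos (fun i _ => ?_) Finset.univ_nonempty
  have : (0 : ℝ) < k i := by exact_mod_cast Nat.pos_of_ne_zero (hk i)
  have := Real.pi_pos
  positivity

/-- The Laplace equation is solvable in sine polynomials. -/
lemma exists_lap_eq {d : ℕ} (hR : 0 < R) {s : (Fin (d + 1) → ℝ) → ℝ}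
    (hs : s ∈ sineSpan (d + 1) R) : ∃ w ∈ sineSpan (d + 1) R, lap w = s := by
  induction hs using Submodule.span_induction with
  | mem x h =>
    obtain ⟨k, rfl⟩ := h
    by_cases hk : ∀ i, k i ≠ 0
    · refine ⟨(-(sineEigenvalue R k)⁻¹) • sineFun R k, Submodule.smul_mem _ _ (sineFun_mem k), ?_⟩
      rw [lap_smul _ (contDiff_sineFun k), lap_sineFun, smul_smul, neg_mul_neg,
        inv_mul_cancel₀ (sineEigenvalue_pos hR hk).ne', one_smul]
    -- A mode with a zero index is the zero function, so it is its own preimage.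
    · push Not at hk
      obtain ⟨i, hi⟩ := hk
      refine ⟨sineFun R k, sineFun_mem k, ?_⟩
      simp only [sineFun_eq_zero hi, lap_zero]
  | zero =>
    refine ⟨0, Submodule.zero_mem _, ?_⟩
    exact lap_zero
  | add x y hx hy h1 h2 =>
    obtain ⟨u, hu, rfl⟩ := h1
    obtain ⟨v, hv, rfl⟩ := h2
    exact ⟨u + v, Submodule.add_mem _ hu hv,
      lap_add (contDiff_of_mem_sineSpan hu) (contDiff_of_mem_sineSpan hv)⟩
  | smul a x hx h1 =>
    obtain ⟨u, hu, rfl⟩ := h1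
    exact ⟨a • u, Submodule.smul_mem _ _ hu, lap_smul _ (contDiff_of_mem_sineSpan hu)⟩

end Sines

/-! ### Completeness of the sines. -/

section Completeness

variable {n : ℕ} {R : ℝ}

instance : CompactSpace (closedCube n R) := isCompact_iff_compactSpace.1 isCompact_closedCube

/-- The coordinate cosines as continuous functions on the closed cube. -/
def cosCoord (n : ℕ) (R : ℝ) (i : Fin n) : C(closedCube n R, ℝ) :=
  ⟨fun x => Real.cos (Real.pi / (2 * R) * ((x : Fin n → ℝ) i + R)),
    Real.continuous_cos.comp (continuous_const.mul
      (((continuous_apply i).comp continuous_subtype_val).add continuous_const))⟩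

/-- The algebra generated by the coordinate cosines. -/
def cosAlgebra (n : ℕ) (R : ℝ) : Subalgebra ℝ C(closedCube n R, ℝ) :=
  Algebra.adjoin ℝ (Set.range (cosCoord n R))

/-- On the cube the argument of each cosine lies in [0, π], where the cosine is injective. -/
lemma cosAlgebra_separatesPoints (hR : 0 < R) : (cosAlgebra n R).SeparatesPoints := by
  intro x y hxy
  have : ∃ i, (x : Fin n → ℝ) i ≠ (y : Fin n → ℝ) i := by
    by_contra h
    push Not at h
    exact hxy (Subtype.ext (funext h))
  obtain ⟨i, hi⟩ := this
  refine ⟨cosCoord n R i, ⟨cosCoord n R i, Algebra.subset_adjoin ⟨i, rfl⟩, rfl⟩, fun h => hi ?_⟩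
  have hm : ∀ z : closedCube n R, Real.pi / (2 * R) * ((z : Fin n → ℝ) i + R) ∈
      Set.Icc 0 Real.pi := by
    intro z
    have h1 := (z.2 i).1
    have h2 := (z.2 i).2
    have hp := Real.pi_pos
    refine ⟨mul_nonneg (by positivity) (by linarith), ?_⟩
    rw [div_mul_eq_mul_div, div_le_iff₀ (by positivity)]
    exact mul_le_mul_of_nonneg_left (by linarith) hp.le
  have := Real.injOn_cos (hm x) (hm y) h
  have hp : Real.pi / (2 * R) ≠ 0 := by have := Real.pi_pos; positivity
  have := mul_left_cancel₀ hp this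
  linarith

/-- On the closed cube the sine polynomials form a module over the cosine algebra. This makes
Stone–Weierstrass available although they all vanish on the boundary and contain no constants. -/
lemma cosAlgebra_mul_sineSpan {P : C(closedCube n R, ℝ)} (hP : P ∈ cosAlgebra n R) :
    ∀ s ∈ sineSpan n R, ∃ s' ∈ sineSpan n R, ∀ x : closedCube n R, P x * s x = s' x := by
  induction hP using Algebra.adjoin_induction with
  | mem P h =>
    obtain ⟨i, rfl⟩ := h
    intro s hs
    induction hs using Submodule.span_induction with
    | mem s h =>
      obtain ⟨k, rfl⟩ := h
      by_cases hk : k i = 0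
      · refine ⟨0, Submodule.zero_mem _, fun x => ?_⟩
        simp [sineFun_eq_zero hk]
      · exact ⟨(1 / 2 : ℝ) • sineFun R (Function.update k i (k i + 1))
          + (1 / 2 : ℝ) • sineFun R (Function.update k i (k i - 1)),
          Submodule.add_mem _ (Submodule.smul_mem _ _ (sineFun_mem _))
            (Submodule.smul_mem _ _ (sineFun_mem _)), fun x => cos_mul_sineFun k i hk x⟩
    | zero => exact ⟨0, Submodule.zero_mem _, fun x => by simp⟩
    | add u v _ _ h1 h2 =>
      obtain ⟨u', hu', hu⟩ := h1
      obtain ⟨v', hv', hv⟩ := h2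
      exact ⟨u' + v', Submodule.add_mem _ hu' hv', fun x => by
        rw [Pi.add_apply, mul_add, hu, hv]; rfl⟩
    | smul c u _ h1 =>
      obtain ⟨u', hu', hu⟩ := h1
      exact ⟨c • u', Submodule.smul_mem _ _ hu', fun x => by
        rw [Pi.smul_apply, Pi.smul_apply, ← hu]; simp; ring⟩
  | algebraMap r => exact fun s hs => ⟨r • s, Submodule.smul_mem _ _ hs, fun x => rfl⟩
  | add P Q _ _ h1 h2 =>
    intro s hs
    obtain ⟨u', hu', hu⟩ := h1 s hs
    obtain ⟨v', hv', hv⟩ := h2 s hs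
    exact ⟨u' + v', Submodule.add_mem _ hu' hv', fun x => by
      rw [ContinuousMap.add_apply, add_mul, hu, hv]; rfl⟩
  | mul P Q _ _ h1 h2 =>
    intro s hs
    obtain ⟨v', hv', hv⟩ := h2 s hs
    obtain ⟨u', hu', hu⟩ := h1 v' hv'
    exact ⟨u', hu', fun x => by rw [ContinuousMap.mul_apply, mul_assoc, hv, hu]⟩

/-- The sine functions are complete. -/
theorem ae_eq_zero_of_integral_sineFun (hR : 0 < R) {g : (Fin n → ℝ) → ℝ}
    (hg : MemLp g 2 (volume.restrict (cube n R)))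
    (h : ∀ k : Fin n → ℕ, ∫ x in cube n R, g x * sineFun R k x = 0) :
    g =ᵐ[volume.restrict (cube n R)] 0 := by
  have hgi : Integrable g (volume.restrict (cube n R)) := hg.integrable (by norm_num)
  have hint : ∀ s ∈ sineSpan n R, Integrable (fun x => g x * s x) (volume.restrict (cube n R)) :=
    fun s hs => hg.integrable_mul
      (memLp_of_continuousOn (contDiff_of_mem_sineSpan hs).continuous.continuousOn 2)
  have hspan : ∀ s ∈ sineSpan n R, ∫ x in cube n R, g x * s x = 0 := by
    intro s hs
    induction hs using Submodule.span_induction with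
    | mem s hs => obtain ⟨k, rfl⟩ := hs; exact h k
    | zero => simp
    | add u v hu hv h1 h2 =>
      simp only [Pi.add_apply, mul_add]
      rw [integral_add (hint u hu) (hint v hv), h1, h2, add_zero]
    | smul c u hu h1 =>
      simp only [Pi.smul_apply, smul_eq_mul, mul_left_comm _ c]
      rw [integral_const_mul, h1, mul_zero]
  -- The ground mode is positive in the cube, so it suffices to show that g e vanishes almost
  -- everywhere.
  set e : (Fin n → ℝ) → ℝ := sineFun R fun _ => 1 with he
  have hem : e ∈ sineSpan n R := sineFun_mem _
  have hpos : ∀ x ∈ cube n R, 0 < e x := by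
    intro x hx
    have hj : ∀ j, 0 < sinMode R 1 (x j) := fun j => by
      refine Real.sin_pos_of_pos_of_lt_pi ?_ ?_
      · have := (hx j).1
        have := Real.pi_pos
        have : 0 < x j + R := by linarith
        positivity
      · have := (hx j).2
        have hp := Real.pi_pos
        rw [Nat.cast_one, one_mul, div_mul_eq_mul_div, div_lt_iff₀ (by positivity)]
        exact mul_lt_mul_of_pos_left (by linarith) hp
    have hprod : e x = ∏ j, sinMode R 1 (x j) := rfl
    rw [hprod]
    exact Finset.prod_pos fun j _ => hj j
  have key := isOpen_cube.ae_eq_zero_of_integral_contDiff_smul_eq_zero (U := cube n R)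
    (f := fun x => g x * e x) (μ := volume.restrict (cube n R))
    ((hint e hem).locallyIntegrable.locallyIntegrableOn _) ?_
  · filter_upwards [key, ae_restrict_mem measurableSet_cube] with x hx hx'
    exact (mul_eq_zero.1 (hx hx')).resolve_right (hpos x hx').ne'
  · intro ψ h1 _ _
    set I := ∫ x in cube n R, |g x| with hI
    have hI0 : 0 ≤ I := integral_nonneg fun x => abs_nonneg _
    have hle : ∀ ε > 0, |∫ x in cube n R, ψ x • (g x * e x)| ≤ ε * I := by
      intro ε hε
      -- P is a cosine polynomial within ε of ψ. Since P e is a sine polynomial, g is orthogonal to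
      -- it, and ∫ ψ g e = ∫ (ψ − P) e g is at most ε ∫ |g|.
      obtain ⟨P, hP⟩ := ContinuousMap.exists_mem_subalgebra_near_continuous_of_separatesPoints
        (cosAlgebra n R) (cosAlgebra_separatesPoints hR) (fun x => ψ x)
        (h1.continuous.comp continuous_subtype_val) ε hε
      obtain ⟨s', hs', hs⟩ := cosAlgebra_mul_sineSpan P.2 e hem
      have e1 : ∫ x in cube n R, ψ x • (g x * e x)
          = ∫ x in cube n R, (ψ x * e x - s' x) * g x := by
        have i1 : Integrable (fun x => ψ x * (g x * e x)) (volume.restrict (cube n R)) := by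
          have := integrable_cont_mul (R := R)
            (h1.continuous.mul (contDiff_of_mem_sineSpan hem).continuous).continuousOn hg
          exact this.congr (ae_of_all _ fun x => by simp only [Pi.mul_apply]; ring)
        have : ∫ x in cube n R, (ψ x * e x - s' x) * g x
            = ∫ x in cube n R, (ψ x * (g x * e x) - g x * s' x) := by
          congr 1; ext x; ring
        rw [this, integral_sub i1 (hint s' hs'), hspan s' hs', sub_zero]
        rfl
      rw [e1, hI, ← integral_const_mul, ← Real.norm_eq_abs]
      refine norm_integral_le_of_norm_le (hgi.abs.const_mul ε)
        (ae_restrict_cube_of_forall fun x hx => ?_)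
      rw [norm_mul, Real.norm_eq_abs, Real.norm_eq_abs]
      refine mul_le_mul_of_nonneg_right ?_ (abs_nonneg _)
      have hxc := cube_subset_closedCube hx
      have h2 := hP ⟨x, hxc⟩
      have h3 := hs ⟨x, hxc⟩
      have h4 : ψ x * e x - s' x = -((P : C(closedCube n R, ℝ)) ⟨x, hxc⟩ - ψ x) * e x := by
        rw [← h3]; ring
      rw [h4, abs_mul, abs_neg]
      calc _ ≤ ε * 1 := mul_le_mul h2.le (abs_sineFun_le_one _ _) (abs_nonneg _) hε.le
        _ = ε := mul_one ε
    rw [← abs_eq_zero]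
    refine le_antisymm (le_of_forall_pos_le_add fun δ hδ => ?_) (abs_nonneg _)
    have hI1 : 0 < I + 1 := by linarith
    refine (hle (δ / (I + 1)) (by positivity)).trans ?_
    rw [zero_add, div_mul_eq_mul_div, div_le_iff₀ hI1]
    nlinarith

/-- Sine polynomials are dense in `L²`. -/
theorem exists_sine_approximation (hR : 0 < R) {g : (Fin n → ℝ) → ℝ}
    (hg : MemLp g 2 (volume.restrict (cube n R))) :
    ∃ s : ℕ → (Fin n → ℝ) → ℝ, (∀ m, s m ∈ sineSpan n R) ∧
      L2Tendsto (volume.restrict (cube n R)) s g := by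
  have hm : ∀ s ∈ sineSpan n R, MemLp s 2 (volume.restrict (cube n R)) := fun s hs =>
    memLp_of_continuousOn (contDiff_of_mem_sineSpan hs).continuous.continuousOn 2
  set K : Submodule ℝ (Lp ℝ 2 (volume.restrict (cube n R))) :=
    Submodule.span ℝ (Set.range fun k : Fin n → ℕ => (hm _ (sineFun_mem k)).toLp (sineFun R k))
    with hK
  have hKmem : ∀ v ∈ K, ∃ s, ∃ hs : s ∈ sineSpan n R, (hm s hs).toLp s = v := by
    intro v hv
    induction hv using Submodule.span_induction with
    | mem v h => obtain ⟨k, rfl⟩ := h; exact ⟨_, sineFun_mem k, rfl⟩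
    | zero => exact ⟨0, Submodule.zero_mem _, rfl⟩
    | add u v _ _ h1 h2 =>
      obtain ⟨a, ha, rfl⟩ := h1
      obtain ⟨b, hb, rfl⟩ := h2
      exact ⟨a + b, Submodule.add_mem _ ha hb, rfl⟩
    | smul c u _ h1 =>
      obtain ⟨a, ha, rfl⟩ := h1
      exact ⟨c • a, Submodule.smul_mem _ _ ha, rfl⟩
  -- A vector orthogonal to all modes is zero by completeness, so the span is dense.
  have htop : K.topologicalClosure = ⊤ := by
    rw [Submodule.topologicalClosure_eq_top_iff, Submodule.eq_bot_iff]
    intro v hv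
    have h0 : (v : (Fin n → ℝ) → ℝ) =ᵐ[volume.restrict (cube n R)] 0 := by
      refine ae_eq_zero_of_integral_sineFun hR (Lp.memLp v) fun k => ?_
      have := (Submodule.mem_orthogonal' K v).1 hv _ (Submodule.subset_span ⟨k, rfl⟩)
      rw [L2.inner_def] at this
      rw [← this]
      refine integral_congr_ae ?_
      filter_upwards [(hm _ (sineFun_mem (R := R) k)).coeFn_toLp] with x hx
      rw [hx]; simp [mul_comm]
    exact (Lp.eq_zero_iff_ae_eq_zero).2 h0
  have hmem : hg.toLp g ∈ closure (K : Set (Lp ℝ 2 (volume.restrict (cube n R)))) := by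
    rw [← Submodule.topologicalClosure_coe, htop]; trivial
  obtain ⟨v, hv, hvt⟩ := mem_closure_iff_seq_limit.1 hmem
  choose s hs hsv using fun m => hKmem (v m) (hv m)
  refine ⟨s, hs, fun m => hm _ (hs m), hg, ?_⟩
  refine (Lp.tendsto_Lp_iff_tendsto_eLpNorm'' _ (fun m => hm _ (hs m)) _ hg).1 ?_
  simpa only [hsv] using hvt

end Completeness

/-! ### H² estimates by the Laplacian. -/

section SineEstimates

variable {d : ℕ} {R : ℝ} {w : (Fin (d + 1) → ℝ) → ℝ}

lemma contDiff_one_of_infty {n : ℕ} {f : (Fin n → ℝ) → ℝ} (hf : ContDiff ℝ ∞ f) :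
    ContDiff ℝ 1 f := hf.of_le (by norm_cast)

lemma integrable_mul_of_continuous {n : ℕ} {f g : (Fin n → ℝ) → ℝ} (hf : Continuous f)
    (hg : Continuous g) : Integrable (fun x => f x * g x) (volume.restrict (cube n R)) :=
  integrableOn_of_continuousOn (hf.mul hg).continuousOn

lemma integrable_sq_of_continuous {n : ℕ} {f : (Fin n → ℝ) → ℝ} (hf : Continuous f) :
    Integrable (fun x => f x ^ 2) (volume.restrict (cube n R)) :=
  integrableOn_of_continuousOn (hf.pow 2).continuousOn

/-- Two integrations by parts without boundary terms: ∂_i w is tangential on the faces x_j = ±R and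
vanishes there, while ∂_j² w is a sine polynomial and vanishes on x_i = ±R. -/
lemma integral_mixed_sq (hR : 0 < R) (hw : w ∈ sineSpan (d + 1) R) (i j : Fin (d + 1)) :
    ∫ x in cube (d + 1) R, pd j (pd i w) x ^ 2 =
      ∫ x in cube (d + 1) R, pd i (pd i w) x * pd j (pd j w) x := by
  have hs := contDiff_of_mem_sineSpan hw
  rcases eq_or_ne i j with rfl | hij
  · simp only [pow_two]
  · have hv := vanishesOnFaces_of_mem_sineSpan hR hw
    have hvj := vanishesOnFaces_of_mem_sineSpan hR (pd_pd_mem_sineSpan hw j)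
    have hwi := contDiff_infty_pd (k := i) hs
    have hwji := contDiff_infty_pd (k := j) hwi
    have hwjj := contDiff_infty_pd (k := j) (contDiff_infty_pd (k := j) hs)
    have e1 := integral_pd_mul_of_vanish hR j (f := pd j (pd i w)) (ψ := pd i w)
      (contDiff_one_of_infty hwji) (contDiff_one_of_infty hwi) (fun x hx => by
        rw [hv.pd_eq_zero (hs.differentiable (by simp)) hij hx, zero_mul])
    have e2 := integral_pd_mul_of_vanish hR i (f := pd j (pd j w)) (ψ := pd i w)
      (contDiff_one_of_infty hwjj) (contDiff_one_of_infty hwi) (fun x hx => by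
        rw [hvj x i hx, mul_zero])
    have e3 : pd j (pd j (pd i w)) = pd i (pd j (pd j w)) := by
      have h1 : pd j (pd i w) = pd i (pd j w) := by
        ext y; exact pd_comm (hs.of_le (by norm_cast)) j i y
      ext y
      rw [h1]
      exact pd_comm ((contDiff_infty_pd hs).of_le (by norm_cast)) j i y
    simp only [pow_two]
    rw [e1, e2, e3]

/-- Summing the previous identity over all pairs gives ∫ (Δw)² as a sum of nonnegative terms, of
which this is one. -/
lemma integral_mixed_sq_le (hR : 0 < R) (hw : w ∈ sineSpan (d + 1) R) (i j : Fin (d + 1)) :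
    ∫ x in cube (d + 1) R, pd j (pd i w) x ^ 2 ≤ ∫ x in cube (d + 1) R, lap w x ^ 2 := by
  have hs := contDiff_of_mem_sineSpan hw
  have hc : ∀ a b, Continuous (pd a (pd b w)) := fun a b =>
    (contDiff_infty_pd (contDiff_infty_pd hs)).continuous
  have e : ∫ x in cube (d + 1) R, lap w x ^ 2 =
      ∑ a, ∑ b, ∫ x in cube (d + 1) R, pd b (pd a w) x ^ 2 := by
    simp only [integral_mixed_sq hR hw]
    have h1 : ∀ x, lap w x ^ 2 = ∑ a, ∑ b, pd a (pd a w) x * pd b (pd b w) x := fun x => by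
      rw [pow_two, lap, Finset.sum_mul_sum]
    simp only [h1]
    rw [integral_finsetSum _ fun a _ => integrable_finsetSum _ fun b _ =>
      integrable_mul_of_continuous (hc a a) (hc b b)]
    refine Finset.sum_congr rfl fun a _ => ?_
    rw [integral_finsetSum _ fun b _ => integrable_mul_of_continuous (hc a a) (hc b b)]
  rw [e]
  have hn : ∀ a b, 0 ≤ ∫ x in cube (d + 1) R, pd b (pd a w) x ^ 2 := fun a b =>
    integral_nonneg fun x => sq_nonneg _
  refine le_trans ?_ (Finset.single_le_sum (f := fun a =>
    ∑ b, ∫ x in cube (d + 1) R, pd b (pd a w) x ^ 2)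
    (fun a _ => Finset.sum_nonneg fun b _ => hn a b) (Finset.mem_univ i))
  exact Finset.single_le_sum (f := fun b => ∫ x in cube (d + 1) R, pd b (pd i w) x ^ 2)
    (fun b _ => hn i b) (Finset.mem_univ j)

/-- Integration by parts against x_i gives ∫ w² = −2 ∫ x_i w ∂_i w. With |x_i| ≤ R and Young's
inequality, half of the left side is absorbed. -/
lemma poincare (hR : 0 < R) (hw : w ∈ sineSpan (d + 1) R) (i : Fin (d + 1)) :
    ∫ x in cube (d + 1) R, w x ^ 2 ≤ 4 * R ^ 2 * ∫ x in cube (d + 1) R, pd i w x ^ 2 := by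
  have hs := contDiff_of_mem_sineSpan hw
  have hv := vanishesOnFaces_of_mem_sineSpan hR hw
  have hpc := (contDiff_infty_pd (k := i) hs).continuous
  have e1 := integral_pd_mul_of_vanish hR i (f := fun x => w x ^ 2)
    (ψ := fun x : Fin (d + 1) → ℝ => x i) (contDiff_one_of_infty (hs.pow 2)) (by fun_prop)
    (fun x hx => by rw [hv x i hx]; ring)
  have h1 : ∀ x : Fin (d + 1) → ℝ, pd i (fun x : Fin (d + 1) → ℝ => x i) x = 1 := fun x => by
    simpa using pd_comp_apply (k := i) (hasDerivAt_id (x i))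
  have h2 : ∀ x, pd i (fun x => w x ^ 2) x = 2 * w x * pd i w x := fun x =>
    pd_pow_two (hs.differentiable (by simp) x)
  simp only [h1, h2, one_mul] at e1
  have i1 := integrable_sq_of_continuous (R := R) hs.continuous
  have i2 := integrable_sq_of_continuous (R := R) hpc
  have hle : - ∫ x in cube (d + 1) R, x i * (2 * w x * pd i w x) ≤
      ∫ x in cube (d + 1) R, (1 / 2 * w x ^ 2 + 2 * R ^ 2 * pd i w x ^ 2) := by
    rw [← integral_neg]
    refine setIntegral_mono_on ?_ ((i1.const_mul _).add (i2.const_mul _)) measurableSet_cube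
      fun x hx => ?_
    · refine (integrable_mul_of_continuous (continuous_apply i)
        ((continuous_const.mul hs.continuous).mul hpc)).neg
    · have b : x i ^ 2 ≤ R ^ 2 := sq_le_sq' (hx i).1.le (hx i).2.le
      nlinarith [sq_nonneg (w x + 2 * (x i * pd i w x)),
        mul_le_mul_of_nonneg_right b (sq_nonneg (pd i w x))]
  rw [integral_add (i1.const_mul _) (i2.const_mul _), integral_const_mul,
    integral_const_mul] at hle
  linarith

/-- From ∫ |∇w|² = −∫ w Δw. The Young weight 1/(8R²) is matched to the Poincaré constant 4R², so
that half of ∫ |∂_i w|² is absorbed. -/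
lemma integral_grad_sq_le (hR : 0 < R) (hw : w ∈ sineSpan (d + 1) R) (i : Fin (d + 1)) :
    ∫ x in cube (d + 1) R, pd i w x ^ 2 ≤
      4 * R ^ 2 * ∫ x in cube (d + 1) R, lap w x ^ 2 := by
  have hs := contDiff_of_mem_sineSpan hw
  have hv := vanishesOnFaces_of_mem_sineSpan hR hw
  have hpc := fun k => contDiff_infty_pd (k := k) hs
  have hpc2 := fun k => contDiff_infty_pd (k := k) (hpc k)
  have e1 : ∀ k, ∫ x in cube (d + 1) R, pd k w x ^ 2 =
      - ∫ x in cube (d + 1) R, w x * pd k (pd k w) x := fun k => by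
    have := integral_pd_mul_of_vanish hR k (f := pd k w) (ψ := w)
      (contDiff_one_of_infty (hpc k)) (contDiff_one_of_infty hs)
      (fun x hx => by rw [hv x k hx, zero_mul])
    simpa only [pow_two] using this
  have hlc : Continuous (lap w) := continuous_finsetSum _ fun k _ => (hpc2 k).continuous
  have e2 : ∑ k, ∫ x in cube (d + 1) R, pd k w x ^ 2 =
      - ∫ x in cube (d + 1) R, w x * lap w x := by
    simp only [e1, lap, Finset.mul_sum]
    rw [integral_finsetSum _ fun k _ =>
      integrable_mul_of_continuous hs.continuous (hpc2 k).continuous, Finset.sum_neg_distrib]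
  have i1 := integrable_sq_of_continuous (R := R) hs.continuous
  have i2 := integrable_sq_of_continuous (R := R) hlc
  have hle : - ∫ x in cube (d + 1) R, w x * lap w x ≤
      ∫ x in cube (d + 1) R, (1 / (8 * R ^ 2) * w x ^ 2 + 2 * R ^ 2 * lap w x ^ 2) := by
    rw [← integral_neg]
    refine setIntegral_mono_on (integrable_mul_of_continuous hs.continuous hlc).neg
      ((i1.const_mul _).add (i2.const_mul _)) measurableSet_cube fun x hx => ?_
    have : 0 ≤ 1 / (8 * R ^ 2) * (w x + 4 * R ^ 2 * lap w x) ^ 2 := by positivity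
    have e3 : 1 / (8 * R ^ 2) * (w x + 4 * R ^ 2 * lap w x) ^ 2 =
        1 / (8 * R ^ 2) * w x ^ 2 + 2 * R ^ 2 * lap w x ^ 2 + w x * lap w x := by
      field_simp; ring
    linarith
  rw [integral_add (i1.const_mul _) (i2.const_mul _), integral_const_mul,
    integral_const_mul] at hle
  have hp := mul_le_mul_of_nonneg_left (poincare hR hw i)
    (show 0 ≤ 1 / (8 * R ^ 2) by positivity)
  have e4 : 1 / (8 * R ^ 2) * (4 * R ^ 2 * ∫ x in cube (d + 1) R, pd i w x ^ 2) =
      1 / 2 * ∫ x in cube (d + 1) R, pd i w x ^ 2 := by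
    field_simp; ring
  have hsingle : ∫ x in cube (d + 1) R, pd i w x ^ 2 ≤
      ∑ k, ∫ x in cube (d + 1) R, pd k w x ^ 2 :=
    Finset.single_le_sum (f := fun k => ∫ x in cube (d + 1) R, pd k w x ^ 2)
      (fun k _ => integral_nonneg fun x => sq_nonneg _) (Finset.mem_univ i)
  linarith

end SineEstimates

/-! ### Density of sine polynomials in H² with zero boundary values. -/

section Density

variable {d : ℕ} {R : ℝ}

/-- Real valued `H²` functions with zero traces on the boundary of the cube. -/
structure RealH20 (R : ℝ) (u : (Fin (d + 1) → ℝ) → ℝ) (g : Fin (d + 1) → (Fin (d + 1) → ℝ) → ℝ)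
    (h : Fin (d + 1) → Fin (d + 1) → (Fin (d + 1) → ℝ) → ℝ) : Prop where
  memLp_val : MemLp u 2 (volume.restrict (cube (d + 1) R))
  memLp_grad : ∀ i, MemLp (g i) 2 (volume.restrict (cube (d + 1) R))
  memLp_hess : ∀ i j, MemLp (h i j) 2 (volume.restrict (cube (d + 1) R))
  weak_grad : ∀ i, IsRealWeakDeriv R i u (g i)
  weak_hess : ∀ i j, IsRealWeakDeriv R j (g i) (h i j)
  trace : ∀ i, HasRealZeroTrace R u g i R ∧ HasRealZeroTrace R u g i (-R)

/-- The first integration by parts uses that w vanishes on the faces, the second that u has zero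
trace; nothing is needed about the boundary values of ∇u or ∂_i w. -/
lemma RealH20.integral_hess_mul {u : (Fin (d + 1) → ℝ) → ℝ}
    {g : Fin (d + 1) → (Fin (d + 1) → ℝ) → ℝ}
    {h : Fin (d + 1) → Fin (d + 1) → (Fin (d + 1) → ℝ) → ℝ} (H : RealH20 R u g h) (hR : 0 < R)
    {w : (Fin (d + 1) → ℝ) → ℝ} (hw : w ∈ sineSpan (d + 1) R) (i : Fin (d + 1)) :
    ∫ x in cube (d + 1) R, w x * h i i x = ∫ x in cube (d + 1) R, pd i (pd i w) x * u x := by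
  have hs := contDiff_of_mem_sineSpan hw
  have hv := vanishesOnFaces_of_mem_sineSpan hR hw
  have e1 := (H.weak_hess i i).integral_eq (H.memLp_grad i) (H.memLp_hess i i) hs
    (fun x hx => hv x i hx)
  have e2 := integral_pd_mul_of_trace hR (H.trace i).1 (H.trace i).2 H.memLp_val (H.memLp_grad i)
    (contDiff_one_of_infty (contDiff_infty_pd (k := i) hs))
  linarith

lemma RealH20.integral_lap_mul {u : (Fin (d + 1) → ℝ) → ℝ}
    {g : Fin (d + 1) → (Fin (d + 1) → ℝ) → ℝ}
    {h : Fin (d + 1) → Fin (d + 1) → (Fin (d + 1) → ℝ) → ℝ} (H : RealH20 R u g h) (hR : 0 < R)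
    {w : (Fin (d + 1) → ℝ) → ℝ} (hw : w ∈ sineSpan (d + 1) R) :
    ∫ x in cube (d + 1) R, w x * ∑ i, h i i x = ∫ x in cube (d + 1) R, lap w x * u x := by
  have hs := contDiff_of_mem_sineSpan hw
  simp only [lap, Finset.mul_sum, Finset.sum_mul]
  rw [integral_finsetSum _ fun i _ =>
      integrable_cont_mul hs.continuous.continuousOn (H.memLp_hess i i),
    integral_finsetSum _ fun i _ => integrable_cont_mul
      (contDiff_infty_pd (contDiff_infty_pd hs)).continuous.continuousOn H.memLp_val]
  exact Finset.sum_congr rfl fun i _ => H.integral_hess_mul hR hw i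

lemma integral_lap_mul_symm (hR : 0 < R) {v w : (Fin (d + 1) → ℝ) → ℝ}
    (hv : v ∈ sineSpan (d + 1) R) (hw : w ∈ sineSpan (d + 1) R) :
    ∫ x in cube (d + 1) R, w x * lap v x = ∫ x in cube (d + 1) R, lap w x * v x := by
  have hvs := contDiff_of_mem_sineSpan hv
  have hws := contDiff_of_mem_sineSpan hw
  have hv0 := vanishesOnFaces_of_mem_sineSpan hR hv
  have hw0 := vanishesOnFaces_of_mem_sineSpan hR hw
  have hc : ∀ {f : (Fin (d + 1) → ℝ) → ℝ}, ContDiff ℝ ∞ f → ∀ i, Continuous (pd i (pd i f)) :=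
    fun hf i => (contDiff_infty_pd (contDiff_infty_pd hf)).continuous
  simp only [lap, Finset.mul_sum, Finset.sum_mul]
  rw [integral_finsetSum _ fun i _ => integrable_mul_of_continuous hws.continuous (hc hvs i),
    integral_finsetSum _ fun i _ => integrable_mul_of_continuous (hc hws i) hvs.continuous]
  refine Finset.sum_congr rfl fun i _ => ?_
  have e1 := integral_pd_mul_of_vanish hR i (f := pd i v) (ψ := w)
    (contDiff_one_of_infty (contDiff_infty_pd hvs)) (contDiff_one_of_infty hws)
    (fun x hx => by rw [hw0 x i hx, zero_mul])
  have e2 := integral_pd_mul_of_vanish hR i (f := v) (ψ := pd i w)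
    (contDiff_one_of_infty hvs) (contDiff_one_of_infty (contDiff_infty_pd hws))
    (fun x hx => by rw [hv0 x i hx, mul_zero])
  linarith

/-- Sine polynomials are dense in `H² ∩ H¹₀` of the cube. -/
theorem RealH20.exists_approximation {u : (Fin (d + 1) → ℝ) → ℝ}
    {g : Fin (d + 1) → (Fin (d + 1) → ℝ) → ℝ}
    {h : Fin (d + 1) → Fin (d + 1) → (Fin (d + 1) → ℝ) → ℝ} (H : RealH20 R u g h) (hR : 0 < R) :
    ∃ w : ℕ → (Fin (d + 1) → ℝ) → ℝ, (∀ m, w m ∈ sineSpan (d + 1) R) ∧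
      L2Tendsto (volume.restrict (cube (d + 1) R)) w u ∧
      (∀ i, L2Tendsto (volume.restrict (cube (d + 1) R)) (fun m => pd i (w m)) (g i)) ∧
      ∀ i j, L2Tendsto (volume.restrict (cube (d + 1) R)) (fun m => pd j (pd i (w m))) (h i j) := by
  have hlap : MemLp (fun x => ∑ i, h i i x) 2 (volume.restrict (cube (d + 1) R)) :=
    memLp_finsetSum _ fun i _ => H.memLp_hess i i
  -- The Laplacian of u is approximated in L² and the Poisson equation is solved for each
  -- approximant; the a priori estimates `b0`, `b1`, `b2` then give convergence of w_m with all
  -- derivatives up to order two.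
  obtain ⟨s, hs, hst⟩ := exists_sine_approximation hR hlap
  choose w hw hws using fun m => exists_lap_eq hR (hs m)
  have hsm := fun m => contDiff_of_mem_sineSpan (hw m)
  have hmem : ∀ {f : (Fin (d + 1) → ℝ) → ℝ}, ContDiff ℝ ∞ f →
      MemLp f 2 (volume.restrict (cube (d + 1) R)) := fun hf =>
    memLp_of_continuousOn hf.continuous.continuousOn 2
  have hdiff : ∀ m l, w m - w l ∈ sineSpan (d + 1) R := fun m l =>
    Submodule.sub_mem _ (hw m) (hw l)
  have hlapd : ∀ m l x, lap (w m - w l) x = s m x - s l x := fun m l x => by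
    rw [lap_sub (hsm m) (hsm l), hws, hws]; rfl
  have hpd : ∀ m l i x, pd i (w m - w l) x = pd i (w m) x - pd i (w l) x := fun m l i x =>
    pd_sub ((hsm m).differentiable (by simp) x) ((hsm l).differentiable (by simp) x)
  have hpd2 : ∀ m l i j x, pd j (pd i (w m - w l)) x
      = pd j (pd i (w m)) x - pd j (pd i (w l)) x := fun m l i j x => by
    have e : pd i (w m - w l) = fun x => pd i (w m) x - pd i (w l) x := funext (hpd m l i)
    rw [e]
    exact pd_sub ((contDiff_infty_pd (hsm m)).differentiable (by simp) x)
      ((contDiff_infty_pd (hsm l)).differentiable (by simp) x)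
  have b1 : ∀ i m l, ∫ x in cube (d + 1) R, (pd i (w m) x - pd i (w l) x) ^ 2 ≤
      4 * R ^ 2 * ∫ x in cube (d + 1) R, (s m x - s l x) ^ 2 := fun i m l => by
    have := integral_grad_sq_le hR (hdiff m l) i
    simpa only [hpd, hlapd] using this
  have b2 : ∀ i j m l, ∫ x in cube (d + 1) R, (pd j (pd i (w m)) x - pd j (pd i (w l)) x) ^ 2 ≤
      1 * ∫ x in cube (d + 1) R, (s m x - s l x) ^ 2 := fun i j m l => by
    have := integral_mixed_sq_le hR (hdiff m l) i j
    simpa only [hpd2, hlapd, one_mul] using this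
  have b0 : ∀ m l, ∫ x in cube (d + 1) R, (w m x - w l x) ^ 2 ≤
      4 * R ^ 2 * (4 * R ^ 2) * ∫ x in cube (d + 1) R, (s m x - s l x) ^ 2 := fun m l => by
    have h1 := poincare hR (hdiff m l) 0
    simp only [hpd] at h1
    rw [mul_assoc (4 * R ^ 2)]
    exact h1.trans (mul_le_mul_of_nonneg_left (b1 0 m l) (by positivity))
  obtain ⟨u', hu'⟩ := exists_L2Tendsto_of_le hst (fun m => hmem (hsm m)) b0
  choose g' hg' using fun i => exists_L2Tendsto_of_le hst
    (fun m => hmem (contDiff_infty_pd (k := i) (hsm m))) (b1 i)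
  choose h' hh' using fun i j => exists_L2Tendsto_of_le hst
    (fun m => hmem (contDiff_infty_pd (k := j) (contDiff_infty_pd (k := i) (hsm m)))) (b2 i j)
  -- The limit is identified by sine coefficients: ∫ e_k s_m is −Λ_k times the coefficient of w_m,
  -- Λ_k being the eigenvalue, and tends to ∫ e_k Δu, which is −Λ_k times the coefficient of u.
  -- Division by Λ_k > 0 finishes.
  have huu : u' =ᵐ[volume.restrict (cube (d + 1) R)] u := by
    have h0 : (fun x => u' x - u x) =ᵐ[volume.restrict (cube (d + 1) R)] 0 := by
      refine ae_eq_zero_of_integral_sineFun hR (hu'.memLp_lim.sub H.memLp_val) fun k => ?_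
      by_cases hk : ∀ i, k i ≠ 0
      · have hem := sineFun_mem (R := R) k
        have hec := hmem (contDiff_of_mem_sineSpan hem)
        have t1 := (L2Tendsto.const hec).integral_mul hst
        have t2 := hu'.integral_mul (L2Tendsto.const hec)
        have e1 : ∀ m, ∫ x in cube (d + 1) R, sineFun R k x * s m x =
            -(sineEigenvalue R k) * ∫ x in cube (d + 1) R, w m x * sineFun R k x := fun m => by
          have := integral_lap_mul_symm hR (hw m) hem
          rw [hws m, lap_sineFun] at this
          rw [this, ← integral_const_mul]
          congr 1; ext x; simp only [Pi.smul_apply, smul_eq_mul]; ring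
        simp only [e1] at t1
        have e2 := tendsto_nhds_unique t1 (t2.const_mul _)
        have e3 := H.integral_lap_mul hR hem
        have e4 : ∫ x in cube (d + 1) R, lap (sineFun R k) x * u x =
            -(sineEigenvalue R k) * ∫ x in cube (d + 1) R, u x * sineFun R k x := by
          rw [lap_sineFun, ← integral_const_mul]
          congr 1; ext x; simp only [Pi.smul_apply, smul_eq_mul]; ring
        rw [e3, e4] at e2
        have e5 := mul_left_cancel₀ (neg_ne_zero.2 (sineEigenvalue_pos hR hk).ne') e2
        simp only [sub_mul]
        have i1 : Integrable (fun x => u' x * sineFun R k x) (volume.restrict (cube (d + 1) R)) :=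
          hu'.memLp_lim.integrable_mul hec
        have i2 : Integrable (fun x => u x * sineFun R k x) (volume.restrict (cube (d + 1) R)) :=
          H.memLp_val.integrable_mul hec
        rw [integral_sub i1 i2]
        exact sub_eq_zero.2 e5.symm
      · push Not at hk
        obtain ⟨i, hi⟩ := hk
        simp [sineFun_eq_zero hi]
    filter_upwards [h0] with x hx
    exact sub_eq_zero.1 hx
  have tu := hu'.congr_lim huu
  have tg : ∀ i, L2Tendsto (volume.restrict (cube (d + 1) R)) (fun m => pd i (w m)) (g i) :=
    fun i => tu.pd_of_isRealWeakDeriv hR (fun m => contDiff_one_of_infty (hsm m)) (hg' i)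
      (H.memLp_grad i) (H.weak_grad i)
  exact ⟨w, hw, tu, tg, fun i j => (tg i).pd_of_isRealWeakDeriv hR
    (fun m => contDiff_one_of_infty (contDiff_infty_pd (hsm m))) (hh' i j)
    (H.memLp_hess i j) (H.weak_hess i j)⟩

end Density

/-! ### The Carleman estimate for real H² functions. -/

section RealEstimate

variable {d : ℕ} {R p lam μ₁ μ₂ A : ℝ}
  {a : Fin (d + 1) → Fin (d + 1) → (Fin (d + 1) → ℝ) → ℝ}

lemma integrable_sq_mul {n : ℕ} {f c : (Fin n → ℝ) → ℝ} (hc : ContinuousOn c (closedCube n R))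
    (hf : MemLp f 2 (volume.restrict (cube n R))) :
    Integrable (fun x => f x ^ 2 * c x) (volume.restrict (cube n R)) := by
  obtain ⟨K, -, hK⟩ := exists_bound hc
  exact hf.integrable_sq.mul_bdd (c := K) (aestronglyMeasurable_of_continuousOn hc)
    (ae_restrict_cube_of_forall fun x hx => hK x (cube_subset_closedCube hx))

lemma integral_energy_eq {n : ℕ} {u c : (Fin n → ℝ) → ℝ} {g : Fin n → (Fin n → ℝ) → ℝ}
    (hc : ContinuousOn c (closedCube n R)) (hu : MemLp u 2 (volume.restrict (cube n R)))
    (hg : ∀ i, MemLp (g i) 2 (volume.restrict (cube n R))) (l : ℝ) :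
    ∫ x in cube n R, (∑ i, g i x ^ 2 + l * u x ^ 2) * c x =
      ∑ i, (∫ x in cube n R, g i x ^ 2 * c x) + l * ∫ x in cube n R, u x ^ 2 * c x := by
  simp only [add_mul, Finset.sum_mul, mul_assoc]
  rw [integral_add (integrable_finsetSum _ fun i _ => integrable_sq_mul hc (hg i))
      ((integrable_sq_mul hc hu).const_mul l),
    integral_finsetSum _ fun i _ => integrable_sq_mul hc (hg i), integral_const_mul]

/-- The Carleman estimate for real `H²` functions. -/
theorem RealH20.carleman {u : (Fin (d + 1) → ℝ) → ℝ} {g : Fin (d + 1) → (Fin (d + 1) → ℝ) → ℝ}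
    {h : Fin (d + 1) → Fin (d + 1) → (Fin (d + 1) → ℝ) → ℝ} (H : RealH20 R u g h)
    (htop : HasRealZeroTrace R (g (Fin.last d)) (h (Fin.last d)) (Fin.last d) R)
    (hR : 1 ≤ R) (hμ : 0 < μ₁) (ha : PrincipalCoeff d R μ₁ μ₂ A a)
    (hp : 2 ≤ p) (hδ : 18 * ((d + 1 : ℕ) : ℝ) ^ 2 * A ^ 2 * (4 * R / (p - 1)) ≤ μ₁ ^ 2)
    (hlam : 1 ≤ lam) :
    μ₁ ^ 2 / 3 * lam * ∫ x in cube (d + 1) R,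
        (∑ i, g i x ^ 2 + lam ^ 2 * u x ^ 2) * weight R p lam x ≤
      ∫ x in cube (d + 1) R, (∑ i, ∑ j, a i j x * h i j x) ^ 2 * weight R p lam x := by
  have hR0 : 0 < R := by linarith
  obtain ⟨K, hK0, hK⟩ := smooth_carleman hR hμ ha hp hδ hlam
  obtain ⟨w, hw, tu, tg, th⟩ := H.exists_approximation hR0
  have hs := fun m => contDiff_of_mem_sineSpan (hw m)
  have hv := fun m => vanishesOnFaces_of_mem_sineSpan hR0 (hw m)
  have hwt : ContinuousOn (weight R p lam : (Fin (d + 1) → ℝ) → ℝ) (closedCube (d + 1) R) :=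
    continuousOn_weight hR0
  obtain ⟨Q, -, hQ⟩ := exists_bound hwt
  have hwm := aestronglyMeasurable_of_continuousOn hwt
  have hwb : ∀ᵐ x ∂(volume.restrict (cube (d + 1) R)), |weight R p lam x| ≤ Q :=
    ae_restrict_cube_of_forall fun x hx => hQ x (cube_subset_closedCube hx)
  -- The condition on ∂_z u enters here: the approximants need not satisfy it, but the integral
  -- multiplying the fixed constant K tends to zero.
  have t0 := tendsto_trace_zero hR
    (fun m => contDiff_one_of_infty (contDiff_infty_pd (k := Fin.last d) (hs m)))
    (tg (Fin.last d)) (th (Fin.last d) (Fin.last d)) htop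
  have t1 : Tendsto (fun m => ∫ x in cube (d + 1) R,
      (∑ i, pd i (w m) x ^ 2 + lam ^ 2 * w m x ^ 2) * weight R p lam x) atTop
      (𝓝 (∫ x in cube (d + 1) R, (∑ i, g i x ^ 2 + lam ^ 2 * u x ^ 2) * weight R p lam x)) := by
    rw [integral_energy_eq hwt H.memLp_val H.memLp_grad]
    refine Tendsto.congr (fun m => (integral_energy_eq hwt (tu.memLp m)
      (fun i => (tg i).memLp m) (lam ^ 2)).symm) ?_
    exact (tendsto_finsetSum _ fun i _ => (tg i).integral_sq_mul hwm hwb).add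
      ((tu.integral_sq_mul hwm hwb).const_mul _)
  have t2 : L2Tendsto (volume.restrict (cube (d + 1) R)) (fun m x => classicalL0 a (w m) x)
      (fun x => ∑ i, ∑ j, a i j x * h i j x) :=
    L2Tendsto.sum _ fun i _ => L2Tendsto.sum _ fun j _ =>
      (th i j).bdd_mul (aestronglyMeasurable_of_continuousOn (ha.contDiffOn i j).continuousOn)
        (ae_restrict_cube_of_forall fun x hx => ha.abs_le i j (cube_subset_closedCube hx))
  have t3 := (t2.integral_sq_mul hwm hwb).add (t0.const_mul K)
  rw [mul_zero, add_zero] at t3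
  exact le_of_tendsto_of_tendsto' (t1.const_mul _) t3 fun m => hK (w m) (hs m) (hv m)

end RealEstimate

/-! ### Passage to complex functions. -/

section ComplexEstimate

variable {d : ℕ} {R p lam μ₁ μ₂ A : ℝ}
  {a : Fin (d + 1) → Fin (d + 1) → (Fin (d + 1) → ℝ) → ℝ}

lemma integrable_smul_of_memLp {n : ℕ} {c : (Fin n → ℝ) → ℝ} {f : (Fin n → ℝ) → ℂ}
    (hc : Continuous c) (hf : MemLp f 2 (volume.restrict (cube n R))) :
    Integrable (fun x => c x • f x) (volume.restrict (cube n R)) := by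
  obtain ⟨K, -, hK⟩ := exists_bound (R := R) hc.continuousOn
  exact (hf.integrable (by norm_num)).bdd_smul K hc.aestronglyMeasurable
    (ae_restrict_cube_of_forall fun x hx => hK x (cube_subset_closedCube hx))

lemma IsWeakDeriv.comp {n : ℕ} (ℓ : ℂ →L[ℝ] ℝ) {k : Fin n} {u g : (Fin n → ℝ) → ℂ}
    (h : IsWeakDeriv (cube n R) k u g) (hu : MemLp u 2 (volume.restrict (cube n R)))
    (hg : MemLp g 2 (volume.restrict (cube n R))) :
    IsRealWeakDeriv R k (fun x => ℓ (u x)) (fun x => ℓ (g x)) := by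
  intro ψ h1 h2 h3
  have e := congrArg ℓ (h ψ h1 h2 h3)
  rw [map_neg, ← ℓ.integral_comp_comm (integrable_smul_of_memLp h1.continuous hg),
    ← ℓ.integral_comp_comm (integrable_smul_of_memLp (contDiff_infty_pd h1).continuous hu)] at e
  simpa only [map_smul, smul_eq_mul] using e

lemma L2Tendsto.comp {α : Type*} [MeasurableSpace α] {μ : Measure α} {ℓ : ℂ →L[ℝ] ℝ}
    (hℓ : ∀ z, |ℓ z| ≤ ‖z‖) {f : ℕ → α → ℂ} {g : α → ℂ}
    (hf : ∀ m, MemLp (fun x => ℓ (f m x)) 2 μ) (hg : MemLp (fun x => ℓ (g x)) 2 μ)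
    (h : Tendsto (fun m => eLpNorm (fun x => f m x - g x) 2 μ) atTop (𝓝 0)) :
    L2Tendsto μ (fun m x => ℓ (f m x)) (fun x => ℓ (g x)) := by
  refine ⟨hf, hg, tendsto_of_tendsto_of_tendsto_of_le_of_le tendsto_const_nhds h
    (fun _ => bot_le) fun m => ?_⟩
  refine eLpNorm_mono fun x => ?_
  rw [Pi.sub_apply, ← map_sub]
  exact hℓ _

/-- A real-linear functional of norm at most 1, here real or imaginary part, commutes with
derivatives and does not increase L² distances. -/
lemma HasTrace.comp {ℓ : ℂ →L[ℝ] ℝ} (hℓ : ∀ z, |ℓ z| ≤ ‖z‖) {w : (Fin (d + 1) → ℝ) → ℂ}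
    {dw : Fin (d + 1) → (Fin (d + 1) → ℝ) → ℂ} {i : Fin (d + 1)} {s : ℝ}
    (h : HasTrace R w dw i s 0) (hw : MemLp w 2 (volume.restrict (cube (d + 1) R)))
    (hdw : ∀ i, MemLp (dw i) 2 (volume.restrict (cube (d + 1) R))) :
    HasRealZeroTrace R (fun x => ℓ (w x)) (fun i x => ℓ (dw i x)) i s := by
  obtain ⟨φ, h1, h2, h3, h4⟩ := h
  have hc : ∀ j, ContDiff ℝ 1 fun x => ℓ (φ j x) := fun j => ℓ.contDiff.comp (h1 j)
  have hpd : ∀ j k, pd k (fun x => ℓ (φ j x)) = fun x => ℓ (pd k (φ j) x) := by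
    intro j k
    ext x
    have := (ℓ.hasFDerivAt.comp x ((h1 j).differentiable one_ne_zero x).hasFDerivAt).fderiv
    simp only [pd]
    rw [show (fun x => ℓ (φ j x)) = ℓ ∘ φ j from rfl, this]
    rfl
  refine ⟨fun j x => ℓ (φ j x), hc, ?_, fun k => ?_, ?_⟩
  · exact L2Tendsto.comp hℓ
      (fun j => memLp_of_continuousOn (hc j).continuous.continuousOn 2) (ℓ.comp_memLp' hw) h2
  · simp only [hpd]
    refine L2Tendsto.comp hℓ (fun j => ?_) (ℓ.comp_memLp' (hdw k)) (h3 k)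
    have := memLp_of_continuousOn (R := R) (continuous_pd (hc j) k).continuousOn 2
    rwa [hpd] at this
  · have := L2Tendsto.comp (μ := volume.restrict (cube d R)) hℓ
      (f := fun j y => φ j (i.insertNth (α := fun _ => ℝ) s y)) (g := fun _ => 0) (fun j =>
        memLp_of_continuousOn ((hc j).continuous.comp (continuous_insertNth i s)).continuousOn 2)
      (by simp) h4
    simpa only [map_zero] using this

namespace H2

lemma ZeroSharp.realH20 {u : H2 (cube (d + 1) R)} (hu : u.ZeroSharp) {ℓ : ℂ →L[ℝ] ℝ}
    (hℓ : ∀ z, |ℓ z| ≤ ‖z‖) :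
    RealH20 R (fun x => ℓ (u.val x)) (fun i x => ℓ (u.grad i x))
      (fun i j x => ℓ (u.hess i j x)) where
  memLp_val := ℓ.comp_memLp' u.memLp_val
  memLp_grad i := ℓ.comp_memLp' (u.memLp_grad i)
  memLp_hess i j := ℓ.comp_memLp' (u.memLp_hess i j)
  weak_grad i := (u.weak_grad i).comp ℓ u.memLp_val (u.memLp_grad i)
  weak_hess i j := (u.weak_hess i j).comp ℓ (u.memLp_grad i) (u.memLp_hess i j)
  trace i := ⟨(hu.1 i).1.comp hℓ u.memLp_val u.memLp_grad,
    (hu.1 i).2.comp hℓ u.memLp_val u.memLp_grad⟩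

/-- The coefficients are real, so the functional commutes with L₀. -/
lemma ZeroSharp.carleman_comp {u : H2 (cube (d + 1) R)} (hu : u.ZeroSharp) {ℓ : ℂ →L[ℝ] ℝ}
    (hℓ : ∀ z, |ℓ z| ≤ ‖z‖) (hR : 1 ≤ R) (hμ : 0 < μ₁) (ha : PrincipalCoeff d R μ₁ μ₂ A a)
    (hp : 2 ≤ p) (hδ : 18 * ((d + 1 : ℕ) : ℝ) ^ 2 * A ^ 2 * (4 * R / (p - 1)) ≤ μ₁ ^ 2)
    (hlam : 1 ≤ lam) :
    μ₁ ^ 2 / 3 * lam * ∫ x in cube (d + 1) R,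
        (∑ i, ℓ (u.grad i x) ^ 2 + lam ^ 2 * ℓ (u.val x) ^ 2) * weight R p lam x ≤
      ∫ x in cube (d + 1) R, ℓ (opL0 a u x) ^ 2 * weight R p lam x := by
  have key := (hu.realH20 hℓ).carleman
    (hu.2.comp hℓ (u.memLp_grad _) (u.memLp_hess _)) hR hμ ha hp hδ hlam
  have e : ∀ x, ℓ (opL0 a u x) = ∑ i, ∑ j, a i j x * ℓ (u.hess i j x) := fun x => by
    unfold opL0
    simp only [map_sum, ← Complex.real_smul, map_smul, smul_eq_mul]
  simpa only [e] using key

end H2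

lemma memLp_real_mul {n : ℕ} {c : (Fin n → ℝ) → ℝ} {f : (Fin n → ℝ) → ℂ}
    (hc : ContinuousOn c (closedCube n R)) (hf : MemLp f 2 (volume.restrict (cube n R))) :
    MemLp (fun x => (c x : ℂ) * f x) 2 (volume.restrict (cube n R)) := by
  obtain ⟨K, -, hK⟩ := exists_bound hc
  refine MemLp.of_le_mul (c := K) hf ((Complex.continuous_ofReal.comp_aestronglyMeasurable
    (aestronglyMeasurable_of_continuousOn hc)).mul hf.1)
    (ae_restrict_cube_of_forall fun x hx => ?_)
  rw [norm_mul, Complex.norm_real]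
  exact mul_le_mul_of_nonneg_right (hK x (cube_subset_closedCube hx)) (norm_nonneg _)

lemma integrable_norm_sq_mul {n : ℕ} {c : (Fin n → ℝ) → ℝ} {f : (Fin n → ℝ) → ℂ}
    (hc : ContinuousOn c (closedCube n R)) (hf : MemLp f 2 (volume.restrict (cube n R))) :
    Integrable (fun x => ‖f x‖ ^ 2 * c x) (volume.restrict (cube n R)) :=
  integrable_sq_mul hc hf.norm

lemma memLp_opL0 (ha : PrincipalCoeff d R μ₁ μ₂ A a) (u : H2 (cube (d + 1) R)) :
    MemLp (opL0 a u) 2 (volume.restrict (cube (d + 1) R)) :=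
  memLp_finsetSum _ fun i _ => memLp_finsetSum _ fun j _ =>
    memLp_real_mul (ha.contDiffOn i j).continuousOn (u.memLp_hess i j)

lemma norm_sq_eq_re_im (z : ℂ) : ‖z‖ ^ 2 = Complex.reCLM z ^ 2 + Complex.imCLM z ^ 2 := by
  rw [← Complex.normSq_eq_norm_sq, Complex.normSq_apply]
  simp only [Complex.reCLM_apply, Complex.imCLM_apply]; ring

/-- The Carleman estimate for the principal part. -/
theorem H2.ZeroSharp.carleman {u : H2 (cube (d + 1) R)} (hu : u.ZeroSharp) (hR : 1 ≤ R)
    (hμ : 0 < μ₁) (ha : PrincipalCoeff d R μ₁ μ₂ A a)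
    (hp : 2 ≤ p) (hδ : 18 * ((d + 1 : ℕ) : ℝ) ^ 2 * A ^ 2 * (4 * R / (p - 1)) ≤ μ₁ ^ 2)
    (hlam : 1 ≤ lam) :
    μ₁ ^ 2 / 3 * lam * ∫ x in cube (d + 1) R,
        (∑ i, ‖u.grad i x‖ ^ 2 + lam ^ 2 * ‖u.val x‖ ^ 2) * weight R p lam x ≤
      ∫ x in cube (d + 1) R, ‖opL0 a u x‖ ^ 2 * weight R p lam x := by
  have hR0 : 0 < R := by linarith
  have hwt : ContinuousOn (weight R p lam : (Fin (d + 1) → ℝ) → ℝ) (closedCube (d + 1) R) :=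
    continuousOn_weight hR0
  have h1 := hu.carleman_comp (ℓ := Complex.reCLM) Complex.abs_re_le_norm hR hμ ha hp hδ hlam
  have h2 := hu.carleman_comp (ℓ := Complex.imCLM) Complex.abs_im_le_norm hR hμ ha hp hδ hlam
  have hL : ∀ ℓ : ℂ →L[ℝ] ℝ, Integrable (fun x => ℓ (opL0 a u x) ^ 2 * weight R p lam x)
      (volume.restrict (cube (d + 1) R)) := fun ℓ =>
    integrable_sq_mul hwt (ℓ.comp_memLp' (memLp_opL0 ha u))
  have hG : ∀ ℓ : ℂ →L[ℝ] ℝ, Integrable (fun x => (∑ i, ℓ (u.grad i x) ^ 2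
      + lam ^ 2 * ℓ (u.val x) ^ 2) * weight R p lam x) (volume.restrict (cube (d + 1) R)) := by
    intro ℓ
    simp only [add_mul, Finset.sum_mul, mul_assoc]
    exact (integrable_finsetSum _ fun i _ => integrable_sq_mul hwt
      (ℓ.comp_memLp' (u.memLp_grad i))).add
      ((integrable_sq_mul hwt (ℓ.comp_memLp' u.memLp_val)).const_mul _)
  have e1 : ∫ x in cube (d + 1) R, ‖opL0 a u x‖ ^ 2 * weight R p lam x =
      (∫ x in cube (d + 1) R, Complex.reCLM (opL0 a u x) ^ 2 * weight R p lam x) +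
      ∫ x in cube (d + 1) R, Complex.imCLM (opL0 a u x) ^ 2 * weight R p lam x := by
    rw [← integral_add (hL _) (hL _)]
    congr 1; ext x; rw [norm_sq_eq_re_im]; ring
  have e2 : ∫ x in cube (d + 1) R,
        (∑ i, ‖u.grad i x‖ ^ 2 + lam ^ 2 * ‖u.val x‖ ^ 2) * weight R p lam x =
      (∫ x in cube (d + 1) R, (∑ i, Complex.reCLM (u.grad i x) ^ 2
        + lam ^ 2 * Complex.reCLM (u.val x) ^ 2) * weight R p lam x) +
      ∫ x in cube (d + 1) R, (∑ i, Complex.imCLM (u.grad i x) ^ 2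
        + lam ^ 2 * Complex.imCLM (u.val x) ^ 2) * weight R p lam x := by
    rw [← integral_add (hG _) (hG _)]
    congr 1; ext x
    simp only [norm_sq_eq_re_im, Finset.sum_add_distrib]; ring
  rw [e1, e2, mul_add]
  exact add_le_add h1 h2

end ComplexEstimate

/-! ### Lower order terms and the system. -/

section System

variable {d : ℕ} {R p lam μ₁ μ₂ A : ℝ}
  {a : Fin (d + 1) → Fin (d + 1) → (Fin (d + 1) → ℝ) → ℝ}

/-- A linear combination with bounded coefficients is controlled by the squares of its terms. -/
lemma norm_sum_mul_sq_le {ι : Type*} [Fintype ι] {c : ι → ℂ} {f : ι → ℂ} {K : ℝ}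
    (hc : ∀ i, ‖c i‖ ≤ K) :
    ‖∑ i, c i * f i‖ ^ 2 ≤ Fintype.card ι * K ^ 2 * ∑ i, ‖f i‖ ^ 2 := by
  have h1 : ‖∑ i, c i * f i‖ ≤ ∑ i, K * ‖f i‖ := by
    refine (norm_sum_le _ _).trans (Finset.sum_le_sum fun i _ => ?_)
    rw [norm_mul]; exact mul_le_mul_of_nonneg_right (hc i) (norm_nonneg _)
  refine (pow_le_pow_left₀ (norm_nonneg _) h1 2).trans ?_
  refine (sq_sum_le_card_mul_sum_sq).trans (le_of_eq ?_)
  simp only [mul_pow, ← Finset.mul_sum, Finset.card_univ]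
  ring

/-- The lower order terms of the system. -/
def lowerOrder {n : ℕ} {Ω : Set (Fin n → ℝ)} {N : ℕ} (S : Fin N → Fin N → ℝ)
    (b : Fin n → (Fin n → ℝ) → ℝ) (c nn : (Fin n → ℝ) → ℝ) (W : Fin N → H2 Ω)
    (x : Fin n → ℝ) (m : Fin N) : ℂ :=
  ∑ i, (b i x : ℂ) * (W m).grad i x + (c x : ℂ) * (W m).val x
    + ∑ r, ((S m r * nn x ^ 2 : ℝ) : ℂ) * (W r).val x

lemma opSystem_eq {n : ℕ} {Ω : Set (Fin n → ℝ)} {N : ℕ} (k₁ k₂ : ℝ)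
    (a : Fin n → Fin n → (Fin n → ℝ) → ℝ)
    (b : Fin n → (Fin n → ℝ) → ℝ) (c nn : (Fin n → ℝ) → ℝ) (W : Fin N → H2 Ω)
    (x : Fin n → ℝ) (m : Fin N) :
    opSystem k₁ k₂ a b c nn W x m = opL0 a (W m) x
      + lowerOrder (fun m r => ((matD k₁ k₂ N)⁻¹ * matS k₁ k₂ N) m r) b c nn W x m := by
  unfold opSystem opL lowerOrder
  push_cast
  ring

lemma norm_add_three_sq_le {E : Type*} [SeminormedAddCommGroup E] (X Y Z : E) :
    ‖X + Y + Z‖ ^ 2 ≤ 3 * (‖X‖ ^ 2 + ‖Y‖ ^ 2 + ‖Z‖ ^ 2) := by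
  refine (pow_le_pow_left₀ (norm_nonneg _) (norm_add₃_le (a := X) (b := Y) (c := Z)) 2).trans ?_
  nlinarith [sq_nonneg (‖X‖ - ‖Y‖), sq_nonneg (‖X‖ - ‖Z‖), sq_nonneg (‖Y‖ - ‖Z‖)]

lemma norm_lowerOrder_sq_le {n : ℕ} {Ω : Set (Fin n → ℝ)} {N : ℕ} {S : Fin N → Fin N → ℝ}
    {b : Fin n → (Fin n → ℝ) → ℝ} {c nn : (Fin n → ℝ) → ℝ} (W : Fin N → H2 Ω) {x : Fin n → ℝ}
    {B C M D : ℝ} (hD0 : 0 ≤ D)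
    (hB : ∀ i, |b i x| ≤ B) (hC : |c x| ≤ C) (hM : |nn x| ≤ M) (hD : ∀ m r, |S m r| ≤ D)
    (m : Fin N) :
    ‖lowerOrder S b c nn W x m‖ ^ 2 ≤ 3 * (n * B ^ 2 * ∑ i, ‖(W m).grad i x‖ ^ 2
      + C ^ 2 * ‖(W m).val x‖ ^ 2 + N * (D * M ^ 2) ^ 2 * ∑ r, ‖(W r).val x‖ ^ 2) := by
  have h1 : ‖∑ i, (b i x : ℂ) * (W m).grad i x‖ ^ 2 ≤
      n * B ^ 2 * ∑ i, ‖(W m).grad i x‖ ^ 2 := by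
    have := norm_sum_mul_sq_le (c := fun i => (b i x : ℂ)) (f := fun i => (W m).grad i x)
      (K := B) (fun i => by rw [Complex.norm_real, Real.norm_eq_abs]; exact hB i)
    rwa [Fintype.card_fin] at this
  have h2 : ‖(c x : ℂ) * (W m).val x‖ ^ 2 ≤ C ^ 2 * ‖(W m).val x‖ ^ 2 := by
    rw [norm_mul, mul_pow, Complex.norm_real, Real.norm_eq_abs]
    exact mul_le_mul_of_nonneg_right (pow_le_pow_left₀ (abs_nonneg _) hC 2) (sq_nonneg _)
  have h3 : ‖∑ r, ((S m r * nn x ^ 2 : ℝ) : ℂ) * (W r).val x‖ ^ 2 ≤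
      N * (D * M ^ 2) ^ 2 * ∑ r, ‖(W r).val x‖ ^ 2 := by
    have hk : ∀ r, ‖((S m r * nn x ^ 2 : ℝ) : ℂ)‖ ≤ D * M ^ 2 := fun r => by
      rw [Complex.norm_real, Real.norm_eq_abs, abs_mul, abs_pow]
      exact mul_le_mul (hD m r) (pow_le_pow_left₀ (abs_nonneg _) hM 2)
        (pow_nonneg (abs_nonneg _) 2) hD0
    have := norm_sum_mul_sq_le (f := fun r => (W r).val x) hk
    rwa [Fintype.card_fin] at this
  exact (norm_add_three_sq_le _ _ _).trans
    (mul_le_mul_of_nonneg_left (add_le_add (add_le_add h1 h2) h3) (by norm_num))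

lemma sum_norm_lowerOrder_sq_le {n : ℕ} {Ω : Set (Fin n → ℝ)} {N : ℕ} {S : Fin N → Fin N → ℝ}
    {b : Fin n → (Fin n → ℝ) → ℝ} {c nn : (Fin n → ℝ) → ℝ} (W : Fin N → H2 Ω) {x : Fin n → ℝ}
    {B C M D : ℝ} (hD0 : 0 ≤ D)
    (hB : ∀ i, |b i x| ≤ B) (hC : |c x| ≤ C) (hM : |nn x| ≤ M) (hD : ∀ m r, |S m r| ≤ D) :
    ∑ m, ‖lowerOrder S b c nn W x m‖ ^ 2 ≤
      3 * (n * B ^ 2 + C ^ 2 + N * (N * (D * M ^ 2) ^ 2)) *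
        (∑ m, ∑ i, ‖(W m).grad i x‖ ^ 2 + ∑ m, ‖(W m).val x‖ ^ 2) := by
  refine (Finset.sum_le_sum fun m _ => norm_lowerOrder_sq_le W hD0 hB hC hM hD m).trans ?_
  rw [← Finset.mul_sum, Finset.sum_add_distrib, Finset.sum_add_distrib, ← Finset.mul_sum,
    ← Finset.mul_sum, Finset.sum_const, Finset.card_univ, Fintype.card_fin, nsmul_eq_mul]
  have hV0 : 0 ≤ ∑ m, ‖(W m).val x‖ ^ 2 := Finset.sum_nonneg fun _ _ => sq_nonneg _
  have hG0 : 0 ≤ ∑ m, ∑ i, ‖(W m).grad i x‖ ^ 2 :=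
    Finset.sum_nonneg fun m _ => Finset.sum_nonneg fun _ _ => sq_nonneg _
  generalize ∑ m, ‖(W m).val x‖ ^ 2 = V at *
  generalize ∑ m, ∑ i, ‖(W m).grad i x‖ ^ 2 = G at *
  have q1 := mul_nonneg (mul_nonneg (Nat.cast_nonneg (α := ℝ) n) (sq_nonneg B)) hV0
  have q2 := mul_nonneg (sq_nonneg C) hG0
  have q3 := mul_nonneg (mul_nonneg (Nat.cast_nonneg (α := ℝ) N)
    (mul_nonneg (Nat.cast_nonneg (α := ℝ) N) (sq_nonneg (D * M ^ 2)))) hG0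
  -- The three nonnegative products are exactly the cross terms added on enlarging to a common
  -- constant.
  linear_combination 3 * (q1 + q2 + q3)

lemma memLp_lowerOrder {N : ℕ} {S : Fin N → Fin N → ℝ}
    {b : Fin (d + 1) → (Fin (d + 1) → ℝ) → ℝ} {c nn : (Fin (d + 1) → ℝ) → ℝ}
    (hb : ∀ i, ContinuousOn (b i) (closedCube (d + 1) R))
    (hc : ContinuousOn c (closedCube (d + 1) R)) (hn : ContinuousOn nn (closedCube (d + 1) R))
    (W : Fin N → H2 (cube (d + 1) R)) (m : Fin N) :
    MemLp (fun x => lowerOrder S b c nn W x m) 2 (volume.restrict (cube (d + 1) R)) :=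
  ((memLp_finsetSum _ fun i _ => memLp_real_mul (hb i) ((W m).memLp_grad i)).add
    (memLp_real_mul hc (W m).memLp_val)).add
    (memLp_finsetSum _ fun r _ => memLp_real_mul (continuousOn_const.mul (hn.pow 2))
      (W r).memLp_val)

/-- The Carleman estimate for the principal part is stable under lower order perturbations. -/
theorem carleman_system (hR : 1 ≤ R) (hμ : 0 < μ₁) (ha : PrincipalCoeff d R μ₁ μ₂ A a)
    (hp : 2 ≤ p) (hδ : 18 * ((d + 1 : ℕ) : ℝ) ^ 2 * A ^ 2 * (4 * R / (p - 1)) ≤ μ₁ ^ 2)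
    (hlam : 1 ≤ lam) {N : ℕ} {S : Fin N → Fin N → ℝ}
    {b : Fin (d + 1) → (Fin (d + 1) → ℝ) → ℝ} {c nn : (Fin (d + 1) → ℝ) → ℝ}
    (hb : ∀ i, ContinuousOn (b i) (closedCube (d + 1) R))
    (hc : ContinuousOn c (closedCube (d + 1) R)) (hn : ContinuousOn nn (closedCube (d + 1) R))
    {B C M D : ℝ} (hD0 : 0 ≤ D) (hB : ∀ i, cNorm R (b i) ≤ B) (hC : cNorm R c ≤ C)
    (hM : cNorm R nn ≤ M) (hD : ∀ m r, |S m r| ≤ D)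
    (hbig : 3 * ((d + 1 : ℕ) * B ^ 2 + C ^ 2 + N * (N * (D * M ^ 2) ^ 2)) ≤ μ₁ ^ 2 / 12 * lam)
    (W : Fin N → H2 (cube (d + 1) R)) (hW : ∀ m, (W m).ZeroSharp) :
    μ₁ ^ 2 / 12 * lam * ∫ x in cube (d + 1) R,
        (∑ m, ∑ i, ‖(W m).grad i x‖ ^ 2 + lam ^ 2 * ∑ m, ‖(W m).val x‖ ^ 2) * weight R p lam x ≤
      ∫ x in cube (d + 1) R,
        (∑ m, ‖opL0 a (W m) x + lowerOrder S b c nn W x m‖ ^ 2) * weight R p lam x := by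
  have hR0 : 0 < R := by linarith
  have hwt : ContinuousOn (weight R p lam : (Fin (d + 1) → ℝ) → ℝ) (closedCube (d + 1) R) :=
    continuousOn_weight hR0
  have hg : ∀ m, Integrable (fun x => (∑ i, ‖(W m).grad i x‖ ^ 2 + lam ^ 2 * ‖(W m).val x‖ ^ 2)
      * weight R p lam x) (volume.restrict (cube (d + 1) R)) := by
    intro m
    simp only [add_mul, Finset.sum_mul, mul_assoc]
    exact (integrable_finsetSum _ fun i _ => integrable_norm_sq_mul hwt ((W m).memLp_grad i)).add
      ((integrable_norm_sq_mul hwt (W m).memLp_val).const_mul _)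
  have hL : ∀ m, Integrable (fun x => ‖opL0 a (W m) x‖ ^ 2 * weight R p lam x)
      (volume.restrict (cube (d + 1) R)) := fun m =>
    integrable_norm_sq_mul hwt (memLp_opL0 ha (W m))
  have hS : ∀ m, Integrable (fun x => ‖opL0 a (W m) x + lowerOrder S b c nn W x m‖ ^ 2
      * weight R p lam x) (volume.restrict (cube (d + 1) R)) := fun m =>
    integrable_norm_sq_mul hwt ((memLp_opL0 ha (W m)).add (memLp_lowerOrder hb hc hn W m))
  set E := ∫ x in cube (d + 1) R,
    (∑ m, ∑ i, ‖(W m).grad i x‖ ^ 2 + lam ^ 2 * ∑ m, ‖(W m).val x‖ ^ 2) * weight R p lam x with hE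
  have eE : ∀ x, (∑ m, ∑ i, ‖(W m).grad i x‖ ^ 2 + lam ^ 2 * ∑ m, ‖(W m).val x‖ ^ 2)
      * weight R p lam x = ∑ m, (∑ i, ‖(W m).grad i x‖ ^ 2 + lam ^ 2 * ‖(W m).val x‖ ^ 2)
      * weight R p lam x := by
    intro x
    rw [← Finset.sum_mul, Finset.sum_add_distrib, Finset.mul_sum]
  have hEi : Integrable (fun x => (∑ m, ∑ i, ‖(W m).grad i x‖ ^ 2
      + lam ^ 2 * ∑ m, ‖(W m).val x‖ ^ 2) * weight R p lam x)
      (volume.restrict (cube (d + 1) R)) := by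
    simp only [eE]; exact integrable_finsetSum _ fun m _ => hg m
  have h1 : μ₁ ^ 2 / 3 * lam * E ≤
      ∑ m, ∫ x in cube (d + 1) R, ‖opL0 a (W m) x‖ ^ 2 * weight R p lam x := by
    rw [hE]
    simp only [eE]
    rw [integral_finsetSum _ fun m _ => hg m, Finset.mul_sum]
    exact Finset.sum_le_sum fun m _ => (hW m).carleman hR hμ ha hp hδ hlam
  -- This rests on |P + Q|² ≥ |P|²/2 − |Q|². Half of μ₁²/3 is μ₁²/6; the lower order terms take
  -- μ₁²/12 of it and μ₁²/12 remains.
  have h2 : ∫ x in cube (d + 1) R, ((1 / 2) * (∑ m, ‖opL0 a (W m) x‖ ^ 2 * weight R p lam x)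
      - μ₁ ^ 2 / 12 * lam * ((∑ m, ∑ i, ‖(W m).grad i x‖ ^ 2
        + lam ^ 2 * ∑ m, ‖(W m).val x‖ ^ 2) * weight R p lam x)) ≤
      ∫ x in cube (d + 1) R,
        (∑ m, ‖opL0 a (W m) x + lowerOrder S b c nn W x m‖ ^ 2) * weight R p lam x := by
    refine setIntegral_mono_on (((integrable_finsetSum _ fun m _ => hL m).const_mul _).sub
      (hEi.const_mul _)) ?_ measurableSet_cube fun x hx => ?_
    · simp only [Finset.sum_mul]
      exact integrable_finsetSum _ fun m _ => hS m
    · have hxc := cube_subset_closedCube hx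
      have hw0 : 0 < weight R p lam x := Real.exp_pos _
      have k1 := sum_norm_lowerOrder_sq_le W hD0
        (fun i => (abs_le_cNorm (hb i) hxc).trans (hB i)) ((abs_le_cNorm hc hxc).trans hC)
        ((abs_le_cNorm hn hxc).trans hM) hD
      have hG0 : 0 ≤ ∑ m, ∑ i, ‖(W m).grad i x‖ ^ 2 :=
        Finset.sum_nonneg fun _ _ => Finset.sum_nonneg fun _ _ => sq_nonneg _
      have hV0 : 0 ≤ ∑ m, ‖(W m).val x‖ ^ 2 := Finset.sum_nonneg fun _ _ => sq_nonneg _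
      have k2 : ∑ m, ‖lowerOrder S b c nn W x m‖ ^ 2 ≤ μ₁ ^ 2 / 12 * lam *
          (∑ m, ∑ i, ‖(W m).grad i x‖ ^ 2 + lam ^ 2 * ∑ m, ‖(W m).val x‖ ^ 2) := by
        refine k1.trans (mul_le_mul hbig ?_ (by positivity) (by positivity))
        have : 1 ≤ lam ^ 2 := one_le_pow₀ hlam
        nlinarith
      have k3 : (1 / 2) * ∑ m, ‖opL0 a (W m) x‖ ^ 2 - ∑ m, ‖lowerOrder S b c nn W x m‖ ^ 2 ≤
          ∑ m, ‖opL0 a (W m) x + lowerOrder S b c nn W x m‖ ^ 2 := by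
        rw [Finset.mul_sum, ← Finset.sum_sub_distrib]
        refine Finset.sum_le_sum fun m _ => ?_
        set P := opL0 a (W m) x
        set Q := lowerOrder S b c nn W x m
        have h4 : ‖P‖ ≤ ‖P + Q‖ + ‖Q‖ := by
          have := norm_sub_le (P + Q) Q
          rwa [add_sub_cancel_right] at this
        have h5 := pow_le_pow_left₀ (norm_nonneg _) h4 2
        nlinarith [sq_nonneg (‖P + Q‖ - ‖Q‖)]
      rw [← Finset.sum_mul, ← mul_assoc, ← mul_assoc, ← sub_mul]
      exact mul_le_mul_of_nonneg_right (by linarith) hw0.le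
  rw [integral_sub ((integrable_finsetSum _ fun m _ => hL m).const_mul _) (hEi.const_mul _),
    integral_const_mul, integral_const_mul, integral_finsetSum _ fun m _ => hL m, ← hE] at h2
  linarith

end System

end Carleman

end

/-! ### Choice of the constants. -/

theorem corollary4p1 (d : ℕ) (R μ₁ μ₂ A : ℝ) (hR : 1 ≤ R) (hμ₁ : 0 < μ₁) (hμ : μ₁ ≤ μ₂) :
    -- `p₀`, `lam₀`, `C₃` depend only on `n = d + 1`, `R`, `μ₁`, `μ₂`, `A`
    ∃ p₀ lam₀ C₃ : ℝ, 1 < p₀ ∧ 1 < lam₀ ∧ 0 < C₃ ∧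
      -- `p₀` and `lam₀` are admissible in the Carleman estimate for `L₀` with `b = 3R`
      (∀ p ≥ p₀, ∃ C₂ > 0, ∀ a, Carleman.PrincipalCoeff d R μ₁ μ₂ A a →
        ∀ lam ≥ lam₀, ∀ u : Carleman.H2 (Carleman.cube (d + 1) R), u.ZeroSharp →
          ∫ x in Carleman.cube (d + 1) R,
              ‖Carleman.opL0 a u x‖ ^ 2 * Carleman.weight R p lam x ≥
            C₂ * lam * ∫ x in Carleman.cube (d + 1) R,
              (∑ i, ‖u.grad i x‖ ^ 2 + lam ^ 2 * ‖u.val x‖ ^ 2) *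
                Carleman.weight R p lam x) ∧
      -- the Carleman estimate for the full system
      ∀ (B C M k₁ k₂ : ℝ) (N : ℕ), 0 < k₁ → k₁ < k₂ → 1 ≤ N →
        ∃ lam₁ ≥ lam₀, ∀ a b c nn, Carleman.PrincipalCoeff d R μ₁ μ₂ A a →
          (∀ i, ContinuousOn (b i) (Carleman.closedCube (d + 1) R)) →
          ContinuousOn c (Carleman.closedCube (d + 1) R) →
          ContinuousOn nn (Carleman.closedCube (d + 1) R) →
          (∀ i, Carleman.cNorm R (b i) ≤ B) → Carleman.cNorm R c ≤ C →
          Carleman.cNorm R nn ≤ M →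
          ∀ lam ≥ lam₁, ∀ W : Fin N → Carleman.H2 (Carleman.cube (d + 1) R),
            (∀ m, (W m).ZeroSharp) →
            ∫ x in Carleman.cube (d + 1) R,
                (∑ m, ‖Carleman.opSystem k₁ k₂ a b c nn W x m‖ ^ 2) *
                  Carleman.weight R p₀ lam x ≥
              C₃ * lam * ∫ x in Carleman.cube (d + 1) R,
                (∑ m, ∑ i, ‖(W m).grad i x‖ ^ 2 + lam ^ 2 * ∑ m, ‖(W m).val x‖ ^ 2) *
                  Carleman.weight R p₀ lam x := by
  have hR0 : 0 < R := by linarith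
  have hμ2 : 0 < μ₁ ^ 2 := by positivity
  -- The smallness condition for δ = 4R/(p − 1) asks p − 1 ≥ 18 · 4R(d + 1)²A²/μ₁², and 72 = 18 · 4;
  -- the summand 2 secures p ≥ 2.
  set p₀ : ℝ := 2 + 72 * R * (d + 1) ^ 2 * A ^ 2 / μ₁ ^ 2 with hp₀
  have hp₀2 : 2 ≤ p₀ := by
    have : 0 ≤ 72 * R * (d + 1) ^ 2 * A ^ 2 / μ₁ ^ 2 := by positivity
    linarith
  have hδ : ∀ p ≥ p₀, 18 * ((d + 1 : ℕ) : ℝ) ^ 2 * A ^ 2 * (4 * R / (p - 1)) ≤ μ₁ ^ 2 := by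
    intro p hp
    have h1 : 0 < p - 1 := by linarith
    have h2 : 72 * R * (d + 1) ^ 2 * A ^ 2 / μ₁ ^ 2 ≤ p - 1 := by linarith
    rw [div_le_iff₀ hμ2] at h2
    rw [← mul_div_assoc, div_le_iff₀ h1]
    push_cast
    linarith
  -- The estimates hold for all λ ≥ 1; the value 2 only meets the strict inequality λ₀ > 1.
  refine ⟨p₀, 2, μ₁ ^ 2 / 12, by linarith, by norm_num, by positivity, ?_, ?_⟩
  · intro p hp
    exact ⟨μ₁ ^ 2 / 3, by positivity, fun a ha lam hlam u hu =>
      hu.carleman hR hμ₁ ha (hp₀2.trans hp) (hδ p hp) (by linarith)⟩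
  · intro B C M k₁ k₂ N _ _ _
    set S : Fin N → Fin N → ℝ :=
      fun m r => ((Carleman.matD k₁ k₂ N)⁻¹ * Carleman.matS k₁ k₂ N) m r with hS
    -- A bound for all entries that depends on the wave number interval and N alone.
    set D : ℝ := ∑ m, ∑ r, |S m r| with hD
    have hD0 : 0 ≤ D := Finset.sum_nonneg fun _ _ => Finset.sum_nonneg fun _ _ => abs_nonneg _
    have hSD : ∀ m r, |S m r| ≤ D := fun m r =>
      (Finset.single_le_sum (f := fun r => |S m r|) (fun _ _ => abs_nonneg _)
        (Finset.mem_univ r)).trans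
        (Finset.single_le_sum (f := fun m => ∑ r, |S m r|)
          (fun _ _ => Finset.sum_nonneg fun _ _ => abs_nonneg _) (Finset.mem_univ m))
    set Q : ℝ := 3 * ((d + 1 : ℕ) * B ^ 2 + C ^ 2 + N * (N * (D * M ^ 2) ^ 2)) with hQ
    -- Beyond this threshold the lower order constant Q is at most μ₁²λ/12, the share reserved for
    -- it.
    refine ⟨max 2 (12 / μ₁ ^ 2 * Q), le_max_left _ _, ?_⟩
    intro a b c nn ha hb hc hn hB hC hM lam hlam W hW
    have h2 : 2 ≤ lam := (le_max_left _ _).trans hlam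
    have hbig : Q ≤ μ₁ ^ 2 / 12 * lam := by
      have h3 : 12 / μ₁ ^ 2 * Q ≤ lam := (le_max_right _ _).trans hlam
      rw [div_mul_eq_mul_div, div_le_iff₀ hμ2] at h3
      linarith
    simp only [Carleman.opSystem_eq]
    exact Carleman.carleman_system hR hμ₁ ha hp₀2 (hδ p₀ le_rfl) (by linarith) hb hc hn hD0
      hB hC hM hSD hbig W hW
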